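/- Let $\mathbb D\subset\mathbb C$ be the open unit disk, $\overline{\mathbb D}$ the closed unit disk with its usual structure of smooth surface with boundary, and $\widehat{\mathbb C}$ the Riemann sphere. For a Riemann surface $U$ and a conformal isomorphism $\phi:U\to\mathbb D$, let $\widehat U_\phi$ be the metric completion of $U$ for the Euclidean metric of $\mathbb D$ pulled back by $\phi$, with the smooth structure for which the continuous extension $\widehat U_\phi\to\overline{\mathbb D}$ of $\phi$ is a diffeomorphism. (1) Let $U$ be a Riemann surface which is conformally isomorphic to $\mathbb D$. For every conformal isomorphism $\phi:U\to\mathbb D$ the space $\widehat U_\phi$ is compact, and the canonical map $U\to\widehat U_\phi$ is an open topological embedding and a smooth local diffeomorphism, with dense image whose complement is the manifold boundary $\partial\widehat U_\phi$. Every conformal isomorphism $\psi:U\to\mathbb D$ extends to a diffeomorphism $\widehat U_\phi\to\overline{\mathbb D}$, and there is a unique diffeomorphism $\widehat U_\phi\to\widehat U_\psi$ which restricts to the identity on $U$. Thus $\widehat U=\widehat U_\phi$ (the ideal compactification of $U$) does not depend on the choice of $\phi$. (2) If $U$ and $U'$ are two such Riemann surfaces, then every proper holomorphic map $U\to U'$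 extends to a smooth map $\widehat U\to\widehat U'$. (3) Let moreover $U$ be an open subset of $\widehat{\mathbb C}$. A crosscut of $U$ is an open arc $A\subset U$ whose closure in $\widehat{\mathbb C}$ is homeomorphic to a closed interval, with its two endpoints in the topological boundary $\partial U\subset\widehat{\mathbb C}$. A fundamental chain is a nested sequence $N_0\supseteq N_1\supseteq\cdots$, where $N_j$ is a connected component of $U\smallsetminus A_j$ for some crosscuts $A_j$ with pairwise disjoint closures and with spherical diameters tending to zero. Two chains $(N_j)$, $(N'_j)$ are equivalent if every $N_j$ contains some $N'_k$ and every $N'_j$ contains some $N_k$. A prime end of $U$ is an equivalence class of fundamental chains. Then there is a bijection $\beta$ from the set of prime ends of $U$ onto the ideal boundary $\partial\widehat U$ such that, for every fundamental chain $(N_j)$ representing a prime end $E$, the intersection over all $j$ of the closures of $N_j$ in $\widehat U$ is exactly $\{\beta(E)\}$. (4) Let $U$ be as in (3). If the topological boundary $\partial U\subset\widehat{\mathbb C}$ is locally connected, then the identity map of $U$ extends to a continuous map from $\widehat U$ onto the topological closure $\overline U\subset\widehat{\mathbb C}$. -/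

import Mathlib

open Set Filter Topology
open scoped Manifold ContDiff

universe u v

noncomputable section

namespace IdealBoundary

/-! ### The closed disk as a smooth surface with boundary -/

/-- The closed unit disk in the complex plane. -/
abbrev ClosedDisk : Type := ↥(Metric.closedBall (0 : ℂ) 1)

/-- The open unit disk, an open subset of the complex plane (hence a Riemann surface). -/
abbrev Disk : TopologicalSpace.Opens ℂ := ⟨Metric.ball (0 : ℂ) 1, Metric.isOpen_ball⟩

/-- The radial retraction of the plane onto the closed unit disk. -/
def radialRetraction (z : ℂ) : ClosedDisk :=
  ⟨((max 1 ‖z‖)⁻¹ : ℝ) • z, by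
    have h1 : (0 : ℝ) < max 1 ‖z‖ := lt_max_of_lt_left one_pos
    rw [mem_closedBall_zero_iff, norm_smul, norm_inv, Real.norm_of_nonneg h1.le,
      inv_mul_le_iff₀ h1, mul_one]
    exact le_max_right _ _⟩

theorem continuous_radialRetraction : Continuous radialRetraction := by
  have h : Continuous fun z : ℂ => (max 1 ‖z‖)⁻¹ :=
    (continuous_const.max continuous_norm).inv₀
      fun z => (lt_max_of_lt_left one_pos : (0 : ℝ) < max 1 ‖z‖).ne'
  exact Continuous.subtype_mk (h.smul continuous_id) _

theorem radialRetraction_coe (z : ClosedDisk) : radialRetraction (z : ℂ) = z := by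
  have hz : ‖(z : ℂ)‖ ≤ 1 := mem_closedBall_zero_iff.1 z.2
  apply Subtype.ext
  simp [radialRetraction, max_eq_left hz]

/-- The closed disk as a model for smooth real surfaces with boundary. A map between subsets of
the closed disk is smooth with respect to this model when it is smooth, in the sense of real
calculus and up to the boundary circle, as a map between subsets of the plane. The manifold
boundary of the closed disk in this model is the unit circle. -/
def diskModel : ModelWithCorners ℝ ℂ ClosedDisk :=
  ModelWithCorners.ofConvexRange
    { toFun := Subtype.val
      invFun := radialRetraction
      source := univ
      target := Metric.closedBall (0 : ℂ) 1
      map_source' := fun z _ => z.2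
      map_target' := fun _ _ => mem_univ _
      left_inv' := fun z _ => radialRetraction_coe z
      right_inv' := fun z hz => congrArg Subtype.val (radialRetraction_coe ⟨z, hz⟩) }
    rfl
    (convex_closedBall (0 : ℂ) 1)
    continuous_subtype_val
    continuous_radialRetraction
    (by
      rw [interior_closedBall (0 : ℂ) one_ne_zero]
      exact ⟨0, Metric.mem_ball_self one_pos⟩)

/-! ### The ideal compactification -/

section Compactification

variable {U : Type u} [TopologicalSpace U] [ChartedSpace ℂ U]

variable (U) in
/-- Conformal isomorphisms from a Riemann surface onto the open unit disk. -/
abbrev ConformalIso : Type u := Diffeomorph 𝓘(ℂ) 𝓘(ℂ) U Disk ω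

/-- A conformal isomorphism onto the open disk, as a map into the closed disk. -/
def toClosedDisk (φ : ConformalIso U) (x : U) : ClosedDisk :=
  ⟨(φ x : ℂ), Metric.ball_subset_closedBall (φ x).2⟩

theorem toClosedDisk_injective (φ : ConformalIso U) : Function.Injective (toClosedDisk φ) :=
  fun _ _ h => φ.injective (Subtype.ext (congrArg (fun z : ClosedDisk => (z : ℂ)) h))

theorem denseRange_toClosedDisk (φ : ConformalIso U) : DenseRange (toClosedDisk φ) := by
  intro z
  rw [Topology.IsInducing.subtypeVal.closure_eq_preimage_closure_image, mem_preimage]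
  have h : Subtype.val '' range (toClosedDisk φ) = Metric.ball (0 : ℂ) 1 := by
    ext w
    constructor
    · rintro ⟨_, ⟨x, rfl⟩, rfl⟩
      exact (φ x).2
    · intro hw
      obtain ⟨x, hx⟩ := φ.toEquiv.surjective ⟨w, hw⟩
      exact ⟨_, ⟨x, rfl⟩, congrArg Subtype.val hx⟩
  rw [h, closure_ball (0 : ℂ) one_ne_zero]
  exact z.2

/-- The surface `U` with the metric obtained by pulling back the Euclidean metric of the unit disk
by a conformal isomorphism. -/
def PulledBack (_ : ConformalIso U) : Type u := U

instance (φ : ConformalIso U) : MetricSpace (PulledBack φ) :=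
  MetricSpace.induced (toClosedDisk (U := U) φ) (toClosedDisk_injective φ) inferInstance

/-- The ideal compactification of `U`: the metric completion of `U` with respect to the Euclidean
metric of the unit disk, pulled back by a conformal isomorphism. -/
abbrev IdealCompactification (φ : ConformalIso U) : Type u :=
  UniformSpace.Completion (PulledBack φ)

/-- The canonical map of `U` into its ideal compactification. -/
def embed (φ : ConformalIso U) (x : U) : IdealCompactification φ :=
  UniformSpace.Completion.coe' (α := PulledBack φ) x

/-- The closed disk as a completion of `U`. -/
def diskPackage (φ : ConformalIso U) : AbstractCompletion.{0} (PulledBack φ) where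
  space := ClosedDisk
  coe := toClosedDisk (U := U) φ
  uniformStruct := inferInstance
  complete := inferInstance
  separation := inferInstance
  isUniformInducing := ⟨rfl⟩
  dense := denseRange_toClosedDisk φ

/-- The extension of a conformal isomorphism `U → 𝔻` to a homeomorphism from the completion of `U`
onto the closed disk. -/
def idealChart (φ : ConformalIso U) : IdealCompactification φ ≃ₜ ClosedDisk :=
  let c := UniformSpace.Completion.cPkg (α := PulledBack φ)
  { toFun := c.compare (diskPackage φ)
    invFun := (diskPackage φ).compare c
    left_inv := congrFun ((diskPackage φ).inverse_compare c)
    right_inv := congrFun (c.inverse_compare (diskPackage φ))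
    continuous_toFun :=
      letI := c.uniformStruct
      letI := (diskPackage φ).uniformStruct
      (c.uniformContinuous_compare (diskPackage φ)).continuous
    continuous_invFun :=
      letI := c.uniformStruct
      letI := (diskPackage φ).uniformStruct
      ((diskPackage φ).uniformContinuous_compare c).continuous }

theorem idealChart_embed (φ : ConformalIso U) (x : U) :
    idealChart φ (embed φ x) = toClosedDisk φ x :=
  AbstractCompletion.compare_coe (UniformSpace.Completion.cPkg (α := PulledBack φ))
    (diskPackage φ) x

/-- The smooth structure of the ideal compactification: the one of the closed disk, transported
by `idealChart`. -/
instance (φ : ConformalIso U) : ChartedSpace ClosedDisk (IdealCompactification φ) :=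
  (idealChart φ).toOpenPartialHomeomorph.singletonChartedSpace rfl

instance (φ : ConformalIso U) : IsManifold diskModel ∞ (IdealCompactification φ) :=
  have := (idealChart φ).toOpenPartialHomeomorph.singleton_hasGroupoid rfl
    (contDiffGroupoid ∞ diskModel)
  IsManifold.mk' _ _ _

end Compactification

/-! ### The Riemann sphere -/

/-- The Riemann sphere `ℂ ∪ {∞}`. -/
abbrev RiemannSphere : Type := OnePoint ℂ

/-- The map `z ↦ 1 / z` of the Riemann sphere. -/
def sphereInv (p : RiemannSphere) : RiemannSphere :=
  p.elim ((0 : ℂ) : OnePoint ℂ)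
    fun z => if z = 0 then OnePoint.infty else ((z⁻¹ : ℂ) : OnePoint ℂ)

theorem sphereInv_infty : sphereInv OnePoint.infty = ((0 : ℂ) : OnePoint ℂ) := rfl

theorem sphereInv_zero : sphereInv ((0 : ℂ) : OnePoint ℂ) = OnePoint.infty := by
  simp [sphereInv]

theorem sphereInv_coe {z : ℂ} (hz : z ≠ 0) :
    sphereInv (z : OnePoint ℂ) = ((z⁻¹ : ℂ) : OnePoint ℂ) := by
  simp [sphereInv, hz]

theorem sphereInv_sphereInv (p : RiemannSphere) : sphereInv (sphereInv p) = p := by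
  induction p using OnePoint.rec with
  | infty => rw [sphereInv_infty, sphereInv_zero]
  | coe z =>
    by_cases hz : z = 0
    · rw [hz, sphereInv_zero, sphereInv_infty]
    · rw [sphereInv_coe hz, sphereInv_coe (inv_ne_zero hz), inv_inv]

theorem continuous_sphereInv : Continuous sphereInv := by
  rw [OnePoint.continuous_iff, sphereInv_infty, coclosedCompact_eq_cocompact]
  constructor
  · have h : Tendsto (fun z : ℂ => ((z⁻¹ : ℂ) : OnePoint ℂ)) (cocompact ℂ)
        (𝓝 ((0 : ℂ) : OnePoint ℂ)) := by
      rw [← Metric.cobounded_eq_cocompact]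
      exact (OnePoint.continuous_coe.tendsto _).comp tendsto_inv₀_cobounded
    refine h.congr' ?_
    filter_upwards [(isCompact_singleton (x := (0 : ℂ))).compl_mem_cocompact] with z hz
    exact (sphereInv_coe hz).symm
  · rw [continuous_iff_continuousAt]
    intro z
    by_cases hz : z = 0
    · subst hz
      rw [continuousAt_iff_punctured_nhds, sphereInv_zero]
      have h : Tendsto (fun z : ℂ => ((z⁻¹ : ℂ) : OnePoint ℂ)) (𝓝[≠] 0)
          (𝓝 OnePoint.infty) := by
        have h2 := OnePoint.tendsto_coe_infty (X := ℂ)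
        rw [coclosedCompact_eq_cocompact, ← Metric.cobounded_eq_cocompact] at h2
        exact h2.comp tendsto_inv₀_nhdsNE_zero
      refine h.congr' ?_
      filter_upwards [self_mem_nhdsWithin] with w hw
      exact (sphereInv_coe hw).symm
    · have h : ContinuousAt (fun z : ℂ => ((z⁻¹ : ℂ) : OnePoint ℂ)) z :=
        OnePoint.continuous_coe.continuousAt.comp (continuousAt_inv₀ hz)
      refine h.congr ?_
      filter_upwards [isOpen_ne.mem_nhds hz] with w hw
      exact (sphereInv_coe hw).symm

/-- The map `z ↦ 1 / z`, as a homeomorphism of the Riemann sphere. -/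
def sphereInvHomeo : RiemannSphere ≃ₜ RiemannSphere where
  toFun := sphereInv
  invFun := sphereInv
  left_inv := sphereInv_sphereInv
  right_inv := sphereInv_sphereInv
  continuous_toFun := continuous_sphereInv
  continuous_invFun := continuous_sphereInv

/-- The chart `z` of the Riemann sphere, on the complement of `∞`. -/
def finiteChart : OpenPartialHomeomorph RiemannSphere ℂ :=
  (OnePoint.isOpenEmbedding_coe.toOpenPartialHomeomorph ((↑) : ℂ → OnePoint ℂ)).symm

/-- The chart `1 / z` of the Riemann sphere, on the complement of `0`. -/
def infiniteChart : OpenPartialHomeomorph RiemannSphere ℂ :=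
  sphereInvHomeo.toOpenPartialHomeomorph.trans finiteChart

theorem finiteChart_coe (z : ℂ) : finiteChart (z : OnePoint ℂ) = z :=
  OnePoint.isOpenEmbedding_coe.toOpenPartialHomeomorph_left_inv ((↑) : ℂ → OnePoint ℂ)

theorem finiteChart_symm (z : ℂ) : finiteChart.symm z = (z : OnePoint ℂ) := rfl

theorem finiteChart_source : finiteChart.source = range ((↑) : ℂ → OnePoint ℂ) := by
  simp [finiteChart]

theorem infiniteChart_apply (p : RiemannSphere) : infiniteChart p = finiteChart (sphereInv p) := rfl

theorem infiniteChart_symm (z : ℂ) : infiniteChart.symm z = sphereInv (z : OnePoint ℂ) := rfl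

theorem infiniteChart_source :
    infiniteChart.source = sphereInv ⁻¹' range ((↑) : ℂ → OnePoint ℂ) := by
  rw [← finiteChart_source]
  simp [infiniteChart]
  rfl

open Classical in
instance : ChartedSpace ℂ RiemannSphere where
  atlas := {finiteChart, infiniteChart}
  chartAt p := if p = OnePoint.infty then infiniteChart else finiteChart
  mem_chart_source p := by
    split_ifs with h
    · rw [h, infiniteChart_source]
      exact ⟨0, rfl⟩
    · rw [finiteChart_source]
      exact OnePoint.ne_infty_iff_exists.1 h
  chart_mem_atlas p := by
    split_ifs <;> simp

/-- The Riemann sphere is a Riemann surface. -/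
instance : IsManifold 𝓘(ℂ) ω RiemannSphere := by
  have key : ∀ z : ℂ, sphereInv (z : OnePoint ℂ) ∈ range ((↑) : ℂ → OnePoint ℂ) → z ≠ 0 := by
    rintro z ⟨w, hw⟩ rfl
    rw [sphereInv_zero] at hw
    exact OnePoint.coe_ne_infty w hw
  have hinv : ∀ s : Set ℂ, (∀ z ∈ s, z ≠ 0) → ∀ f : ℂ → ℂ,
      (∀ z, f z = finiteChart (sphereInv (z : OnePoint ℂ))) → ContDiffOn ℂ ω f s := by
    intro s hs f hf
    refine ContDiffOn.congr (f := fun z => z⁻¹) (contDiffOn_id.inv hs) fun z hz => ?_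
    rw [hf, sphereInv_coe (hs z hz), finiteChart_coe]
  have hid : ∀ s : Set ℂ, ∀ f : ℂ → ℂ, (∀ z, f z = z) → ContDiffOn ℂ ω f s :=
    fun s f hf => contDiffOn_id.congr fun z _ => hf z
  apply isManifold_of_contDiffOn
  rintro e e' (rfl | rfl) (rfl | rfl)
  · exact hid _ _ fun z => finiteChart_coe z
  · refine hinv _ (fun z hz => ?_) _ fun z => rfl
    simp only [modelWithCornersSelf_coe_symm, preimage_id_eq, id_eq, mem_inter_iff,
      OpenPartialHomeomorph.trans_source, mem_preimage, infiniteChart_source] at hz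
    exact key z hz.1.2
  · refine hinv _ (fun z hz => ?_) _ fun z => rfl
    simp only [modelWithCornersSelf_coe_symm, preimage_id_eq, id_eq, mem_inter_iff,
      OpenPartialHomeomorph.trans_source, mem_preimage, finiteChart_source] at hz
    exact key z hz.1.2
  · refine hid _ _ fun z => ?_
    change finiteChart (sphereInv (sphereInv (z : OnePoint ℂ))) = z
    rw [sphereInv_sphereInv, finiteChart_coe]

/-- The chordal distance on the Riemann sphere. -/
def chordalDist (p q : RiemannSphere) : ℝ :=
  p.elim
    (q.elim 0 fun w => 2 / √(1 + ‖w‖ ^ 2))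
    fun z => q.elim (2 / √(1 + ‖z‖ ^ 2))
      fun w => 2 * ‖z - w‖ / (√(1 + ‖z‖ ^ 2) * √(1 + ‖w‖ ^ 2))

/-! ### Prime ends -/

/-- A crosscut of an open set `U` of the sphere: an open arc in `U` whose closure is a closed arc
with both endpoints (and nothing else) in the boundary of `U`. -/
def IsCrosscut (U A : Set RiemannSphere) : Prop :=
  ∃ γ : ℝ → RiemannSphere, ContinuousOn γ (Icc 0 1) ∧ InjOn γ (Icc 0 1) ∧
    γ 0 ∈ frontier U ∧ γ 1 ∈ frontier U ∧ γ '' Ioo 0 1 = A ∧ A ⊆ U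

/-- A crosscut neighborhood: a connected component of the complement in `U` of a crosscut `A`. -/
def IsCrosscutNhd (U A N : Set RiemannSphere) : Prop :=
  ∃ p ∈ U \ A, N = connectedComponentIn (U \ A) p

/-- A fundamental chain of an open set `U` of the sphere: a nested sequence `N₀ ⊇ N₁ ⊇ ⋯` of
crosscut neighborhoods such that the corresponding crosscuts have pairwise disjoint closures
and spherical diameters tending to zero. -/
structure FundamentalChain (U : Set RiemannSphere) where
  /-- The crosscuts. -/
  cut : ℕ → Set RiemannSphere
  /-- The crosscut neighborhoods. -/
  nhd : ℕ → Set RiemannSphere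
  isCrosscut : ∀ j, IsCrosscut U (cut j)
  isCrosscutNhd : ∀ j, IsCrosscutNhd U (cut j) (nhd j)
  nested : ∀ j, nhd (j + 1) ⊆ nhd j
  disjoint_closure : Pairwise fun i j => Disjoint (closure (cut i)) (closure (cut j))
  diam_tendsto_zero : ∀ ε > 0, ∀ᶠ j in atTop, ∀ p ∈ cut j, ∀ q ∈ cut j, chordalDist p q < ε

/-- Two fundamental chains are equivalent if each neighborhood of either one contains some
neighborhood of the other one. -/
instance FundamentalChain.setoid (U : Set RiemannSphere) : Setoid (FundamentalChain U) where
  r C D := (∀ j, ∃ k, D.nhd k ⊆ C.nhd j) ∧ ∀ j, ∃ k, C.nhd k ⊆ D.nhd j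
  iseqv :=
    { refl := fun _ => ⟨fun j => ⟨j, Subset.rfl⟩, fun j => ⟨j, Subset.rfl⟩⟩
      symm := fun h => ⟨h.2, h.1⟩
      trans := fun {C D E} h h' =>
        ⟨fun j => by
          obtain ⟨k, hk⟩ := h.1 j
          obtain ⟨l, hl⟩ := h'.1 k
          exact ⟨l, hl.trans hk⟩,
        fun j => by
          obtain ⟨k, hk⟩ := h'.2 j
          obtain ⟨l, hl⟩ := h.2 k
          exact ⟨l, hl.trans hk⟩⟩ }

/-- A prime end of an open set of the sphere: an equivalence class of fundamental chains. -/
def PrimeEnd (U : Set RiemannSphere) : Type := Quotient (FundamentalChain.setoid U)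

/-- The prime end represented by a fundamental chain. -/
def FundamentalChain.toPrimeEnd {U : Set RiemannSphere} (C : FundamentalChain U) : PrimeEnd U :=
  Quotient.mk _ C

end IdealBoundary

end

/-!
The proof transports everything to the closed disk by a conformal isomorphism `φ : U → 𝔻`, with
inverse `F`.

For the naturality of the ideal compactification, let `f` be a proper holomorphic self-map of
the disk. Then `‖f z‖` tends to one when `z` tends to the unit circle. The maximum principle
shows that `f` is a finite Blaschke product: as long as there are zeros one may divide `f` by
Blaschke factors, and a function without zeros has constant absolute value one. So `f` is smooth
up to the circle (`exists_contDiffOn_closedBall`). The identity map, for two choices of `φ`, is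
a special case, and it gives the independence of the choices.

For the prime ends, the main tool is the existence of short crosscuts: every point `ζ` of the
unit circle has arbitrarily small neighbourhoods in the disk which are bounded by an arc whose
image under `F` is a crosscut of `U` of small diameter (`exists_isSmallCut`). This is the
length-area method in logarithmic polar coordinates around `ζ`. It is applied to a bounded
injective holomorphic function `G` such that `F = Q ∘ G`, where `Q` is a continuous map with
finite fibres (`exists_bounded_model`). Almost no radial limit of `G` takes a given value
(`ae_not_tendsto_radial`), hence the end points of the crosscut can be chosen to avoid any
finite set. Consequently one finds chains of short crosscuts around every `ζ`
(`exists_fundamentalChain`). Conversely, a subsequence of the crosscuts of a fundamental chain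
converges to a boundary point of `U`, and the preimages of these crosscuts accumulate at some
`ζ` in the circle. Short crosscuts around `ζ` whose closure avoids the boundary point show that
these preimages shrink to `ζ`, and so do the crosscut neighbourhoods in the disk
(`FundamentalChain.exists_point`). Two crosscuts of a chain cannot both accumulate at `ζ`,
because their closures are disjoint. Therefore every crosscut neighbourhood of the chain
contains a full neighbourhood of `ζ`, and two chains are equivalent if and only if they converge
to the same `ζ` (`exists_primeEnd_point`).

If the boundary of `U` is locally connected, the end points of a short crosscut are joined by a
small connected subset `L` of the boundary. The region which is cut off is then small too. In
place of separation theorems for plane sets, this uses logarithms: if a point `w` of the region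
were far away, then the logarithms of `z - w` on a disk containing `L` and on the complement of
`U` would fit together to a logarithm on the boundary of the region, which is impossible for a
bounded open set containing `w` (`IsSmallCut.image_subset_ball`). So `F` has a limit at every
point of the circle.
-/

noncomputable section

namespace IdealBoundary

/-! ### Length, area and radial limits -/

section
open MeasureTheory Metric
open scoped ENNReal

/-- An injective holomorphic map `H` multiplies areas by `‖H'‖ ^ 2`. -/
theorem lintegral_sq_enorm_deriv_eq_volume_image {H : ℂ → ℂ} {S : Set ℂ} (hS : IsOpen S)
    (hH : DifferentiableOn ℂ H S) (hinj : InjOn H S) :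
    ∫⁻ z in S, ‖deriv H z‖ₑ ^ 2 = volume (H '' S) := by
  have h := lintegral_image_eq_lintegral_abs_det_fderiv_mul volume hS.measurableSet
    (f := H) (f' := fun z => (ContinuousLinearMap.toSpanSingleton ℂ (deriv H z)).restrictScalars ℝ)
    (fun z hz => ((hH.differentiableAt (hS.mem_nhds hz)).hasDerivAt.hasFDerivAt.restrictScalars
      ℝ).hasFDerivWithinAt) hinj (fun _ => 1)
  simp only [mul_one, lintegral_const, one_mul, Measure.restrict_apply_univ] at h
  rw [h]
  refine setLIntegral_congr_fun hS.measurableSet fun z _ => ?_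
  have : (((ContinuousLinearMap.toSpanSingleton ℂ (deriv H z)).restrictScalars ℝ).det : ℝ)
      = ‖deriv H z‖ ^ 2 := by
    simp [ContinuousLinearMap.det, LinearMap.det_restrictScalars,
      Algebra.norm_complex_eq, Complex.normSq_eq_norm_sq]
  simp only [this, abs_of_nonneg (sq_nonneg ‖deriv H z‖)]
  rw [ENNReal.ofReal_pow (norm_nonneg _), ofReal_norm]

/-- Cauchy-Schwarz. -/
theorem sq_setLIntegral_le {α : Type*} [MeasurableSpace α] (μ : Measure α) {f : α → ℝ≥0∞}
    (hf : AEMeasurable f μ) : (∫⁻ x, f x ∂μ) ^ 2 ≤ μ univ * ∫⁻ x, f x ^ 2 ∂μ := by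
  have h := ENNReal.lintegral_mul_le_Lp_mul_Lq μ Real.HolderConjugate.two_two hf
    (aemeasurable_const (b := (1 : ℝ≥0∞)))
  simp only [Pi.mul_apply, mul_one, lintegral_const,
    ENNReal.rpow_two] at h
  refine (pow_le_pow_left' h 2).trans (le_of_eq ?_)
  rw [mul_pow, ← ENNReal.rpow_two, ← ENNReal.rpow_two, ← ENNReal.rpow_mul, ← ENNReal.rpow_mul]
  norm_num [mul_comm]

/-- A form of the length-area principle: on some segment of a family of parallel ones, the square
of the integral of `u` is at most the length of the segment times the average over the family of
the integrals of `u ^ 2`. The segment can be chosen outside a null set. -/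
theorem exists_sq_lintegral_le {u : ℝ → ℝ → ℝ≥0∞} (hu : Measurable fun p : ℝ × ℝ => u p.1 p.2)
    {I J : Set ℝ} (hJ : volume J ≠ 0) (hJ' : volume J ≠ ⊤) (hJm : MeasurableSet J)
    {N : Set ℝ} (hN : volume N = 0) :
    ∃ y ∈ J, y ∉ N ∧ (∫⁻ x in I, u x y) ^ 2 ≤
      volume I * ((∫⁻ y in J, ∫⁻ x in I, u x y ^ 2) / volume J) := by
  have hm : Measurable fun y => ∫⁻ x in I, u x y ^ 2 :=
    Measurable.lintegral_prod_left' (f := fun p : ℝ × ℝ => u p.1 p.2 ^ 2) (hu.pow_const 2)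
  have h0 : volume.restrict J ≠ 0 := by simpa [Measure.restrict_eq_zero] using hJ
  have : IsFiniteMeasure (volume.restrict J) := ⟨by simpa using hJ'.lt_top⟩
  obtain ⟨y, hy, hle⟩ := exists_notMem_null_le_laverage (N := N ∪ Jᶜ) h0 hm.aemeasurable
    (by
      refine measure_union_null (nonpos_iff_eq_zero.1 ((Measure.restrict_apply_le _ _).trans hN.le))
        ?_
      rw [Measure.restrict_apply hJm.compl]; simp)
  simp only [mem_union, mem_compl_iff, not_or, not_not] at hy
  refine ⟨y, hy.2, hy.1, (sq_setLIntegral_le (volume.restrict I)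
    (hu.comp (measurable_id.prodMk measurable_const)).aemeasurable).trans ?_⟩
  rw [Measure.restrict_apply_univ]
  gcongr
  rwa [setLAverage_eq] at hle

theorem edist_le_setLIntegral_of_hasDerivAt {f f' : ℝ → ℂ} {a b : ℝ}
    (hf : ∀ x ∈ Ioo a b, HasDerivAt f (f' x) x) (hf' : ContinuousOn f' (Ioo a b))
    {s t : ℝ} (hs : s ∈ Ioo a b) (ht : t ∈ Ioo a b) :
    edist (f s) (f t) ≤ ∫⁻ x in Ioo a b, ‖f' x‖ₑ := by
  wlog hst : s ≤ t generalizing s t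
  · rw [edist_comm]; exact this ht hs (le_of_not_ge hst)
  have hsub : Icc s t ⊆ Ioo a b := fun x hx => ⟨hs.1.trans_le hx.1, hx.2.trans_lt ht.2⟩
  have hint : IntervalIntegrable f' volume s t :=
    (hf'.mono (by rwa [uIcc_of_le hst])).intervalIntegrable
  have := intervalIntegral.integral_eq_sub_of_hasDerivAt (a := s) (b := t) (f := f) (f' := f')
    (fun x hx => hf x (hsub (by rwa [uIcc_of_le hst] at hx))) hint
  rw [edist_comm, edist_eq_enorm_sub, ← this, intervalIntegral.integral_of_le hst]
  refine (enorm_integral_le_lintegral_enorm _).trans ?_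
  exact lintegral_mono_set (Ioc_subset_Icc_self.trans hsub)

/-- A curve of finite length has an end point. -/
theorem exists_tendsto_of_setLIntegral_lt_top {f f' : ℝ → ℂ} {a b : ℝ} (hab : a < b)
    (hf : ∀ x ∈ Ioo a b, HasDerivAt f (f' x) x) (hf' : ContinuousOn f' (Ioo a b))
    (hfin : ∫⁻ x in Ioo a b, ‖f' x‖ₑ ≠ ⊤) : ∃ p, Tendsto f (𝓝[<] b) (𝓝 p) := by
  have h0 : Tendsto (fun s => ∫⁻ x in Ioo s b, ‖f' x‖ₑ) (𝓝[<] b) (𝓝 0) := by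
    have := tendsto_setLIntegral_zero (μ := volume.restrict (Ioo a b)) hfin
      (l := 𝓝[<] b) (s := fun s => Ioo s b) (by
        have h1 : Tendsto (fun s : ℝ => ENNReal.ofReal (b - s)) (𝓝[<] b) (𝓝 0) := by
          have : Tendsto (fun s : ℝ => ENNReal.ofReal (b - s)) (𝓝 b) (𝓝 (ENNReal.ofReal (b - b))) :=
            (ENNReal.continuous_ofReal.comp (continuous_const.sub continuous_id)).tendsto b
          simpa using this.mono_left nhdsWithin_le_nhds
        refine tendsto_of_tendsto_of_tendsto_of_le_of_le tendsto_const_nhds h1 (fun _ => zero_le)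
          fun s => ?_
        exact (Measure.restrict_apply_le _ _).trans (by simp))
    refine this.congr' ?_
    filter_upwards [Ioo_mem_nhdsLT hab] with s hs
    rw [Measure.restrict_restrict measurableSet_Ioo,
      inter_eq_left.2 (Ioo_subset_Ioo_left hs.1.le)]
  have hc : Cauchy (map f (𝓝[<] b)) := by
    rw [EMetric.cauchy_iff]
    refine ⟨NeBot.ne inferInstance, fun ε hε => ?_⟩
    obtain ⟨s, hs, hs2⟩ := ((h0.eventually (gt_mem_nhds hε)).and (Ioo_mem_nhdsLT hab)).exists
    refine ⟨f '' Ioo s b, image_mem_map (Ioo_mem_nhdsLT hs2.2), ?_⟩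
    rintro _ ⟨x, hx, rfl⟩ _ ⟨y, hy, rfl⟩
    have hsub : Ioo s b ⊆ Ioo a b := Ioo_subset_Ioo_left hs2.1.le
    exact (edist_le_setLIntegral_of_hasDerivAt (fun x hx => hf x (hsub hx)) (hf'.mono hsub)
      hx hy).trans_lt hs
  exact CompleteSpace.complete hc

/-- By Jensen's formula and Fatou's lemma, almost no radial limit of a bounded holomorphic function
on the disk is equal to a given value which the function omits. -/
theorem ae_not_tendsto_radial {G : ℂ → ℂ} (hG : DifferentiableOn ℂ G (ball 0 1))
    (hb : Bornology.IsBounded (G '' ball 0 1)) {p : ℂ} (hp : p ∉ G '' ball 0 1) :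
    ∀ᵐ y : ℝ, y ∈ Ioo (-1 : ℝ) 1 →
      ¬ Tendsto (fun x : ℝ => G (Complex.exp (x + y * Complex.I))) (𝓝[<] 0) (𝓝 p) := by
  obtain ⟨C, hC0, hC⟩ : ∃ C > 0, ∀ z ∈ ball (0 : ℂ) 1, ‖G z - p‖ ≤ C := by
    obtain ⟨C, hC⟩ := hb.exists_norm_le
    refine ⟨|C| + ‖p‖ + 1, by positivity, fun z hz => (norm_sub_le _ _).trans ?_⟩
    have := (hC _ (mem_image_of_mem G hz)).trans (le_abs_self C)
    linarith
  have hne : ∀ z ∈ ball (0 : ℂ) 1, G z - p ≠ 0 := fun z hz h =>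
    hp ⟨z, hz, sub_eq_zero.1 h⟩
  have hlog : ∀ z ∈ ball (0 : ℂ) 1, 0 ≤ Real.log C - Real.log ‖G z - p‖ := fun z hz =>
    sub_nonneg.2 (Real.log_le_log (norm_pos_iff.2 (hne z hz)) (hC z hz))
  have hcont : ContinuousOn (fun z => Real.log C - Real.log ‖G z - p‖) (ball 0 1) :=
    continuousOn_const.sub (((hG.continuousOn.sub continuousOn_const).norm).log
      fun z hz => norm_ne_zero_iff.2 (hne z hz))
  -- radii tending to `1`
  let ρ : ℕ → ℝ := fun n => Real.exp (-(1 / ((n : ℝ) + 1)))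
  have hρ : ∀ n, 0 < ρ n ∧ ρ n < 1 := fun n =>
    ⟨Real.exp_pos _, Real.exp_zero ▸ Real.exp_lt_exp.2 (neg_lt_zero.2 (by positivity))⟩
  have hmem : ∀ n (y : ℝ), circleMap 0 (ρ n) y ∈ ball (0 : ℂ) 1 := fun n y => by
    rw [mem_ball_zero_iff, norm_circleMap_zero, abs_of_pos (hρ n).1]; exact (hρ n).2
  let v : ℕ → ℝ → ℝ := fun n y => Real.log C - Real.log ‖G (circleMap 0 (ρ n) y) - p‖
  have hv : ∀ n, Continuous (v n) := fun n =>
    hcont.comp_continuous (continuous_circleMap 0 (ρ n)) (hmem n)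
  have hint : ∀ n, ∫ y in (-Real.pi)..Real.pi, v n y
      = 2 * Real.pi * (Real.log C - Real.log ‖G 0 - p‖) := fun n => by
    have hsub : closedBall (0 : ℂ) |ρ n| ⊆ ball 0 1 := by
      rw [abs_of_pos (hρ n).1]; exact closedBall_subset_ball (hρ n).2
    have h1 := AnalyticOnNhd.circleAverage_log_norm_of_ne_zero (R := ρ n) (c := 0)
      (g := fun z => G z - p)
      (fun z hz => ((hG.sub_const p).analyticAt (isOpen_ball.mem_nhds (hsub hz))))
      (fun z hz => hne z (hsub hz))
    rw [Real.circleAverage_eq_integral_add (-Real.pi),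
      intervalIntegral.integral_comp_add_right
        (fun θ => Real.log ‖G (circleMap 0 (ρ n) θ) - p‖)] at h1
    have e1 : 0 + -Real.pi = -Real.pi := zero_add _
    have e2 : 2 * Real.pi + -Real.pi = Real.pi := by ring
    rw [e1, e2, smul_eq_mul, inv_mul_eq_iff_eq_mul₀ Real.two_pi_pos.ne'] at h1
    have hl : Continuous fun θ => Real.log ‖G (circleMap 0 (ρ n) θ) - p‖ := by
      have := (continuous_const (y := Real.log C)).sub (hv n)
      simpa only [v, Pi.sub_def, sub_sub_cancel] using this
    simp only [v]
    rw [intervalIntegral.integral_sub (by simp) (hl.intervalIntegrable _ _), h1]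
    simp
    ring
  have hlint : ∀ n, ∫⁻ y in Ioc (-Real.pi) Real.pi, ENNReal.ofReal (v n y)
      = ENNReal.ofReal (2 * Real.pi * (Real.log C - Real.log ‖G 0 - p‖)) := fun n => by
    have hπ : -Real.pi ≤ Real.pi := by linarith [Real.pi_pos]
    rw [← hint n, intervalIntegral.integral_of_le hπ, ofReal_integral_eq_lintegral_ofReal]
    · exact ((hv n).intervalIntegrable _ _).1
    · exact ae_of_all _ fun y => hlog _ (hmem n y)
  have hmeas : ∀ n, Measurable fun y => ENNReal.ofReal (v n y) := fun n =>
    (ENNReal.continuous_ofReal.comp (hv n)).measurable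
  have hfatou : ∫⁻ y in Ioc (-Real.pi) Real.pi, liminf (fun n => ENNReal.ofReal (v n y)) atTop
      ≠ ⊤ := by
    refine ((lintegral_liminf_le (u := atTop) hmeas).trans_lt ?_).ne
    simp only [hlint, liminf_const]
    exact ENNReal.ofReal_lt_top
  have hae := ae_lt_top (Measurable.liminf hmeas) hfatou
  rw [ae_restrict_iff' measurableSet_Ioc] at hae
  filter_upwards [hae] with y hy hyI hlim
  have hlt := hy ⟨by linarith [hyI.1, Real.pi_gt_three], by linarith [hyI.2, Real.pi_gt_three]⟩
  refine hlt.ne (Tendsto.liminf_eq ?_)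
  have hx : Tendsto (fun n : ℕ => -(1 / ((n : ℝ) + 1))) atTop (𝓝[<] 0) := by
    refine tendsto_nhdsWithin_iff.2 ⟨?_,
      Eventually.of_forall fun n => neg_lt_zero.2 (by positivity : (0 : ℝ) < 1 / ((n : ℝ) + 1))⟩
    rw [← neg_zero]
    exact (tendsto_one_div_add_atTop_nhds_zero_nat (𝕜 := ℝ)).neg
  have h1 := hlim.comp hx
  have h2 : Tendsto (fun n => G (circleMap 0 (ρ n) y) - p) atTop (𝓝 0) := by
    have h1' := h1.sub_const p
    rw [sub_self] at h1'
    refine h1'.congr fun n => ?_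
    simp only [Function.comp, circleMap, ρ, zero_add]
    rw [Complex.exp_add]
    push_cast
    rfl
  have h3 : Tendsto (fun n => Real.log ‖G (circleMap 0 (ρ n) y) - p‖) atTop atBot := by
    refine Real.tendsto_log_nhdsNE_zero.comp (tendsto_nhdsWithin_iff.2 ⟨by simpa using h2.norm,
      Eventually.of_forall fun n => norm_ne_zero_iff.2 (hne _ (hmem n y))⟩)
  exact ENNReal.tendsto_ofReal_atTop.comp
    (tendsto_atTop_add_const_left _ (Real.log C) (tendsto_neg_atBot_atTop.comp h3))

end

/-! ### The chordal distance -/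

section
open Metric

theorem chordalDist_self (p : RiemannSphere) : chordalDist p p = 0 := by
  induction p using OnePoint.rec <;> simp [chordalDist]

theorem eq_of_chordalDist_eq_zero {p q : RiemannSphere} (h : chordalDist p q = 0) : p = q := by
  have hs : ∀ z : ℂ, √(1 + ‖z‖ ^ 2) ≠ 0 := fun z => (Real.sqrt_pos.2 (by positivity)).ne'
  induction p using OnePoint.rec with
  | infty =>
    induction q using OnePoint.rec with
    | infty => rfl
    | coe w => exact absurd h (div_ne_zero two_ne_zero (hs w))
  | coe z =>
    induction q using OnePoint.rec with
    | infty => exact absurd h (div_ne_zero two_ne_zero (hs z))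
    | coe w =>
      have h' : 2 * ‖z - w‖ / (√(1 + ‖z‖ ^ 2) * √(1 + ‖w‖ ^ 2)) = 0 := h
      have := hs z
      have := hs w
      simp_all [sub_eq_zero]

/-- Inverse stereographic projection; its second component is shifted by one. -/
def stereo (p : RiemannSphere) : ℂ × ℝ :=
  p.elim (0, 0) fun z => ((2 / (1 + ‖z‖ ^ 2) : ℝ) • z, 2 / (1 + ‖z‖ ^ 2))

theorem continuous_stereo : Continuous stereo := by
  have hpos : ∀ z : ℂ, (1 + ‖z‖ ^ 2 : ℝ) ≠ 0 := fun z => by positivity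
  rw [OnePoint.continuous_iff, coclosedCompact_eq_cocompact]
  constructor
  · have h1 : Tendsto (fun z : ℂ => ‖z‖) (cocompact ℂ) atTop := tendsto_norm_cocompact_atTop
    have h2 : Tendsto (fun z : ℂ => 1 + ‖z‖ ^ 2) (cocompact ℂ) atTop :=
      tendsto_atTop_add_const_left _ _ ((tendsto_pow_atTop two_ne_zero).comp h1)
    have h3 : Tendsto (fun z : ℂ => 2 / (1 + ‖z‖ ^ 2)) (cocompact ℂ) (𝓝 0) := h2.const_div_atTop 2
    refine Tendsto.prodMk_nhds ?_ h3
    rw [tendsto_zero_iff_norm_tendsto_zero]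
    have h4 : Tendsto (fun z : ℂ => 2 / ‖z‖) (cocompact ℂ) (𝓝 0) := h1.const_div_atTop 2
    refine squeeze_zero' (Eventually.of_forall fun z => norm_nonneg _) ?_ h4
    filter_upwards [h1.eventually_gt_atTop 0] with z hz
    change ‖(2 / (1 + ‖z‖ ^ 2) : ℝ) • z‖ ≤ 2 / ‖z‖
    rw [norm_smul, Real.norm_of_nonneg (by positivity), div_mul_eq_mul_div,
      div_le_div_iff₀ (by positivity) hz]
    nlinarith
  · change Continuous fun z : ℂ => ((2 / (1 + ‖z‖ ^ 2) : ℝ) • z, (2 / (1 + ‖z‖ ^ 2) : ℝ))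
    have : Continuous fun z : ℂ => (2 / (1 + ‖z‖ ^ 2) : ℝ) := by
      fun_prop (disch := exact hpos)
    exact (this.smul continuous_id).prodMk this

theorem chordalDist_eq (p q : RiemannSphere) :
    chordalDist p q = √(‖(stereo p).1 - (stereo q).1‖ ^ 2 + ((stereo p).2 - (stereo q).2) ^ 2) := by
  have hpos : ∀ z : ℂ, (0 : ℝ) < 1 + ‖z‖ ^ 2 := fun z => by positivity
  have key : ∀ z : ℂ, 2 / √(1 + ‖z‖ ^ 2) =
      √(‖(2 / (1 + ‖z‖ ^ 2) : ℝ) • z‖ ^ 2 + (2 / (1 + ‖z‖ ^ 2)) ^ 2) := fun z => by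
    have := hpos z
    rw [eq_comm, Real.sqrt_eq_iff_eq_sq (by positivity) (by positivity), div_pow 2 √_,
      Real.sq_sqrt this.le, norm_smul, Real.norm_of_nonneg (by positivity)]
    field_simp
    ring
  induction p using OnePoint.rec with
  | infty =>
    induction q using OnePoint.rec with
    | infty => simp [chordalDist]
    | coe w =>
      change 2 / √(1 + ‖w‖ ^ 2) = √(‖(0 : ℂ) - _‖ ^ 2 + ((0 : ℝ) - _) ^ 2)
      rw [zero_sub, zero_sub, norm_neg, neg_sq]
      exact key w
  | coe z =>
    induction q using OnePoint.rec with
    | infty =>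
      change 2 / √(1 + ‖z‖ ^ 2) = √(‖_ - (0 : ℂ)‖ ^ 2 + (_ - (0 : ℝ)) ^ 2)
      rw [sub_zero, sub_zero]
      exact key z
    | coe w =>
      change 2 * ‖z - w‖ / (√(1 + ‖z‖ ^ 2) * √(1 + ‖w‖ ^ 2)) =
        √(‖(2 / (1 + ‖z‖ ^ 2) : ℝ) • z - (2 / (1 + ‖w‖ ^ 2) : ℝ) • w‖ ^ 2
          + (2 / (1 + ‖z‖ ^ 2) - 2 / (1 + ‖w‖ ^ 2)) ^ 2)
      have hz := hpos z
      have hw := hpos w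
      rw [eq_comm, Real.sqrt_eq_iff_eq_sq (by positivity) (by positivity), div_pow (2 * _), mul_pow,
        mul_pow √_, Real.sq_sqrt hz.le, Real.sq_sqrt hw.le, norm_sub_sq_real, norm_sub_sq_real,
        norm_smul, norm_smul, Real.norm_of_nonneg (by positivity),
        Real.norm_of_nonneg (by positivity), real_inner_smul_left, real_inner_smul_right]
      field_simp
      ring

theorem continuous_chordalDist : Continuous fun p : RiemannSphere × RiemannSphere =>
    chordalDist p.1 p.2 := by
  simp only [chordalDist_eq]
  have h1 : Continuous fun p : RiemannSphere × RiemannSphere => stereo p.1 :=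
    continuous_stereo.comp continuous_fst
  have h2 : Continuous fun p : RiemannSphere × RiemannSphere => stereo p.2 :=
    continuous_stereo.comp continuous_snd
  fun_prop

/-- A continuous map from a compact metric space to the sphere is uniformly continuous for the
chordal distance. -/
theorem exists_chordalDist_lt {Q : ℂ → RiemannSphere} (hQ : Continuous Q) {K : Set ℂ}
    (hK : IsCompact K) {ε : ℝ} (hε : 0 < ε) :
    ∃ η > 0, ∀ u ∈ K, ∀ v ∈ K, dist u v ≤ η → chordalDist (Q u) (Q v) < ε := by
  by_contra! hcon
  choose u hu v hv huv hd using fun n : ℕ => hcon (1 / ((n : ℝ) + 1)) (by positivity)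
  obtain ⟨a, -, φ, hφ, hua⟩ := hK.tendsto_subseq hu
  have h0 : Tendsto (fun n => dist (u (φ n)) (v (φ n))) atTop (𝓝 0) :=
    squeeze_zero (fun _ => dist_nonneg) (fun n => huv (φ n))
      ((tendsto_one_div_add_atTop_nhds_zero_nat (𝕜 := ℝ)).comp hφ.tendsto_atTop)
  have hva : Tendsto (v ∘ φ) atTop (𝓝 a) := (tendsto_iff_of_dist h0).1 hua
  have hc : Continuous fun p : ℂ × ℂ => chordalDist (Q p.1) (Q p.2) :=
    continuous_chordalDist.comp ((hQ.comp continuous_fst).prodMk (hQ.comp continuous_snd))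
  have hlim := (hc.tendsto (a, a)).comp (hua.prodMk_nhds hva)
  simp only [chordalDist_self] at hlim
  exact absurd hε (not_lt.2 (ge_of_tendsto' hlim fun n => hd (φ n)))

/-- By compactness, points whose chordal distance to a convergent family tends to zero have the same
limit. -/
theorem tendsto_of_chordalDist_tendsto {ι : Type*} {l : Filter ι} {p q : ι → RiemannSphere}
    {a : RiemannSphere} (hp : Tendsto p l (𝓝 a))
    (hd : Tendsto (fun i => chordalDist (p i) (q i)) l (𝓝 0)) : Tendsto q l (𝓝 a) := by
  rw [tendsto_iff_ultrafilter]
  intro g hg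
  obtain ⟨b, -, hb⟩ := isCompact_univ.ultrafilter_le_nhds (g.map q) (by simp)
  have hb' : Tendsto q g (𝓝 b) := hb
  have h1 := (continuous_chordalDist.tendsto (a, b)).comp ((hp.mono_left hg).prodMk_nhds hb')
  have h2 : chordalDist a b = 0 := tendsto_nhds_unique h1 (hd.mono_left hg)
  rwa [eq_of_chordalDist_eq_zero h2]

theorem chordalDist_nonneg (p q : RiemannSphere) : 0 ≤ chordalDist p q := by
  rw [chordalDist_eq]; exact Real.sqrt_nonneg _

/-- Sets of chordal diameter tending to zero which contain points converging to `p` are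
eventually contained in every neighbourhood of `p`. -/
theorem eventually_subset_of_chordalDist_lt {ι : Type*} {l : Filter ι} {A : ι → Set RiemannSphere}
    {a : ι → RiemannSphere} {p : RiemannSphere} (ha : ∀ j, a j ∈ A j) (hlim : Tendsto a l (𝓝 p))
    (hd : ∀ ε > 0, ∀ᶠ j in l, ∀ x ∈ A j, ∀ y ∈ A j, chordalDist x y < ε)
    {V : Set RiemannSphere} (hV : V ∈ 𝓝 p) : ∀ᶠ j in l, A j ⊆ V := by
  classical
  -- a point of `A j` outside `V`, if there is one
  let b : ι → RiemannSphere := fun j => if h : ∃ q ∈ A j, q ∉ V then h.choose else a j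
  have hb : ∀ j, b j ∈ A j := fun j => by
    by_cases h : ∃ q ∈ A j, q ∉ V
    · simp only [b, dif_pos h]; exact h.choose_spec.1
    · simp only [b, dif_neg h]; exact ha j
  have hdiam : Tendsto (fun j => chordalDist (a j) (b j)) l (𝓝 0) := by
    rw [Metric.tendsto_nhds]
    intro ε hε
    filter_upwards [hd ε hε] with j hj
    rw [Real.dist_eq, sub_zero, abs_of_nonneg (chordalDist_nonneg _ _)]
    exact hj _ (ha j) _ (hb j)
  filter_upwards [tendsto_of_chordalDist_tendsto hlim hdiam hV] with j hj q hq
  by_contra hqV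
  have h : ∃ q ∈ A j, q ∉ V := ⟨q, hq, hqV⟩
  refine h.choose_spec.2 ?_
  rw [mem_preimage] at hj
  simpa only [b, dif_pos h] using hj

end

/-! ### Short curves near a boundary point of the disk -/

section
open MeasureTheory Metric
open scoped ENNReal

/-- The point with logarithmic polar coordinates `x` and `y`. -/
def polarPoint (x y : ℝ) : ℂ := Complex.exp (x + y * Complex.I)

theorem polarPoint_mem_ball {x : ℝ} (hx : x < 0) (y : ℝ) : polarPoint x y ∈ ball (0 : ℂ) 1 := by
  rw [mem_ball_zero_iff, polarPoint, Complex.norm_exp]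
  simpa using hx

/-- In logarithmic polar coordinates, the image of a box under a bounded injective holomorphic
function has finite area. -/
theorem lintegral_sq_enorm_deriv_exp_ne_top {G : ℂ → ℂ} (hG : DifferentiableOn ℂ G (ball 0 1))
    (hinj : InjOn G (ball 0 1)) (hb : Bornology.IsBounded (G '' ball 0 1)) :
    ∫⁻ p in Ioo (-1 : ℝ) 0 ×ˢ Ioo (-1 : ℝ) 1,
      ‖deriv (fun w => G (Complex.exp w)) (p.1 + p.2 * Complex.I)‖ₑ ^ 2 ≠ ⊤ := by
  set S : Set ℂ := Ioo (-1 : ℝ) 0 ×ℂ Ioo (-1 : ℝ) 1 with hS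
  have hSo : IsOpen S := isOpen_Ioo.reProdIm isOpen_Ioo
  have hmaps : MapsTo Complex.exp S (ball 0 1) := fun w hw => by
    rw [mem_ball_zero_iff, Complex.norm_exp]
    simpa using hw.1.2
  have hd : DifferentiableOn ℂ (fun w => G (Complex.exp w)) S :=
    hG.comp Complex.differentiable_exp.differentiableOn hmaps
  have hi : InjOn (fun w => G (Complex.exp w)) S := by
    refine hinj.comp (fun w hw w' hw' h => ?_) hmaps
    refine Complex.exp_inj_of_neg_pi_lt_of_le_pi ?_ ?_ ?_ ?_ h
    all_goals first | linarith [hw.2.1, hw.2.2, hw'.2.1, hw'.2.2, Real.pi_gt_three]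
  have h1 := lintegral_sq_enorm_deriv_eq_volume_image hSo hd hi
  have h2 : volume ((fun w => G (Complex.exp w)) '' S) < ⊤ := by
    refine (hb.subset ?_).measure_lt_top
    rintro _ ⟨w, hw, rfl⟩
    exact mem_image_of_mem G (hmaps hw)
  have h3 := Complex.volume_preserving_equiv_real_prod.symm.setLIntegral_comp_preimage_emb
    Complex.measurableEquivRealProd.symm.measurableEmbedding
    (fun z => ‖deriv (fun w => G (Complex.exp w)) z‖ₑ ^ 2) S
  rw [← h1, ← h3] at h2
  refine ne_of_eq_of_ne ?_ h2.ne
  have e : Complex.measurableEquivRealProd.symm ⁻¹' S = Ioo (-1 : ℝ) 0 ×ˢ Ioo (-1 : ℝ) 1 := by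
    ext p; simp [S, Complex.mem_reProdIm]
  rw [e]
  refine lintegral_congr fun p => ?_
  rw [Complex.measurableEquivRealProd_symm_apply]
  congr 4
  apply Complex.ext <;> simp

theorem differentiableOn_comp_exp {G : ℂ → ℂ} (hG : DifferentiableOn ℂ G (ball 0 1)) :
    DifferentiableOn ℂ (fun w => G (Complex.exp w)) {w | w.re < 0} :=
  hG.comp Complex.differentiable_exp.differentiableOn fun w hw => by
    rw [mem_ball_zero_iff, Complex.norm_exp]
    simpa using hw

theorem isOpen_re_neg : IsOpen {w : ℂ | w.re < 0} :=
  isOpen_lt Complex.continuous_re continuous_const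

/-- If the image of a box of size `δ` has small area, then some radial segment with angle between
`a` and `b` has a short image, which ends outside the finite set `B` of omitted values. -/
theorem exists_short_radius {G : ℂ → ℂ} (hG : DifferentiableOn ℂ G (ball 0 1))
    (hb : Bornology.IsBounded (G '' ball 0 1)) {δ η : ℝ} {A : ℝ≥0∞} (hδ : 0 < δ)
    (hA : ∫⁻ p in Ioo (-δ) 0 ×ˢ Ioo (-δ) δ,
      ‖deriv (fun w => G (Complex.exp w)) (p.1 + p.2 * Complex.I)‖ₑ ^ 2 ≤ A)
    (hAη : A ≤ ENNReal.ofReal η ^ 2) (hη : 0 < η) {a b : ℝ} (hab : b - a = δ) (ha : -δ ≤ a)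
    (hbδ : b ≤ δ) (hδ1 : δ < 1) {B : Set ℂ} (hB : B.Finite) (hBG : Disjoint B (G '' ball 0 1)) :
    ∃ y ∈ Ioo a b, ∃ p, Tendsto (fun x => G (polarPoint x y)) (𝓝[<] 0) (𝓝 p) ∧ p ∉ B ∧
      ∀ x ∈ Ioo (-δ) 0, ∀ x' ∈ Ioo (-δ) 0,
        dist (G (polarPoint x y)) (G (polarPoint x' y)) ≤ η := by
  set H : ℂ → ℂ := fun w => G (Complex.exp w) with hH
  have hmeas : Measurable fun p : ℝ × ℝ => ‖deriv H (p.1 + p.2 * Complex.I)‖ₑ :=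
    ((measurable_deriv H).comp (by fun_prop)).enorm
  let N : Set ℝ := ⋃ p ∈ B, {y | ¬ (y ∈ Ioo (-1 : ℝ) 1 →
      ¬ Tendsto (fun x : ℝ => G (Complex.exp (x + y * Complex.I))) (𝓝[<] 0) (𝓝 p))}
  have hN : volume N = 0 := (measure_biUnion_null_iff hB.countable).2 fun p hp =>
    ae_not_tendsto_radial hG hb (disjoint_left.1 hBG hp)
  obtain ⟨y, hy, hyN, hle⟩ := exists_sq_lintegral_le (I := Ioo (-δ) 0) (J := Ioo a b)
    (u := fun x y => ‖deriv H (x + y * Complex.I)‖ₑ) hmeas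
    (by simpa using by linarith) (by simp) measurableSet_Ioo hN
  have hle2 : ∫⁻ x in Ioo (-δ) 0, ‖deriv H (x + y * Complex.I)‖ₑ ≤ ENNReal.ofReal η := by
    rw [← ENNReal.pow_le_pow_left_iff two_ne_zero]
    refine hle.trans ((?_ : _ ≤ A).trans hAη)
    rw [Real.volume_Ioo, Real.volume_Ioo, hab, zero_sub, neg_neg, ENNReal.mul_div_cancel
      (by simpa using hδ) ENNReal.ofReal_ne_top]
    refine le_trans ?_ hA
    rw [Measure.volume_eq_prod, setLIntegral_prod_symm _ (hmeas.pow_const 2).aemeasurable]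
    exact lintegral_mono_set (Ioo_subset_Ioo ha hbδ)
  have hder : ∀ x ∈ Ioo (-δ) 0, HasDerivAt (fun x : ℝ => G (polarPoint x y))
      (deriv H (x + y * Complex.I)) x := fun x hx => by
    have h1 : HasDerivAt H (deriv H (x + y * Complex.I)) (x + y * Complex.I) :=
      ((differentiableOn_comp_exp hG).differentiableAt
        (isOpen_re_neg.mem_nhds (by simpa using hx.2))).hasDerivAt
    exact (h1.comp_add_const (x : ℂ) (y * Complex.I)).comp_ofReal
  have hcont : ContinuousOn (fun x : ℝ => deriv H (x + y * Complex.I)) (Ioo (-δ) 0) :=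
    ((differentiableOn_comp_exp hG).deriv isOpen_re_neg).continuousOn.comp
      (by fun_prop) fun x hx => by simpa using hx.2
  obtain ⟨p, hp⟩ := exists_tendsto_of_setLIntegral_lt_top (neg_lt_zero.2 hδ) hder hcont
    (hle2.trans_lt ENNReal.ofReal_lt_top).ne
  refine ⟨y, hy, p, hp, fun hpB => hyN ?_, fun x hx x' hx' => ?_⟩
  · simp only [N, mem_iUnion]
    exact ⟨p, hpB, fun h => h ⟨by linarith [hy.1], by linarith [hy.2]⟩ hp⟩
  · have := (edist_le_setLIntegral_of_hasDerivAt hder hcont hx hx').trans hle2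
    rwa [edist_dist, ENNReal.ofReal_le_ofReal_iff hη.le] at this

/-- If the image of a box of size `δ` has small area, then some circular arc has a short image. -/
theorem exists_short_arc {G : ℂ → ℂ} (hG : DifferentiableOn ℂ G (ball 0 1))
    {δ η : ℝ} {A : ℝ≥0∞} (hδ : 0 < δ)
    (hA : ∫⁻ p in Ioo (-δ) 0 ×ˢ Ioo (-δ) δ,
      ‖deriv (fun w => G (Complex.exp w)) (p.1 + p.2 * Complex.I)‖ₑ ^ 2 ≤ A)
    (hAη : 2 * A ≤ ENNReal.ofReal η ^ 2) (hη : 0 < η) :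
    ∃ x ∈ Ioo (-δ) 0, ∀ y ∈ Ioo (-δ) δ, ∀ y' ∈ Ioo (-δ) δ,
        dist (G (polarPoint x y)) (G (polarPoint x y')) ≤ η := by
  set H : ℂ → ℂ := fun w => G (Complex.exp w) with hH
  have hmeas : Measurable fun p : ℝ × ℝ => ‖deriv H (p.1 + p.2 * Complex.I)‖ₑ :=
    ((measurable_deriv H).comp (by fun_prop)).enorm
  obtain ⟨x, hx, -, hle⟩ := exists_sq_lintegral_le (I := Ioo (-δ) δ) (J := Ioo (-δ) 0)
    (u := fun y x => ‖deriv H (x + y * Complex.I)‖ₑ)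
    (hmeas.comp measurable_swap)
    (by simpa using hδ) (by simp) measurableSet_Ioo (measure_empty)
  have hle2 : ∫⁻ y in Ioo (-δ) δ, ‖deriv H (x + y * Complex.I)‖ₑ ≤ ENNReal.ofReal η := by
    rw [← ENNReal.pow_le_pow_left_iff two_ne_zero]
    refine hle.trans ((?_ : _ ≤ 2 * A).trans hAη)
    have e : δ - -δ = 2 * δ := by ring
    rw [Real.volume_Ioo, Real.volume_Ioo, zero_sub, neg_neg, e, ENNReal.ofReal_mul zero_le_two,
      mul_assoc, ENNReal.mul_div_cancel (by simpa using hδ) ENNReal.ofReal_ne_top,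
      ENNReal.ofReal_ofNat]
    gcongr
    refine le_trans (le_of_eq ?_) hA
    rw [Measure.volume_eq_prod, setLIntegral_prod _ (hmeas.pow_const 2).aemeasurable]
  have hmem : ∀ y : ℝ, (x + y * Complex.I : ℂ) ∈ {w : ℂ | w.re < 0} := fun y => by simpa using hx.2
  have hder : ∀ y ∈ Ioo (-δ) δ, HasDerivAt (fun y : ℝ => G (polarPoint x y))
      (deriv H (x + y * Complex.I) * Complex.I) y := fun y hy => by
    have h1 : HasDerivAt H (deriv H (x + y * Complex.I)) (x + y * Complex.I) :=
      ((differentiableOn_comp_exp hG).differentiableAt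
        (isOpen_re_neg.mem_nhds (hmem y))).hasDerivAt
    have h2 : HasDerivAt (fun w : ℂ => x + w * Complex.I) Complex.I y := by
      simpa using ((hasDerivAt_id (y : ℂ)).mul_const Complex.I).const_add (x : ℂ)
    exact (h1.comp (y : ℂ) h2).comp_ofReal
  have hcont : ContinuousOn (fun y : ℝ => deriv H (x + y * Complex.I) * Complex.I) (Ioo (-δ) δ) :=
    (((differentiableOn_comp_exp hG).deriv isOpen_re_neg).continuousOn.comp
      (by fun_prop) fun y hy => hmem y).mul continuousOn_const
  refine ⟨x, hx, fun y hy y' hy' => ?_⟩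
  have := (edist_le_setLIntegral_of_hasDerivAt hder hcont hy hy').trans
    (le_trans (le_of_eq (lintegral_congr fun t => by
      rw [enorm_mul, ← ofReal_norm Complex.I, Complex.norm_I, ENNReal.ofReal_one, mul_one])) hle2)
  rwa [edist_dist, ENNReal.ofReal_le_ofReal_iff hη.le] at this

/-- Every boundary neighbourhood of `1` contains a box in logarithmic polar coordinates whose sides
are mapped to short curves. The two radial sides can be chosen independently, and their
end points avoid a given finite set. -/
theorem exists_short_box {G : ℂ → ℂ} (hG : DifferentiableOn ℂ G (ball 0 1))
    (hinj : InjOn G (ball 0 1)) (hb : Bornology.IsBounded (G '' ball 0 1)) {ε η : ℝ} (hε : 0 < ε)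
    (hη : 0 < η) :
    ∃ δ ∈ Ioo 0 ε, (∃ x ∈ Ioo (-δ) 0, ∀ y ∈ Ioo (-δ) δ, ∀ y' ∈ Ioo (-δ) δ,
        dist (G (polarPoint x y)) (G (polarPoint x y')) ≤ η) ∧
      ∀ a b : ℝ, b - a = δ → -δ ≤ a → b ≤ δ → ∀ B : Set ℂ, B.Finite → Disjoint B (G '' ball 0 1) →
        ∃ y ∈ Ioo a b, ∃ p, Tendsto (fun x => G (polarPoint x y)) (𝓝[<] 0) (𝓝 p) ∧ p ∉ B ∧
          ∀ x ∈ Ioo (-δ) 0, ∀ x' ∈ Ioo (-δ) 0,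
            dist (G (polarPoint x y)) (G (polarPoint x' y)) ≤ η := by
  have hfin := lintegral_sq_enorm_deriv_exp_ne_top hG hinj hb
  set f : ℝ × ℝ → ℝ≥0∞ := fun p =>
    ‖deriv (fun w => G (Complex.exp w)) (p.1 + p.2 * Complex.I)‖ₑ ^ 2 with hf
  have hlim := tendsto_setLIntegral_zero (μ := volume.restrict (Ioo (-1 : ℝ) 0 ×ˢ Ioo (-1 : ℝ) 1))
    hfin (l := 𝓝[>] (0 : ℝ)) (s := fun δ : ℝ => Ioo (-δ) 0 ×ˢ Ioo (-δ) δ) (by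
      have h1 : Tendsto (fun δ : ℝ => ENNReal.ofReal δ * ENNReal.ofReal (δ - -δ)) (𝓝[>] 0)
          (𝓝 0) := by
        have hc : Continuous fun δ : ℝ => ENNReal.ofReal (δ * (δ - -δ)) :=
          ENNReal.continuous_ofReal.comp (by fun_prop)
        have h2 := hc.tendsto 0
        simp only [zero_mul, ENNReal.ofReal_zero] at h2
        refine (h2.mono_left nhdsWithin_le_nhds).congr' ?_
        filter_upwards [self_mem_nhdsWithin] with δ hδ
        exact ENNReal.ofReal_mul (le_of_lt hδ)
      refine tendsto_of_tendsto_of_tendsto_of_le_of_le tendsto_const_nhds h1 (fun _ => zero_le)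
        fun δ => ?_
      refine (Measure.restrict_apply_le _ _).trans (le_of_eq ?_)
      rw [Measure.volume_eq_prod, Measure.prod_prod, Real.volume_Ioo, Real.volume_Ioo, zero_sub,
        neg_neg])
  have hpos : (0 : ℝ≥0∞) < ENNReal.ofReal η ^ 2 / 2 :=
    ENNReal.div_pos (pow_ne_zero _ (by simpa using hη)) (by simp)
  obtain ⟨δ, hδlim, hδ⟩ := ((hlim.eventually (gt_mem_nhds hpos)).and
    (Ioo_mem_nhdsGT (lt_min hε one_pos))).exists
  have hδε : δ < ε := hδ.2.trans_le (min_le_left _ _)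
  have hδ1 : δ < 1 := hδ.2.trans_le (min_le_right _ _)
  have hsub : Ioo (-δ) 0 ×ˢ Ioo (-δ) δ ⊆ Ioo (-1 : ℝ) 0 ×ˢ Ioo (-1 : ℝ) 1 :=
    prod_mono (Ioo_subset_Ioo_left (by linarith)) (Ioo_subset_Ioo (by linarith) hδ1.le)
  rw [Measure.restrict_restrict (measurableSet_Ioo.prod measurableSet_Ioo),
    inter_eq_left.2 hsub] at hδlim
  have h2A : 2 * (∫⁻ p in Ioo (-δ) 0 ×ˢ Ioo (-δ) δ, f p) ≤ ENNReal.ofReal η ^ 2 := by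
    rw [mul_comm]
    exact (ENNReal.le_div_iff_mul_le (by simp) (by simp)).1 hδlim.le
  refine ⟨δ, ⟨hδ.1, hδε⟩, exists_short_arc hG hδ.1 le_rfl h2A hη,
    fun a b hab ha hbδ B hB hBG => exists_short_radius hG hb hδ.1 le_rfl ?_ hη hab ha hbδ hδ1 hB
      hBG⟩
  refine le_trans ?_ h2A
  exact le_mul_of_one_le_left zero_le one_le_two

end

/-! ### Parametrizations by the disk and crosscuts -/

section
open Metric

/-- `F` maps the unit disk homeomorphically onto the open set `U` of the sphere, with inverse `Φ`.
Both are total functions, with arbitrary values elsewhere. -/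
structure IsDiskParam (U : Set RiemannSphere) (F : ℂ → RiemannSphere) (Φ : RiemannSphere → ℂ) :
    Prop where
  isOpen : IsOpen U
  continuousOn : ContinuousOn F (ball 0 1)
  continuousOn_symm : ContinuousOn Φ U
  mapsTo : MapsTo F (ball 0 1) U
  mapsTo_symm : MapsTo Φ U (ball 0 1)
  left_inv : ∀ z ∈ ball 0 1, Φ (F z) = z
  right_inv : ∀ p ∈ U, F (Φ p) = p

namespace IsDiskParam
variable {U : Set RiemannSphere} {F : ℂ → RiemannSphere} {Φ : RiemannSphere → ℂ}

theorem injOn (h : IsDiskParam U F Φ) : InjOn F (ball 0 1) := fun z hz w hw e => by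
  rw [← h.left_inv z hz, e, h.left_inv w hw]

theorem mem_frontier_of_tendsto (h : IsDiskParam U F Φ) {ι : Type*} {l : Filter ι} [l.NeBot]
    {z : ι → ℂ} {ζ : ℂ} {q : RiemannSphere} (hz : ∀ᶠ i in l, z i ∈ ball (0 : ℂ) 1)
    (hζ : ζ ∉ ball (0 : ℂ) 1) (hlim : Tendsto z l (𝓝 ζ)) (hq : Tendsto (fun i => F (z i)) l (𝓝 q)) :
    q ∈ frontier U := by
  rw [h.isOpen.frontier_eq]
  refine ⟨mem_closure_of_tendsto hq (hz.mono fun i hi => h.mapsTo hi), fun hqU => hζ ?_⟩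
  have h1 : Tendsto (fun i => Φ (F (z i))) l (𝓝 (Φ q)) :=
    (h.continuousOn_symm.continuousAt (h.isOpen.mem_nhds hqU)).tendsto.comp hq
  have h2 : Tendsto z l (𝓝 (Φ q)) := h1.congr' (hz.mono fun i hi => h.left_inv _ hi)
  rw [tendsto_nhds_unique hlim h2]
  exact h.mapsTo_symm hqU

end IsDiskParam

/-- An injective path which tends to two distinct boundary points is a crosscut, and its closure
adds these two points only. -/
theorem isCrosscut_of_tendsto {U : Set RiemannSphere} {f : ℝ → RiemannSphere}
    {q₀ q₁ : RiemannSphere} (hU : IsOpen U) (hf : ContinuousOn f (Ioo 0 1)) (hi : InjOn f (Ioo 0 1))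
    (hm : MapsTo f (Ioo 0 1) U) (h0 : Tendsto f (𝓝[>] 0) (𝓝 q₀)) (h1 : Tendsto f (𝓝[<] 1) (𝓝 q₁))
    (hq0 : q₀ ∈ frontier U) (hq1 : q₁ ∈ frontier U) (hne : q₀ ≠ q₁) :
    IsCrosscut U (f '' Ioo 0 1) ∧ closure (f '' Ioo 0 1) ⊆ f '' Ioo 0 1 ∪ {q₀, q₁} := by
  obtain ⟨γ, hγ, e0, e1, eI⟩ : ∃ γ : ℝ → RiemannSphere, ContinuousOn γ (Icc 0 1) ∧ γ 0 = q₀ ∧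
      γ 1 = q₁ ∧ ∀ t ∈ Ioo (0 : ℝ) 1, γ t = f t :=
    ⟨extendFrom (Ioo (0 : ℝ) 1) f, continuousOn_Icc_extendFrom_Ioo hf h0 h1,
      eq_lim_at_left_extendFrom_Ioo zero_lt_one h0, eq_lim_at_right_extendFrom_Ioo zero_lt_one h1,
      fun t ht => extendFrom_eq (subset_closure ht) ((hf t ht).tendsto)⟩
  have hIcc : ∀ t ∈ Icc (0 : ℝ) 1, t = 0 ∨ t = 1 ∨ t ∈ Ioo (0 : ℝ) 1 := fun t ht => by
    rcases ht.1.eq_or_lt with h | h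
    · exact Or.inl h.symm
    · rcases ht.2.eq_or_lt with h' | h'
      · exact Or.inr (Or.inl h')
      · exact Or.inr (Or.inr ⟨h, h'⟩)
  rw [hU.frontier_eq] at hq0 hq1
  have him : γ '' Ioo 0 1 = f '' Ioo 0 1 := image_congr eI
  refine ⟨⟨γ, hγ, ?_, by rw [e0, hU.frontier_eq]; exact hq0, by rw [e1, hU.frontier_eq]; exact hq1,
    him, ?_⟩, ?_⟩
  · intro s hs t ht hst
    rcases hIcc s hs with rfl | rfl | hs' <;> rcases hIcc t ht with rfl | rfl | ht'
    · rfl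
    · rw [e0, e1] at hst; exact absurd hst hne
    · rw [e0, eI t ht'] at hst; exact absurd (hst ▸ hm ht') hq0.2
    · rw [e0, e1] at hst; exact absurd hst.symm hne
    · rfl
    · rw [e1, eI t ht'] at hst; exact absurd (hst ▸ hm ht') hq1.2
    · rw [e0, eI s hs'] at hst; exact absurd (hst ▸ hm hs') hq0.2
    · rw [e1, eI s hs'] at hst; exact absurd (hst ▸ hm hs') hq1.2
    · rw [eI s hs', eI t ht'] at hst; exact hi hs' ht' hst
  · rintro _ ⟨t, ht, rfl⟩; exact hm ht
  · have hcl : IsClosed (γ '' Icc 0 1) := (isCompact_Icc.image_of_continuousOn hγ).isClosed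
    refine (closure_minimal ?_ hcl).trans ?_
    · rw [← him]; exact image_mono Ioo_subset_Icc_self
    · rintro _ ⟨t, ht, rfl⟩
      rcases hIcc t ht with rfl | rfl | ht'
      · rw [e0]; simp
      · rw [e1]; simp
      · rw [eI t ht']; exact Or.inl (mem_image_of_mem f ht')

/-- First coordinate of the path along three sides of the rectangle with corners `(x₀, y₁)` and
`(0, y₂)`, all but the side on the axis `x = 0`. -/
def boxPathX (x₀ t : ℝ) : ℝ := x₀ * min 1 (min (3 * t) (3 * (1 - t)))

/-- Second coordinate of the path along three sides of a rectangle whose first coordinate is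
`boxPathX`. -/
def boxPathY (y₁ y₂ t : ℝ) : ℝ := y₁ + (y₂ - y₁) * max 0 (min 1 (3 * t - 1))

theorem continuous_boxPathX (x₀ : ℝ) : Continuous (boxPathX x₀) := by
  unfold boxPathX; fun_prop

theorem continuous_boxPathY (y₁ y₂ : ℝ) : Continuous (boxPathY y₁ y₂) := by
  unfold boxPathY; fun_prop

theorem boxPath_cases (x₀ y₁ y₂ : ℝ) {t : ℝ} (ht : t ∈ Ioo (0 : ℝ) 1) :
    (t < 1 / 3 ∧ boxPathX x₀ t = x₀ * (3 * t) ∧ boxPathY y₁ y₂ t = y₁) ∨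
    (1 / 3 ≤ t ∧ t ≤ 2 / 3 ∧ boxPathX x₀ t = x₀ ∧
      boxPathY y₁ y₂ t = y₁ + (y₂ - y₁) * (3 * t - 1)) ∨
    (2 / 3 < t ∧ boxPathX x₀ t = x₀ * (3 * (1 - t)) ∧ boxPathY y₁ y₂ t = y₂) := by
  have h0 := ht.1
  have h1 := ht.2
  unfold boxPathX boxPathY
  rcases lt_or_ge t (1 / 3) with h | h
  · left
    rw [min_eq_left (a := 3 * t) (by linarith), min_eq_right (a := (1 : ℝ)) (b := 3 * t)
      (by linarith), min_eq_right (a := (1 : ℝ)) (by linarith), max_eq_left (by linarith)]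
    exact ⟨h, rfl, by ring⟩
  · rcases le_or_gt t (2 / 3) with h' | h'
    · right; left
      rw [min_eq_left (a := (1 : ℝ)) (le_min (by linarith) (by linarith)),
        min_eq_right (a := (1 : ℝ)) (by linarith), max_eq_right (by linarith)]
      exact ⟨h, h', by ring, rfl⟩
    · right; right
      rw [min_eq_right (a := 3 * t) (by linarith), min_eq_right (a := (1 : ℝ)) (b := 3 * (1 - t))
        (by linarith), min_eq_left (a := (1 : ℝ)) (by linarith), max_eq_right (by linarith)]
      exact ⟨h', rfl, by ring⟩

theorem boxPath_injOn {x₀ y₁ y₂ : ℝ} (hx : x₀ < 0) (hy : y₁ < y₂) {s t : ℝ}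
    (hs : s ∈ Ioo (0 : ℝ) 1) (ht : t ∈ Ioo (0 : ℝ) 1) (h1 : boxPathX x₀ s = boxPathX x₀ t)
    (h2 : boxPathY y₁ y₂ s = boxPathY y₁ y₂ t) : s = t := by
  rcases boxPath_cases x₀ y₁ y₂ hs with ⟨a, b, c⟩ | ⟨a, a', b, c⟩ | ⟨a, b, c⟩ <;>
  rcases boxPath_cases x₀ y₁ y₂ ht with ⟨a2, b2, c2⟩ | ⟨a2, a2', b2, c2⟩ | ⟨a2, b2, c2⟩ <;>
  rw [b, b2] at h1 <;> rw [c, c2] at h2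
  · linarith [mul_left_cancel₀ hx.ne h1]
  · nlinarith
  · linarith
  · nlinarith
  · have h3 : (y₂ - y₁) * (3 * s - 1) = (y₂ - y₁) * (3 * t - 1) := by linarith
    linarith [mul_left_cancel₀ (sub_pos.2 hy).ne' h3]
  · nlinarith
  · linarith
  · nlinarith
  · linarith [mul_left_cancel₀ hx.ne h1]

theorem boxPath_mem {x₀ y₁ y₂ : ℝ} (hx : x₀ < 0) (hy : y₁ < y₂) {t : ℝ} (ht : t ∈ Ioo (0 : ℝ) 1) :
    boxPathX x₀ t ∈ Ico x₀ 0 ∧ boxPathY y₁ y₂ t ∈ Icc y₁ y₂ ∧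
      (boxPathX x₀ t = x₀ ∨ boxPathY y₁ y₂ t = y₁ ∨ boxPathY y₁ y₂ t = y₂) := by
  have h0 := ht.1
  have h1 := ht.2
  rcases boxPath_cases x₀ y₁ y₂ ht with ⟨a, b, c⟩ | ⟨a, a', b, c⟩ | ⟨a, b, c⟩ <;> rw [b, c]
  · exact ⟨⟨by nlinarith, by nlinarith⟩, ⟨le_rfl, hy.le⟩, by simp⟩
  · exact ⟨⟨by nlinarith, by nlinarith⟩, ⟨by nlinarith, by nlinarith⟩, by simp⟩
  · exact ⟨⟨by nlinarith, by nlinarith⟩, ⟨hy.le, le_rfl⟩, by simp⟩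

theorem exists_boxPath_eq {x₀ y₁ y₂ : ℝ} (hx : x₀ < 0) (hy : y₁ < y₂) {x y : ℝ}
    (hxI : x ∈ Ico x₀ 0) (hyI : y ∈ Icc y₁ y₂) (h : x = x₀ ∨ y = y₁ ∨ y = y₂) :
    ∃ t ∈ Ioo (0 : ℝ) 1, boxPathX x₀ t = x ∧ boxPathY y₁ y₂ t = y := by
  have hy' := sub_pos.2 hy
  have hr0 : 0 < x / x₀ := div_pos_of_neg_of_neg hxI.2 hx
  have hr1 : x / x₀ ≤ 1 := by rw [div_le_one_of_neg hx]; exact hxI.1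
  have hr : x₀ * (x / x₀) = x := mul_div_cancel₀ _ hx.ne
  rcases h with rfl | rfl | rfl
  · have hs0 : 0 ≤ (y - y₁) / (y₂ - y₁) := div_nonneg (by linarith [hyI.1]) hy'.le
    have hs1 : (y - y₁) / (y₂ - y₁) ≤ 1 := by rw [div_le_one hy']; linarith [hyI.2]
    have hs : (y₂ - y₁) * ((y - y₁) / (y₂ - y₁)) = y - y₁ := mul_div_cancel₀ _ hy'.ne'
    refine ⟨((y - y₁) / (y₂ - y₁) + 1) / 3, ⟨by linarith, by linarith⟩, ?_, ?_⟩
    · rw [boxPathX, min_eq_left (a := (1 : ℝ)) (le_min (by linarith) (by linarith)), mul_one]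
    · rw [boxPathY, min_eq_right (a := (1 : ℝ)) (by linarith), max_eq_right (by linarith)]
      linear_combination hs
  · refine ⟨x / x₀ / 3, ⟨by linarith, by linarith⟩, ?_, ?_⟩
    · rw [boxPathX, min_eq_left (a := 3 * _) (by linarith), min_eq_right (a := (1 : ℝ))
        (by linarith)]
      linear_combination hr
    · rw [boxPathY, min_eq_right (a := (1 : ℝ)) (by linarith), max_eq_left (by linarith)]
      ring
  · refine ⟨1 - x / x₀ / 3, ⟨by linarith, by linarith⟩, ?_, ?_⟩
    · rw [boxPathX, min_eq_right (a := 3 * _) (by linarith), min_eq_right (a := (1 : ℝ))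
        (by linarith)]
      linear_combination hr
    · rw [boxPathY, min_eq_left (a := (1 : ℝ)) (by linarith), max_eq_right (by linarith)]
      ring

end

/-! ### Short crosscuts around a boundary point of the disk -/

section
open Metric

/-- The crosscut `F '' Γ` of `U` is a small crosscut which cuts off the neighbourhood `R` of the
boundary point `ζ` of the disk. The diameter of `F '' Γ` is less than `ε`, and its end points are
not in `P`. -/
structure IsSmallCut (U : Set RiemannSphere) (F : ℂ → RiemannSphere) (ζ : ℂ) (ε : ℝ)
    (P : Set RiemannSphere) (Γ R : Set ℂ) : Prop where
  cut_subset : Γ ⊆ ball 0 1 ∩ ball ζ ε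
  subset : R ⊆ ball 0 1 ∩ ball ζ ε
  isOpen : IsOpen R
  isPreconnected : IsPreconnected R
  exists_ball_subset : ∃ r > 0, ball ζ r ∩ ball 0 1 ⊆ R
  disjoint : Disjoint R Γ
  exists_closed : ∃ K, IsClosed K ∧ R ∪ Γ = ball 0 1 ∩ K
  nonempty : Γ.Nonempty
  isPreconnected_cut : IsPreconnected Γ
  isCrosscut : IsCrosscut U (F '' Γ)
  disjoint_closure : Disjoint (closure (F '' Γ)) P
  finite : (closure (F '' Γ) ∩ frontier U).Finite
  chordalDist_lt : ∀ p ∈ F '' Γ, ∀ q ∈ F '' Γ, chordalDist p q < ε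

theorem continuous_polarPoint : Continuous fun p : ℝ × ℝ => polarPoint p.1 p.2 := by
  unfold polarPoint; fun_prop

theorem polarPoint_injOn {x y x' y' : ℝ} (hy : y ∈ Ioo (-1 : ℝ) 1) (hy' : y' ∈ Ioo (-1 : ℝ) 1)
    (h : polarPoint x y = polarPoint x' y') : x = x' ∧ y = y' := by
  have := Complex.exp_inj_of_neg_pi_lt_of_le_pi (x := x + y * Complex.I)
    (y := x' + y' * Complex.I) (by simpa using by linarith [hy.1, Real.pi_gt_three])
    (by simpa using by linarith [hy.2, Real.pi_gt_three])
    (by simpa using by linarith [hy'.1, Real.pi_gt_three])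
    (by simpa using by linarith [hy'.2, Real.pi_gt_three]) h
  constructor
  · simpa using congrArg Complex.re this
  · simpa using congrArg Complex.im this

theorem polarPoint_mem_ball_one {x y δ : ℝ} (hδ : δ ≤ 1 / 2) (hx : |x| < δ) (hy : |y| < δ) :
    polarPoint x y ∈ ball (1 : ℂ) (4 * δ) := by
  have h1 : ‖(x + y * Complex.I : ℂ)‖ < 2 * δ := by
    refine (norm_add_le _ _).trans_lt ?_
    simp only [Complex.norm_real, norm_mul, Complex.norm_I, mul_one, Real.norm_eq_abs]
    linarith
  rw [mem_ball_iff_norm, polarPoint]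
  have := Complex.norm_exp_sub_one_le (x := x + y * Complex.I) (by linarith)
  linarith

/-- The region of the disk cut off by the three sides of a small box in logarithmic polar
coordinates around `ζ`. -/
def polarBox (ζ : ℂ) (x₀ y₁ y₂ : ℝ) : Set ℂ :=
  (fun p : ℝ × ℝ => ζ * polarPoint p.1 p.2) '' (Ioo x₀ 0 ×ˢ Ioo y₁ y₂)

/-- The part in the disk of the boundary of `polarBox`. -/
def polarBoxCut (ζ : ℂ) (x₀ y₁ y₂ : ℝ) : Set ℂ :=
  (fun t : ℝ => ζ * polarPoint (boxPathX x₀ t) (boxPathY y₁ y₂ t)) '' Ioo 0 1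

theorem mul_mem_ball_iff {ζ : ℂ} (hζ : ‖ζ‖ = 1) {z : ℂ} :
    ζ * z ∈ ball (0 : ℂ) 1 ↔ z ∈ ball (0 : ℂ) 1 := by
  simp [hζ]

theorem isOpen_image_polarPoint {ζ : ℂ} (hζ : ‖ζ‖ = 1) {S : Set (ℝ × ℝ)} (hS : IsOpen S) :
    IsOpen ((fun p : ℝ × ℝ => ζ * polarPoint p.1 p.2) '' S) := by
  have hζ0 : ζ ≠ 0 := by rintro rfl; simp at hζ
  have h1 : (fun p : ℝ × ℝ => ζ * polarPoint p.1 p.2) =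
      (fun z => ζ * z) ∘ Complex.exp ∘ Complex.equivRealProdCLM.symm := by
    ext p
    simp [polarPoint, Complex.equivRealProdCLM_symm_apply]
  rw [h1, image_comp, image_comp]
  exact (Homeomorph.mulLeft₀ ζ hζ0).isOpenMap _ (Complex.isOpenMap_exp _
    (Complex.equivRealProdCLM.symm.toHomeomorph.isOpenMap _ hS))

section
variable {ζ : ℂ} {x₀ y₁ y₂ : ℝ}

theorem polarBox_union_cut (hζ : ‖ζ‖ = 1) (hx : x₀ < 0) (hy : y₁ < y₂) :
    polarBox ζ x₀ y₁ y₂ ∪ polarBoxCut ζ x₀ y₁ y₂ = ball 0 1 ∩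
      (fun p : ℝ × ℝ => ζ * polarPoint p.1 p.2) '' (Icc x₀ 0 ×ˢ Icc y₁ y₂) := by
  ext z
  constructor
  · rintro (⟨⟨x, y⟩, ⟨hx', hy'⟩, rfl⟩ | ⟨t, ht, rfl⟩)
    · exact ⟨(mul_mem_ball_iff hζ).2 (polarPoint_mem_ball hx'.2 _), (x, y),
        ⟨Ioo_subset_Icc_self hx', Ioo_subset_Icc_self hy'⟩, rfl⟩
    · obtain ⟨h1, h2, -⟩ := boxPath_mem hx hy ht
      exact ⟨(mul_mem_ball_iff hζ).2 (polarPoint_mem_ball h1.2 _), (_, _),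
        ⟨Ico_subset_Icc_self h1, h2⟩, rfl⟩
  · rintro ⟨hz, ⟨x, y⟩, ⟨hx', hy'⟩, rfl⟩
    have hx0 : x < 0 := by
      have := (mul_mem_ball_iff hζ).1 hz
      rw [mem_ball_zero_iff, polarPoint, Complex.norm_exp] at this
      simpa using this
    by_cases h : x = x₀ ∨ y = y₁ ∨ y = y₂
    · obtain ⟨t, ht, e1, e2⟩ := exists_boxPath_eq hx hy ⟨hx'.1, hx0⟩ hy' h
      right
      exact ⟨t, ht, by simp only [e1, e2]⟩
    · push Not at h
      left
      exact ⟨(x, y), ⟨⟨lt_of_le_of_ne hx'.1 (Ne.symm h.1), hx0⟩,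
        ⟨lt_of_le_of_ne hy'.1 (Ne.symm h.2.1), lt_of_le_of_ne hy'.2 h.2.2⟩⟩, rfl⟩

theorem disjoint_polarBox_cut (hζ : ‖ζ‖ = 1) (hx : x₀ < 0) (hy : y₁ < y₂) (h1 : -1 < y₁)
    (h2 : y₂ < 1) : Disjoint (polarBox ζ x₀ y₁ y₂) (polarBoxCut ζ x₀ y₁ y₂) := by
  have hζ0 : ζ ≠ 0 := by rintro rfl; simp at hζ
  rw [disjoint_left]
  rintro _ ⟨⟨x, y⟩, ⟨hx', hy'⟩, rfl⟩ ⟨t, ht, h⟩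
  obtain ⟨h3, h4, h5⟩ := boxPath_mem hx hy ht
  obtain ⟨e1, e2⟩ := polarPoint_injOn ⟨h1.trans_le h4.1, h4.2.trans_lt h2⟩
    ⟨h1.trans hy'.1, hy'.2.trans h2⟩ (mul_left_cancel₀ hζ0 h)
  rw [e1, e2] at h5
  rcases h5 with h5 | h5 | h5
  · exact hx'.1.ne' h5
  · exact hy'.1.ne' h5
  · exact hy'.2.ne h5

end

theorem tendsto_boxPathX_zero {x₀ : ℝ} (hx : x₀ < 0) :
    Tendsto (boxPathX x₀) (𝓝[>] 0) (𝓝[<] 0) := by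
  refine tendsto_nhdsWithin_iff.2 ⟨?_, ?_⟩
  · have := (continuous_boxPathX x₀).tendsto 0
    simp only [boxPathX, mul_zero, sub_zero, mul_one] at this
    rw [min_eq_left (a := (0 : ℝ)) (by norm_num), min_eq_right (a := (1 : ℝ)) (by norm_num),
      mul_zero] at this
    exact this.mono_left nhdsWithin_le_nhds
  · filter_upwards [Ioo_mem_nhdsGT (zero_lt_one' ℝ)] with t ht
    exact (boxPath_mem hx zero_lt_one ht).1.2

theorem tendsto_boxPathX_one {x₀ : ℝ} (hx : x₀ < 0) :
    Tendsto (boxPathX x₀) (𝓝[<] 1) (𝓝[<] 0) := by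
  refine tendsto_nhdsWithin_iff.2 ⟨?_, ?_⟩
  · have := (continuous_boxPathX x₀).tendsto 1
    simp only [boxPathX, sub_self, mul_zero, mul_one] at this
    rw [min_eq_right (a := (3 : ℝ)) (by norm_num), min_eq_right (by norm_num), mul_zero] at this
    exact this.mono_left nhdsWithin_le_nhds
  · filter_upwards [Ioo_mem_nhdsLT (zero_lt_one' ℝ)] with t ht
    exact (boxPath_mem hx zero_lt_one ht).1.2

/-- The limit of `F` along a radius, if it exists, is a boundary point. -/
theorem IsDiskParam.mem_frontier_of_tendsto_radius {U : Set RiemannSphere} {F : ℂ → RiemannSphere}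
    {Φ : RiemannSphere → ℂ} (hF : IsDiskParam U F Φ) {ζ : ℂ} (hζ : ‖ζ‖ = 1) {y : ℝ}
    {q : RiemannSphere} (hq : Tendsto (fun x => F (ζ * polarPoint x y)) (𝓝[<] 0) (𝓝 q)) :
    q ∈ frontier U := by
  refine hF.mem_frontier_of_tendsto (z := fun x => ζ * polarPoint x y) (ζ := ζ * polarPoint 0 y)
    ?_ ?_ ?_ hq
  · filter_upwards [self_mem_nhdsWithin] with x hx
    exact (mul_mem_ball_iff hζ).2 (polarPoint_mem_ball hx y)
  · rw [mul_mem_ball_iff hζ, mem_ball_zero_iff, polarPoint, Complex.norm_exp]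
    simp
  · have : Continuous fun x => ζ * polarPoint x y := by unfold polarPoint; fun_prop
    exact (this.tendsto 0).mono_left nhdsWithin_le_nhds

/-- Every boundary point of the disk has arbitrarily small neighbourhoods which are cut off by
a short crosscut. The crosscut is the image of three sides of a box in logarithmic polar
coordinates. The injective function `G` maps these sides to short curves, and `Q` is uniformly
continuous on the range of `G`. The finite fibres of `Q` allow to avoid `P`, and to give the two
radial sides different end points. -/
theorem exists_isSmallCut {U : Set RiemannSphere} {F : ℂ → RiemannSphere} {Φ : RiemannSphere → ℂ}
    (hF : IsDiskParam U F Φ) {G : ℂ → ℂ} {Q : ℂ → RiemannSphere}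
    (hG : DifferentiableOn ℂ G (ball 0 1)) (hinj : InjOn G (ball 0 1))
    (hb : Bornology.IsBounded (G '' ball 0 1)) (hQ : Continuous Q)
    (hQfin : ∀ p, (Q ⁻¹' {p}).Finite) (hFG : ∀ z ∈ ball (0 : ℂ) 1, F z = Q (G z))
    {ζ : ℂ} (hζ : ‖ζ‖ = 1) {ε : ℝ} (hε : 0 < ε) {P : Set RiemannSphere} (hP : P.Finite)
    (hPU : P ⊆ frontier U) : ∃ Γ R, IsSmallCut U F ζ ε P Γ R := by
  have hζ0 : ζ ≠ 0 := by rintro rfl; simp at hζ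
  have hmaps : MapsTo (fun z => ζ * z) (ball (0 : ℂ) 1) (ball 0 1) := fun z hz =>
    (mul_mem_ball_iff hζ).2 hz
  have hG' : DifferentiableOn ℂ (fun z => G (ζ * z)) (ball 0 1) :=
    hG.comp (by fun_prop) hmaps
  have hinj' : InjOn (fun z => G (ζ * z)) (ball 0 1) :=
    hinj.comp (fun z _ w _ h => mul_left_cancel₀ hζ0 h) hmaps
  have himg : (fun z => G (ζ * z)) '' ball 0 1 ⊆ G '' ball 0 1 := by
    rintro _ ⟨z, hz, rfl⟩; exact mem_image_of_mem G (hmaps hz)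
  have hdisj : ∀ P' : Set RiemannSphere, P' ⊆ frontier U →
      Disjoint (Q ⁻¹' P') ((fun z => G (ζ * z)) '' ball 0 1) := fun P' hP' => by
    refine Disjoint.mono_right himg (disjoint_left.2 ?_)
    rintro _ hu ⟨z, hz, rfl⟩
    have h1 := hP' hu
    rw [← hFG z hz, hF.isOpen.frontier_eq] at h1
    exact h1.2 (hF.mapsTo hz)
  obtain ⟨η, hη, hηQ⟩ := exists_chordalDist_lt hQ hb.isCompact_closure hε
  obtain ⟨δ, hδ, ⟨x₀, hx₀, harc⟩, hrad⟩ := exists_short_box hG' hinj' (hb.subset himg)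
    (lt_min (by positivity : 0 < ε / 4) one_half_pos) (by positivity : 0 < η / 4)
  have hδ2 : δ ≤ 1 / 2 := hδ.2.le.trans (min_le_right _ _)
  have hδε : 4 * δ < ε := by linarith [hδ.2.trans_le (min_le_left (ε / 4) (1 / 2))]
  -- the first radial side, whose end point avoids `P`
  obtain ⟨y₁, hy₁, p₁, hp₁, hp₁P, hrad₁⟩ := hrad (-δ) 0 (by ring) le_rfl hδ.1.le (Q ⁻¹' P)
    (hP.preimage' fun b _ => hQfin b) (hdisj P hPU)
  have hlim : ∀ {y : ℝ} {p : ℂ}, Tendsto (fun x => G (ζ * polarPoint x y)) (𝓝[<] 0) (𝓝 p) →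
      Tendsto (fun x => F (ζ * polarPoint x y)) (𝓝[<] 0) (𝓝 (Q p)) := fun {y p} h => by
    refine ((hQ.tendsto p).comp h).congr' ?_
    filter_upwards [self_mem_nhdsWithin] with x hx
    exact (hFG _ ((mul_mem_ball_iff hζ).2 (polarPoint_mem_ball hx y))).symm
  have hq₁ : Q p₁ ∈ frontier U := hF.mem_frontier_of_tendsto_radius hζ (hlim hp₁)
  -- the second radial side, whose end point also differs from that of the first one
  obtain ⟨y₂, hy₂, p₂, hp₂, hp₂P, hrad₂⟩ := hrad 0 δ (by ring) (by linarith [hδ.1]) le_rfl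
    (Q ⁻¹' (insert (Q p₁) P)) ((hP.insert _).preimage' fun b _ => hQfin b)
    (hdisj _ (insert_subset hq₁ hPU))
  have hq₂ : Q p₂ ∈ frontier U := hF.mem_frontier_of_tendsto_radius hζ (hlim hp₂)
  have hne : Q p₁ ≠ Q p₂ := fun h => hp₂P (by rw [mem_preimage, ← h]; exact mem_insert _ _)
  have hp₂P' : Q p₂ ∉ P := fun h => hp₂P (mem_insert_of_mem _ h)
  have hx0 : x₀ < 0 := hx₀.2
  have hyy : y₁ < y₂ := hy₁.2.trans hy₂.1
  have hnear : ∀ {x y : ℝ}, x ∈ Ico x₀ 0 → y ∈ Icc y₁ y₂ →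
      ζ * polarPoint x y ∈ ball (0 : ℂ) 1 ∩ ball ζ ε := fun {x y} hx hy => by
    refine ⟨(mul_mem_ball_iff hζ).2 (polarPoint_mem_ball hx.2 y), ?_⟩
    have h1 := polarPoint_mem_ball_one hδ2 (abs_lt.2 ⟨by linarith [hx₀.1, hx.1], by
      linarith [hx.2, hδ.1]⟩ : |x| < δ)
      (abs_lt.2 ⟨by linarith [hy₁.1, hy.1], by linarith [hy.2, hy₂.2]⟩ : |y| < δ)
    rw [mem_ball_iff_norm] at h1 ⊢
    have : ζ * polarPoint x y - ζ = ζ * (polarPoint x y - 1) := by ring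
    rw [this, norm_mul, hζ, one_mul]
    linarith
  have hcutball : ∀ {t : ℝ}, t ∈ Ioo (0 : ℝ) 1 →
      ζ * polarPoint (boxPathX x₀ t) (boxPathY y₁ y₂ t) ∈ ball (0 : ℂ) 1 ∩ ball ζ ε := fun ht =>
    hnear (boxPath_mem hx0 hyy ht).1 (boxPath_mem hx0 hyy ht).2.1
  have hpathc : Continuous fun t => ζ * polarPoint (boxPathX x₀ t) (boxPathY y₁ y₂ t) :=
    continuous_const.mul (continuous_polarPoint.comp
      ((continuous_boxPathX x₀).prodMk (continuous_boxPathY y₁ y₂)))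
  let f : ℝ → RiemannSphere := fun t => F (ζ * polarPoint (boxPathX x₀ t) (boxPathY y₁ y₂ t))
  have hFcut : F '' polarBoxCut ζ x₀ y₁ y₂ = f '' Ioo 0 1 := by
    rw [polarBoxCut, image_image]
  have hf0 : Tendsto f (𝓝[>] 0) (𝓝 (Q p₁)) := by
    refine ((hlim hp₁).comp (tendsto_boxPathX_zero hx0)).congr' ?_
    filter_upwards [Ioo_mem_nhdsGT (by norm_num : (0 : ℝ) < 1 / 3)] with t ht
    rcases boxPath_cases x₀ y₁ y₂ (t := t) ⟨ht.1, by linarith [ht.2]⟩ with h | h | h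
    · simp only [f, Function.comp, h.2.2]
    · exact absurd h.1 (not_le.2 ht.2)
    · linarith [h.1, ht.2]
  have hf1 : Tendsto f (𝓝[<] 1) (𝓝 (Q p₂)) := by
    refine ((hlim hp₂).comp (tendsto_boxPathX_one hx0)).congr' ?_
    filter_upwards [Ioo_mem_nhdsLT (by norm_num : (2 / 3 : ℝ) < 1)] with t ht
    rcases boxPath_cases x₀ y₁ y₂ (t := t) ⟨by linarith [ht.1], ht.2⟩ with h | h | h
    · linarith [h.1, ht.1]
    · linarith [h.2.1, ht.1]
    · simp only [f, Function.comp, h.2.2]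
  obtain ⟨hcross, hclos⟩ := isCrosscut_of_tendsto hF.isOpen
    (hF.continuousOn.comp hpathc.continuousOn fun t ht => (hcutball ht).1)
    (fun s hs t ht hst => by
      have h1 := mul_left_cancel₀ hζ0 (hF.injOn (hcutball hs).1 (hcutball ht).1 hst)
      have hb1 := (boxPath_mem hx0 hyy hs).2.1
      have hb2 := (boxPath_mem hx0 hyy ht).2.1
      obtain ⟨e1, e2⟩ := polarPoint_injOn
        ⟨by linarith [hb1.1, hy₁.1], by linarith [hb1.2, hy₂.2]⟩
        ⟨by linarith [hb2.1, hy₁.1], by linarith [hb2.2, hy₂.2]⟩ h1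
      exact boxPath_injOn hx0 hyy hs ht e1 e2)
    (fun t ht => hF.mapsTo (hcutball ht).1) hf0 hf1 hq₁ hq₂ hne
  have hfU : ∀ t ∈ Ioo (0 : ℝ) 1, f t ∉ frontier U := fun t ht h => by
    rw [hF.isOpen.frontier_eq] at h
    exact h.2 (hF.mapsTo (hcutball ht).1)
  have hcorner : ∀ t ∈ Ioo (0 : ℝ) 1, dist
      (G (ζ * polarPoint (boxPathX x₀ t) (boxPathY y₁ y₂ t))) (G (ζ * polarPoint x₀ y₁)) ≤ η / 2 :=
    fun t ht => by
    obtain ⟨h1, h2, h3⟩ := boxPath_mem hx0 hyy ht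
    have hX : boxPathX x₀ t ∈ Ioo (-δ) 0 := ⟨hx₀.1.trans_le h1.1, h1.2⟩
    have hY : boxPathY y₁ y₂ t ∈ Ioo (-δ) δ := ⟨hy₁.1.trans_le h2.1, h2.2.trans_lt hy₂.2⟩
    have hY₁ : y₁ ∈ Ioo (-δ) δ := ⟨hy₁.1, hy₁.2.trans hδ.1⟩
    have hY₂ : y₂ ∈ Ioo (-δ) δ := ⟨by linarith [hy₂.1, hδ.1], hy₂.2⟩
    rcases h3 with h3 | h3 | h3 <;> rw [h3]
    · linarith [harc _ hY _ hY₁]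
    · linarith [hrad₁ _ hX _ hx₀]
    · linarith [hrad₂ _ hX _ hx₀, harc _ hY₂ _ hY₁, dist_triangle
        (G (ζ * polarPoint (boxPathX x₀ t) y₂)) (G (ζ * polarPoint x₀ y₂))
        (G (ζ * polarPoint x₀ y₁))]
  refine ⟨polarBoxCut ζ x₀ y₁ y₂, polarBox ζ x₀ y₁ y₂, ?_⟩
  constructor
  · rintro _ ⟨t, ht, rfl⟩; exact hcutball ht
  · rintro _ ⟨⟨x, y⟩, ⟨hx, hy⟩, rfl⟩
    exact hnear ⟨hx.1.le, hx.2⟩ (Ioo_subset_Icc_self hy)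
  · exact isOpen_image_polarPoint hζ (isOpen_Ioo.prod isOpen_Ioo)
  · exact (isPreconnected_Ioo.prod isPreconnected_Ioo).image _
      (continuous_const.mul continuous_polarPoint).continuousOn
  · have hop : IsOpen ((fun p : ℝ × ℝ => ζ * polarPoint p.1 p.2) '' (Ioo x₀ 1 ×ˢ Ioo y₁ y₂)) :=
      isOpen_image_polarPoint hζ (isOpen_Ioo.prod isOpen_Ioo)
    have hmem : ζ ∈ (fun p : ℝ × ℝ => ζ * polarPoint p.1 p.2) '' (Ioo x₀ 1 ×ˢ Ioo y₁ y₂) :=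
      ⟨(0, 0), ⟨⟨hx0, zero_lt_one⟩, ⟨hy₁.2, hy₂.1⟩⟩, by simp [polarPoint]⟩
    obtain ⟨r, hr, hsub⟩ := Metric.isOpen_iff.1 hop ζ hmem
    refine ⟨r, hr, ?_⟩
    rintro _ ⟨hz, hz1⟩
    obtain ⟨⟨x, y⟩, ⟨hx, hy⟩, rfl⟩ := hsub hz
    have : x < 0 := by
      have := (mul_mem_ball_iff hζ).1 hz1
      rw [mem_ball_zero_iff, polarPoint, Complex.norm_exp] at this
      simpa using this
    exact ⟨(x, y), ⟨⟨hx.1, this⟩, hy⟩, rfl⟩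
  · exact disjoint_polarBox_cut hζ hx0 hyy (by linarith [hy₁.1]) (by linarith [hy₂.2])
  · exact ⟨_, ((isCompact_Icc.prod isCompact_Icc).image
      (continuous_const.mul continuous_polarPoint)).isClosed, polarBox_union_cut hζ hx0 hyy⟩
  · exact (nonempty_Ioo.2 zero_lt_one).image _
  · exact isPreconnected_Ioo.image _ hpathc.continuousOn
  · rw [hFcut]; exact hcross
  · rw [hFcut]
    refine disjoint_left.2 fun p hp hpP => ?_
    rcases hclos hp with ⟨t, ht, rfl⟩ | rfl | h
    · exact hfU t ht (hPU hpP)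
    · exact hp₁P hpP
    · rw [mem_singleton_iff] at h; exact hp₂P' (h ▸ hpP)
  · rw [hFcut]
    refine (toFinite {Q p₁, Q p₂}).subset ?_
    rintro p ⟨hp, hpU⟩
    rcases hclos hp with ⟨t, ht, rfl⟩ | h
    · exact absurd hpU (hfU t ht)
    · exact h
  · rw [hFcut]
    rintro _ ⟨s, hs, rfl⟩ _ ⟨t, ht, rfl⟩
    simp only [f]
    rw [hFG _ (hcutball hs).1, hFG _ (hcutball ht).1]
    refine hηQ _ (subset_closure (mem_image_of_mem G (hcutball hs).1)) _
      (subset_closure (mem_image_of_mem G (hcutball ht).1)) ?_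
    have h1 := hcorner s hs
    have h2 := hcorner t ht
    rw [dist_comm] at h2
    linarith [dist_triangle (G (ζ * polarPoint (boxPathX x₀ s) (boxPathY y₁ y₂ s)))
      (G (ζ * polarPoint x₀ y₁)) (G (ζ * polarPoint (boxPathX x₀ t) (boxPathY y₁ y₂ t)))]

end

/-! ### The point of the circle determined by a fundamental chain -/

section
open Metric

/-- Every boundary point of the disk has arbitrarily small neighbourhoods which are cut off by
short crosscuts, with end points outside a given finite set. -/
def HasSmallCuts (U : Set RiemannSphere) (F : ℂ → RiemannSphere) : Prop :=
  ∀ ζ : ℂ, ‖ζ‖ = 1 → ∀ ε > 0, ∀ P : Set RiemannSphere, P.Finite → P ⊆ frontier U →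
    ∃ Γ R, IsSmallCut U F ζ ε P Γ R

section
variable {U : Set RiemannSphere} {F : ℂ → RiemannSphere} {Φ : RiemannSphere → ℂ}

namespace IsDiskParam

theorem image_image_symm (hF : IsDiskParam U F Φ) {S : Set RiemannSphere} (hS : S ⊆ U) :
    F '' (Φ '' S) = S := by
  rw [image_image]
  exact (image_congr fun p hp => hF.right_inv p (hS hp)).trans (image_id' S)

theorem symm_image_image (hF : IsDiskParam U F Φ) {S : Set ℂ} (hS : S ⊆ ball 0 1) :
    Φ '' (F '' S) = S := by
  rw [image_image]
  exact (image_congr fun p hp => hF.left_inv p (hS hp)).trans (image_id' S)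

theorem symm_image_subset (hF : IsDiskParam U F Φ) {S : Set RiemannSphere} (hS : S ⊆ U) :
    Φ '' S ⊆ ball 0 1 := (hF.mapsTo_symm.mono_left hS).image_subset

theorem image_subset (hF : IsDiskParam U F Φ) {S : Set ℂ} (hS : S ⊆ ball 0 1) :
    F '' S ⊆ U := (hF.mapsTo.mono_left hS).image_subset

end IsDiskParam

namespace IsSmallCut
variable {ζ : ℂ} {ε : ℝ} {P : Set RiemannSphere} {Γ R : Set ℂ}

/-- A connected subset of the disk which does not meet the cut lies on one side of it. -/
theorem subset_of_isPreconnected (h : IsSmallCut U F ζ ε P Γ R) {α : Set ℂ}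
    (hα : IsPreconnected α) (hball : α ⊆ ball 0 1) (hΓ : Disjoint α Γ) (hR : (α ∩ R).Nonempty) :
    α ⊆ R := by
  obtain ⟨K, hK, hRK⟩ := h.exists_closed
  have hRK' : R ⊆ K := fun z hz => (hRK.subset (Or.inl hz)).2
  refine hα.subset_left_of_subset_union h.isOpen hK.isOpen_compl
    (disjoint_compl_right.mono_left hRK') (fun z hz => ?_) hR
  by_cases hzK : z ∈ K
  · rcases hRK.symm.subset ⟨hball hz, hzK⟩ with h' | h'
    · exact Or.inl h'
    · exact absurd h' (disjoint_left.1 hΓ hz)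
  · exact Or.inr hzK

/-- A connected subset of the disk which accumulates at `ζ` but is not contained in a small
neighbourhood of `ζ` meets the cut. -/
theorem exists_mem_cut (h : IsSmallCut U F ζ ε P Γ R) {α : Set ℂ}
    (hα : IsPreconnected α) (hball : α ⊆ ball 0 1) (hζ : ζ ∈ closure α) (hε : ¬ α ⊆ ball ζ ε) :
    ∃ z ∈ α, z ∈ Γ := by
  by_contra! hcon
  refine hε ((h.subset_of_isPreconnected hα hball (disjoint_left.2 hcon) ?_).trans
    (h.subset.trans inter_subset_right))
  obtain ⟨r, hr, hsub⟩ := h.exists_ball_subset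
  obtain ⟨z, hz, hzα⟩ := mem_closure_iff_nhds.1 hζ _ (ball_mem_nhds ζ hr)
  exact ⟨z, hzα, hsub ⟨hz, hball hzα⟩⟩

theorem closure_image_inter_subset (h : IsSmallCut U F ζ ε P Γ R) (hF : IsDiskParam U F Φ) :
    closure (F '' Γ) ∩ U ⊆ F '' Γ := by
  rintro q ⟨hq, hqU⟩
  obtain ⟨K, hK, hRK⟩ := h.exists_closed
  have hΓb : Γ ⊆ ball 0 1 := h.cut_subset.trans inter_subset_left
  have h1 : Φ q ∈ closure Γ := by
    have := ((hF.continuousOn_symm.continuousAt (hF.isOpen.mem_nhds hqU)).continuousWithinAt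
      (s := F '' Γ)).mem_closure_image hq
    rwa [hF.symm_image_image hΓb] at this
  have h2 : Φ q ∈ K := closure_minimal (fun z hz => (hRK.subset (Or.inr hz)).2) hK h1
  have h3 : Φ q ∈ Rᶜ := closure_minimal (fun z hz hz' => disjoint_left.1 h.disjoint hz' hz)
    h.isOpen.isClosed_compl h1
  rcases hRK.symm.subset ⟨hF.mapsTo_symm hqU, h2⟩ with h' | h'
  · exact absurd h' h3
  · exact ⟨Φ q, h', hF.right_inv q hqU⟩

end IsSmallCut

namespace IsCrosscut
variable {A : Set RiemannSphere}

theorem subset (h : IsCrosscut U A) : A ⊆ U := by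
  obtain ⟨γ, -, -, -, -, -, h⟩ := h; exact h

theorem isPreconnected (h : IsCrosscut U A) : IsPreconnected A := by
  obtain ⟨γ, hc, -, -, -, rfl, -⟩ := h
  exact isPreconnected_Ioo.image _ (hc.mono Ioo_subset_Icc_self)

theorem nonempty (h : IsCrosscut U A) : A.Nonempty := by
  obtain ⟨γ, hc, -, -, -, rfl, -⟩ := h
  exact (nonempty_Ioo.2 zero_lt_one).image _

theorem exists_mem_closure (h : IsCrosscut U A) : ∃ q ∈ frontier U, q ∈ closure A := by
  obtain ⟨γ, hc, -, h0, -, rfl, -⟩ := h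
  refine ⟨γ 0, h0, ?_⟩
  have h1 : (0 : ℝ) ∈ closure (Ioo (0 : ℝ) 1) := by
    rw [closure_Ioo zero_ne_one]; exact ⟨le_rfl, zero_le_one⟩
  exact ((hc 0 ⟨le_rfl, zero_le_one⟩).mono Ioo_subset_Icc_self).mem_closure_image h1

end IsCrosscut

namespace FundamentalChain

theorem cut_subset (C : FundamentalChain U) (j : ℕ) : C.cut j ⊆ U := (C.isCrosscut j).subset

theorem nhd_subset (C : FundamentalChain U) (j : ℕ) : C.nhd j ⊆ U \ C.cut j := by
  obtain ⟨p, -, h⟩ := C.isCrosscutNhd j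
  rw [h]; exact connectedComponentIn_subset _ _

theorem nhd_nonempty (C : FundamentalChain U) (j : ℕ) : (C.nhd j).Nonempty := by
  obtain ⟨p, hp, h⟩ := C.isCrosscutNhd j
  exact ⟨p, h ▸ mem_connectedComponentIn hp⟩

theorem nhd_antitone (C : FundamentalChain U) : Antitone C.nhd := antitone_nat_of_succ_le C.nested

/-- A connected subset of `U` which does not meet a crosscut lies in the crosscut neighbourhood
as soon as it meets it. -/
theorem subset_nhd (C : FundamentalChain U) {j : ℕ} {S : Set RiemannSphere}
    (hS : IsPreconnected S) (hSU : S ⊆ U \ C.cut j) (hne : (S ∩ C.nhd j).Nonempty) :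
    S ⊆ C.nhd j := by
  obtain ⟨p, hp, h⟩ := C.isCrosscutNhd j
  obtain ⟨q, hqS, hq⟩ := hne
  rw [h] at hq ⊢
  rw [connectedComponentIn_eq hq]
  exact hS.subset_connectedComponentIn hqS hSU

/-- Along a suitable ultrafilter the crosscuts of a chain converge to a boundary point of `U`, and
their preimages in the disk accumulate at a point of the unit circle. -/
theorem exists_ultrafilter (hF : IsDiskParam U F Φ) (C : FundamentalChain U) :
    ∃ g : Ultrafilter ℕ, (g : Filter ℕ) ≤ atTop ∧ ∃ p ∈ frontier U, ∃ ζ : ℂ, ‖ζ‖ = 1 ∧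
      (∀ V ∈ 𝓝 p, ∀ᶠ j in (g : Filter ℕ), C.cut j ⊆ V) ∧
      ∃ z : ℕ → ℂ, (∀ j, z j ∈ Φ '' C.cut j) ∧ Tendsto z g (𝓝 ζ) := by
  choose e he hecl using fun j => (C.isCrosscut j).exists_mem_closure
  have hnear : ∀ j, ∃ a ∈ C.cut j, chordalDist (e j) a < 1 / ((j : ℝ) + 1) := fun j => by
    have hc : Continuous fun a => chordalDist (e j) a :=
      continuous_chordalDist.comp (continuous_const.prodMk continuous_id)
    have ho : IsOpen {a | chordalDist (e j) a < 1 / ((j : ℝ) + 1)} :=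
      isOpen_lt hc continuous_const
    obtain ⟨a, ha, haC⟩ := mem_closure_iff.1 (hecl j) _ ho
      (by rw [mem_ofPred_eq, chordalDist_self]; positivity)
    exact ⟨a, haC, ha⟩
  choose a ha hea using hnear
  let g := hyperfilter ℕ
  have hg : (g : Filter ℕ) ≤ atTop := Nat.hyperfilter_le_atTop
  obtain ⟨p, -, hp⟩ := isCompact_univ.ultrafilter_le_nhds (g.map e) (by simp)
  have hp' : Tendsto e g (𝓝 p) := hp
  have hpU : p ∈ frontier U := isClosed_frontier.mem_of_tendsto hp' (Eventually.of_forall he)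
  have hap : Tendsto a g (𝓝 p) := by
    refine tendsto_of_chordalDist_tendsto hp' (Tendsto.mono_left ?_ hg)
    refine squeeze_zero (fun j => ?_) (fun j => (hea j).le)
      (tendsto_one_div_add_atTop_nhds_zero_nat (𝕜 := ℝ))
    exact chordalDist_nonneg _ _
  have hzb : ∀ j, Φ (a j) ∈ ball (0 : ℂ) 1 := fun j => hF.mapsTo_symm (C.cut_subset j (ha j))
  obtain ⟨ζ, hζ, hzζ⟩ := (isCompact_closedBall (0 : ℂ) 1).ultrafilter_le_nhds
    (g.map fun j => Φ (a j)) (by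
      rw [le_principal_iff]
      exact Eventually.of_forall (f := (g : Filter ℕ)) fun j => ball_subset_closedBall (hzb j))
  have hzζ' : Tendsto (fun j => Φ (a j)) g (𝓝 ζ) := hzζ
  have hζb : ζ ∉ ball (0 : ℂ) 1 := fun hζb => by
    have h1 := ((hF.continuousOn.continuousAt (isOpen_ball.mem_nhds hζb)).tendsto).comp hzζ'
    have h2 : Tendsto a g (𝓝 (F ζ)) :=
      h1.congr fun j => hF.right_inv _ (C.cut_subset j (ha j))
    rw [hF.isOpen.frontier_eq, tendsto_nhds_unique hap h2] at hpU
    exact hpU.2 (hF.mapsTo hζb)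
  refine ⟨g, hg, p, hpU, ζ, le_antisymm (mem_closedBall_zero_iff.1 hζ)
    (not_lt.1 fun h => hζb (mem_ball_zero_iff.2 h)), fun V hV => ?_, fun j => Φ (a j),
    fun j => mem_image_of_mem Φ (ha j), hzζ'⟩
  exact eventually_subset_of_chordalDist_lt ha hap
    (fun ε hε => hg (C.diam_tendsto_zero ε hε)) hV

theorem symm_image_nhd_subset_ball (hF : IsDiskParam U F Φ) (C : FundamentalChain U) (j : ℕ) :
    Φ '' C.nhd j ⊆ ball 0 1 := hF.symm_image_subset ((C.nhd_subset j).trans sdiff_subset)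

/-- The crosscut neighbourhoods of a fundamental chain shrink, in the disk, to a point `ζ` of the
unit circle. Namely, if `ζ` is given by `exists_ultrafilter`, then some crosscuts lie in small
neighbourhoods of `ζ`, since they do not meet a fixed short cut around `ζ`, whose closure
avoids the limit point of the crosscuts. The complement in the disk of a small cap at `ζ` is
convex, so that the crosscut neighbourhood either lies in the cap or contains the complement of
the cap, including the first crosscut. -/
theorem exists_point (hF : IsDiskParam U F Φ) (hcut : HasSmallCuts U F) (C : FundamentalChain U) :
    ∃ ζ : ℂ, ‖ζ‖ = 1 ∧ ∀ ε > 0, ∃ j, Φ '' C.nhd j ⊆ ball ζ ε := by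
  obtain ⟨g, hg, p, hp, ζ, hζ, hV, z, hz, hzζ⟩ := C.exists_ultrafilter hF
  refine ⟨ζ, hζ, fun ε hε => ?_⟩
  have hsmall : ∀ ε > 0, ∀ᶠ j in (g : Filter ℕ), Φ '' C.cut j ⊆ ball ζ ε := fun ε hε => by
    obtain ⟨Γ, R, h⟩ := hcut ζ hζ ε hε {p} (finite_singleton p) (singleton_subset_iff.2 hp)
    obtain ⟨r, hr, hsub⟩ := h.exists_ball_subset
    have hVp : (closure (F '' Γ))ᶜ ∈ 𝓝 p :=
      isClosed_closure.isOpen_compl.mem_nhds fun h' => disjoint_left.1 h.disjoint_closure h' rfl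
    filter_upwards [hV _ hVp, hzζ (ball_mem_nhds ζ hr)] with j hj hzj
    have hball := hF.symm_image_subset (C.cut_subset j)
    refine (h.subset_of_isPreconnected ((C.isCrosscut j).isPreconnected.image _
      (hF.continuousOn_symm.mono (C.cut_subset j))) hball ?_
      ⟨z j, hz j, hsub ⟨hzj, hball (hz j)⟩⟩).trans (h.subset.trans inter_subset_right)
    refine disjoint_left.2 ?_
    rintro _ ⟨q, hq, rfl⟩ hqΓ
    refine hj hq (subset_closure ⟨Φ q, hqΓ, hF.right_inv q (C.cut_subset j hq)⟩)
  have hre : ∀ w ∈ ball (0 : ℂ) 1, (starRingEnd ℂ ζ * w).re < 1 := fun w hw =>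
    (Complex.re_le_norm _).trans_lt (by simpa [hζ] using hw)
  obtain ⟨q₀, hq₀⟩ := (C.isCrosscut 0).nonempty
  have hw₀ := hF.mapsTo_symm (C.cut_subset 0 hq₀)
  obtain ⟨δ, hδ0, hδ⟩ : ∃ δ > 0, δ < 1 - (starRingEnd ℂ ζ * Φ q₀).re ∧ 2 * δ < ε ^ 2 := by
    have h1 : 0 < 1 - (starRingEnd ℂ ζ * Φ q₀).re := sub_pos.2 (hre _ hw₀)
    have h2 : 0 < ε ^ 2 / 2 := by positivity
    obtain ⟨δ, h3, h4⟩ := exists_between (lt_min h1 h2)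
    exact ⟨δ, h3, h4.trans_le (min_le_left _ _), by linarith [h4.trans_le (min_le_right _ _)]⟩
  obtain ⟨j, hj⟩ := (hsmall δ hδ0).exists
  refine ⟨j, ?_⟩
  set H : Set ℂ := ball 0 1 ∩ {w | (starRingEnd ℂ ζ * w).re < 1 - δ} with hH
  have hlin : IsLinearMap ℝ fun w : ℂ => (starRingEnd ℂ ζ * w).re :=
    ⟨fun x y => by simp only [mul_add, Complex.add_re],
      fun c x => by simp only [Complex.real_smul, Complex.mul_re, Complex.ofReal_re,
        Complex.ofReal_im, Complex.mul_im, smul_eq_mul]; ring⟩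
  have hHconv : Convex ℝ H :=
    (convex_ball 0 1).inter (convex_halfSpace_lt hlin _)
  have hsq : ∀ w : ℂ, ‖w - ζ‖ ^ 2 = ‖w‖ ^ 2 + 1 - 2 * (starRingEnd ℂ ζ * w).re := fun w => by
    have h1 : ‖ζ‖ ^ 2 = 1 := by rw [hζ, one_pow]
    rw [← Complex.normSq_eq_norm_sq, ← Complex.normSq_eq_norm_sq, Complex.normSq_sub,
      Complex.normSq_eq_norm_sq ζ, h1, mul_comm w]
  have hHcut : F '' H ⊆ U \ C.cut j := by
    rintro _ ⟨w, hw, rfl⟩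
    refine ⟨hF.mapsTo hw.1, fun hcut => ?_⟩
    have h1 : w ∈ ball ζ δ := hj ⟨F w, hcut, hF.left_inv w hw.1⟩
    rw [mem_ball_iff_norm] at h1
    have h2 : (starRingEnd ℂ ζ * w).re < 1 - δ := hw.2
    have h3 : (starRingEnd ℂ ζ * (ζ - w)).re ≤ ‖w - ζ‖ := by
      refine (Complex.re_le_norm _).trans ?_
      rw [norm_mul, RCLike.norm_conj, hζ, one_mul, norm_sub_rev]
    have h4 : (starRingEnd ℂ ζ * ζ).re = 1 := by
      rw [Complex.conj_mul', hζ]; simp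
    rw [mul_sub, Complex.sub_re, h4] at h3
    linarith
  have hdisj : ∀ w ∈ Φ '' C.nhd j, w ∉ H := by
    rintro _ ⟨q, hq, rfl⟩ hqH
    have h1 := C.subset_nhd (hHconv.isPreconnected.image F (hF.continuousOn.mono
      inter_subset_left)) hHcut ⟨q, ⟨Φ q, hqH, hF.right_inv q (C.nhd_subset j hq).1⟩, hq⟩
    have h2 : q₀ ∈ C.nhd j := h1 ⟨Φ q₀, ⟨hw₀, by
      rw [mem_ofPred_eq]; linarith [hδ.1]⟩, hF.right_inv _ (C.cut_subset 0 hq₀)⟩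
    exact (C.nhd_subset 0 (C.nhd_antitone (Nat.zero_le j) h2)).2 hq₀
  intro w hw
  have hwb := symm_image_nhd_subset_ball hF C j hw
  have h1 : 1 - δ ≤ (starRingEnd ℂ ζ * w).re := not_lt.1 fun h => hdisj w hw ⟨hwb, h⟩
  rw [mem_ball_iff_norm]
  refine lt_of_pow_lt_pow_left₀ 2 hε.le ?_
  rw [hsq w]
  have h2 : ‖w‖ ^ 2 ≤ 1 := pow_le_one₀ (norm_nonneg _) (mem_ball_zero_iff.1 hwb).le
  linarith [hδ.2]

end FundamentalChain
end

end

/-! ### Prime ends and points of the circle -/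

section
open Metric

section
variable {U : Set RiemannSphere} {F : ℂ → RiemannSphere} {Φ : RiemannSphere → ℂ}

namespace FundamentalChain

theorem iInter_closure_eq (C : FundamentalChain U) {ζ : ℂ}
    (hζ : ∀ ε > 0, ∃ j, Φ '' C.nhd j ⊆ ball ζ ε) : ⋂ j, closure (Φ '' C.nhd j) = {ζ} := by
  apply Subset.antisymm
  · intro w hw
    rw [mem_singleton_iff]
    by_contra hne
    obtain ⟨j, hj⟩ := hζ (dist w ζ / 2) (half_pos (dist_pos.2 hne))
    have h1 := closure_mono hj (mem_iInter.1 hw j)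
    have h2 := closure_ball_subset_closedBall h1
    rw [mem_closedBall] at h2
    linarith [dist_pos.2 hne]
  · rw [singleton_subset_iff, mem_iInter]
    refine fun j => Metric.mem_closure_iff.2 fun ε hε => ?_
    obtain ⟨k, hk⟩ := hζ ε hε
    obtain ⟨q, hq⟩ := C.nhd_nonempty (max j k)
    exact ⟨Φ q, mem_image_of_mem Φ (C.nhd_antitone (le_max_left j k) hq), by
      rw [dist_comm]
      exact hk (mem_image_of_mem Φ (C.nhd_antitone (le_max_right j k) hq))⟩

/-- Two crosscuts of a chain cannot accumulate at the same point of the unit circle, since both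
would meet the same short crosscuts and hence have intersecting closures. -/
theorem not_mem_closure_cut (hF : IsDiskParam U F Φ) (hcut : HasSmallCuts U F)
    (C : FundamentalChain U) {ζ : ℂ} (hζ : ‖ζ‖ = 1) {i j : ℕ} (hij : i ≠ j)
    (hi : ζ ∈ closure (Φ '' C.cut i)) : ζ ∉ closure (Φ '' C.cut j) := by
  intro hj
  have hpos : ∀ n : ℕ, (0 : ℝ) < 1 / ((n : ℝ) + 1) := fun n => by positivity
  choose Γ R h using fun n : ℕ => hcut ζ hζ _ (hpos n) ∅ finite_empty (empty_subset _)
  -- each crosscut eventually meets the short crosscuts around `ζ`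
  have key : ∀ i, ζ ∈ closure (Φ '' C.cut i) →
      ∀ᶠ n in atTop, ∃ p ∈ C.cut i, p ∈ F '' Γ n := fun i hi => by
    obtain ⟨q, hq⟩ := (C.isCrosscut i).nonempty
    have hb := hF.symm_image_subset (C.cut_subset i)
    have hne : 0 < dist (Φ q) ζ := dist_pos.2 fun h => by
      have := hb (mem_image_of_mem Φ hq)
      rw [h, mem_ball_zero_iff, hζ] at this
      exact lt_irrefl _ this
    filter_upwards [(tendsto_one_div_add_atTop_nhds_zero_nat (𝕜 := ℝ)).eventually
      (gt_mem_nhds hne)] with n hn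
    obtain ⟨_, ⟨p, hp, rfl⟩, hpΓ⟩ := (h n).exists_mem_cut
      ((C.isCrosscut i).isPreconnected.image _ (hF.continuousOn_symm.mono (C.cut_subset i)))
      hb hi (fun hsub => by
        have := hsub (mem_image_of_mem Φ hq)
        rw [mem_ball] at this
        linarith)
    exact ⟨p, hp, Φ p, hpΓ, hF.right_inv p (C.cut_subset i hp)⟩
  obtain ⟨N, hN⟩ := eventually_atTop.1 ((key i hi).and (key j hj))
  choose u huc huΓ using fun n => (hN (N + n) (Nat.le_add_right _ _)).1
  choose v hvc hvΓ using fun n => (hN (N + n) (Nat.le_add_right _ _)).2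
  let g := hyperfilter ℕ
  obtain ⟨a, -, ha⟩ := isCompact_univ.ultrafilter_le_nhds (g.map u) (by simp)
  have ha' : Tendsto u g (𝓝 a) := ha
  have hd : Tendsto (fun n => chordalDist (u n) (v n)) g (𝓝 0) := by
    refine Tendsto.mono_left ?_ Nat.hyperfilter_le_atTop
    refine squeeze_zero (fun n => ?_)
      (fun n => ((h (N + n)).chordalDist_lt _ (huΓ n) _ (hvΓ n)).le)
      ((tendsto_one_div_add_atTop_nhds_zero_nat (𝕜 := ℝ)).comp
        (tendsto_atTop_mono (fun n => Nat.le_add_left n N) tendsto_id))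
    exact chordalDist_nonneg _ _
  exact disjoint_left.1 (C.disjoint_closure hij)
    (mem_closure_of_tendsto ha' (Eventually.of_forall huc))
    (mem_closure_of_tendsto (tendsto_of_chordalDist_tendsto ha' hd) (Eventually.of_forall hvc))

/-- Every crosscut neighbourhood of a chain contains a full neighbourhood of the point of the unit
circle to which the chain converges. -/
theorem exists_ball_subset (hF : IsDiskParam U F Φ) (hcut : HasSmallCuts U F)
    (C : FundamentalChain U) {ζ : ℂ} (hζ : ‖ζ‖ = 1)
    (hC : ∀ ε > 0, ∃ j, Φ '' C.nhd j ⊆ ball ζ ε) (j : ℕ) :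
    ∃ r > 0, F '' (ball ζ r ∩ ball 0 1) ⊆ C.nhd j := by
  have key : ∀ i, ζ ∉ closure (Φ '' C.cut i) →
      ∃ r > 0, F '' (ball ζ r ∩ ball 0 1) ⊆ C.nhd i := fun i hi => by
    obtain ⟨r, hr, hsub⟩ := Metric.isOpen_iff.1 isClosed_closure.isOpen_compl ζ hi
    refine ⟨r, hr, C.subset_nhd ?_ ?_ ?_⟩
    · exact ((convex_ball ζ r).inter (convex_ball 0 1)).isPreconnected.image F
        (hF.continuousOn.mono inter_subset_right)
    · rintro _ ⟨w, hw, rfl⟩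
      exact ⟨hF.mapsTo hw.2, fun h =>
        hsub hw.1 (subset_closure ⟨F w, h, hF.left_inv w hw.2⟩)⟩
    · have h1 : ζ ∈ closure (Φ '' C.nhd i) := by
        have := (C.iInter_closure_eq hC).symm.subset rfl
        exact mem_iInter.1 this i
      obtain ⟨_, hwr, q, hq, rfl⟩ := mem_closure_iff_nhds.1 h1 _ (ball_mem_nhds ζ hr)
      have hqU := (C.nhd_subset i hq).1
      exact ⟨q, ⟨Φ q, ⟨hwr, hF.mapsTo_symm hqU⟩, hF.right_inv q hqU⟩, hq⟩
  by_cases h : ζ ∈ closure (Φ '' C.cut j)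
  · obtain ⟨r, hr, hsub⟩ := key (j + 1)
      (C.not_mem_closure_cut hF hcut hζ (Nat.succ_ne_self j).symm h)
    exact ⟨r, hr, hsub.trans (C.nested j)⟩
  · exact key j h

theorem exists_nhd_subset (hF : IsDiskParam U F Φ) (hcut : HasSmallCuts U F)
    (C D : FundamentalChain U) {ζ : ℂ} (hζ : ‖ζ‖ = 1)
    (hC : ∀ ε > 0, ∃ j, Φ '' C.nhd j ⊆ ball ζ ε) (hD : ∀ ε > 0, ∃ j, Φ '' D.nhd j ⊆ ball ζ ε)
    (j : ℕ) : ∃ k, D.nhd k ⊆ C.nhd j := by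
  obtain ⟨r, hr, hsub⟩ := C.exists_ball_subset hF hcut hζ hC j
  obtain ⟨k, hk⟩ := hD r hr
  refine ⟨k, fun q hq => hsub ?_⟩
  have hqU := (D.nhd_subset k hq).1
  exact ⟨Φ q, ⟨hk (mem_image_of_mem Φ hq), hF.mapsTo_symm hqU⟩, hF.right_inv q hqU⟩

end FundamentalChain

/-- The region cut off by a short crosscut is a component of the complement of the crosscut. -/
theorem IsSmallCut.isCrosscutNhd {ζ : ℂ} {ε : ℝ} {P : Set RiemannSphere} {Γ R : Set ℂ}
    (h : IsSmallCut U F ζ ε P Γ R) (hF : IsDiskParam U F Φ) (hne : R.Nonempty) :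
    IsCrosscutNhd U (F '' Γ) (F '' R) := by
  have hRb : R ⊆ ball 0 1 := h.subset.trans inter_subset_left
  have hΓb : Γ ⊆ ball 0 1 := h.cut_subset.trans inter_subset_left
  have hsub : F '' R ⊆ U \ F '' Γ := by
    rintro _ ⟨w, hw, rfl⟩
    refine ⟨hF.mapsTo (hRb hw), ?_⟩
    rintro ⟨w', hw', e⟩
    rw [hF.injOn (hΓb hw') (hRb hw) e] at hw'
    exact disjoint_left.1 h.disjoint hw hw'
  obtain ⟨w, hw⟩ := hne
  refine ⟨F w, hsub (mem_image_of_mem F hw), Subset.antisymm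
    ((h.isPreconnected.image F (hF.continuousOn.mono hRb)).subset_connectedComponentIn
      (mem_image_of_mem F hw) hsub) ?_⟩
  set c := connectedComponentIn (U \ F '' Γ) (F w) with hc
  have hcU : c ⊆ U \ F '' Γ := connectedComponentIn_subset _ _
  have hcU' : c ⊆ U := hcU.trans sdiff_subset
  have h1 : Φ '' c ⊆ R := by
    refine h.subset_of_isPreconnected (isPreconnected_connectedComponentIn.image Φ
      (hF.continuousOn_symm.mono hcU')) (hF.symm_image_subset hcU') (disjoint_left.2 ?_)
      ⟨w, ⟨F w, mem_connectedComponentIn (hsub (mem_image_of_mem F hw)),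
        hF.left_inv w (hRb hw)⟩, hw⟩
    rintro _ ⟨q, hq, rfl⟩ hqΓ
    exact (hcU hq).2 ⟨Φ q, hqΓ, hF.right_inv q (hcU' hq)⟩
  rw [← hF.image_image_symm hcU']
  exact image_mono h1

/-- Every point of the unit circle is the limit of a fundamental chain. The short crosscuts are
chosen one after the other, each in the region cut off by the earlier ones, and with end points
different from the earlier ones. -/
theorem exists_fundamentalChain (hF : IsDiskParam U F Φ) (hcut : HasSmallCuts U F) {ζ : ℂ}
    (hζ : ‖ζ‖ = 1) : ∃ C : FundamentalChain U, ∀ ε > 0, ∃ j, Φ '' C.nhd j ⊆ ball ζ ε := by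
  -- the triples consist of a diameter bound, a cut and the region which is cut off
  obtain ⟨f, hf, hrel⟩ := exists_seq_of_forall_finset_exists
    (fun x : ℝ × Set ℂ × Set ℂ => 0 < x.1 ∧ IsSmallCut U F ζ x.1 ∅ x.2.1 x.2.2)
    (fun x y => y.1 ≤ x.1 / 2 ∧ y.2.1 ∪ y.2.2 ⊆ x.2.2 ∧
      Disjoint (closure (F '' x.2.1)) (closure (F '' y.2.1))) (by
    intro s hs
    have hev : ∀ᶠ ε in 𝓝[>] (0 : ℝ), ∀ x ∈ s, ε ≤ x.1 / 2 ∧ ball ζ ε ∩ ball 0 1 ⊆ x.2.2 := by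
      rw [eventually_all_finset]
      intro x hx
      obtain ⟨hx0, hx1⟩ := hs x hx
      obtain ⟨r, hr, hsub⟩ := hx1.exists_ball_subset
      filter_upwards [Ioo_mem_nhdsGT (lt_min (half_pos hx0) hr)] with ε hε
      exact ⟨hε.2.le.trans (min_le_left _ _), (inter_subset_inter_left _
        (ball_subset_ball (hε.2.le.trans (min_le_right _ _)))).trans hsub⟩
    obtain ⟨ε, hε, hε0⟩ := (hev.and self_mem_nhdsWithin).exists
    obtain ⟨Γ, R, h⟩ := hcut ζ hζ ε hε0 (⋃ x ∈ s, closure (F '' x.2.1) ∩ frontier U)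
      (s.finite_toSet.biUnion fun x hx => (hs x hx).2.finite)
      (iUnion₂_subset fun x _ => inter_subset_right)
    refine ⟨(ε, Γ, R), ⟨hε0, { h with disjoint_closure := disjoint_empty _ }⟩, fun x hx => ?_⟩
    have hsub : Γ ∪ R ⊆ x.2.2 := by
      refine Subset.trans ?_ (hε x hx).2
      rw [inter_comm]
      exact union_subset h.cut_subset h.subset
    refine ⟨(hε x hx).1, hsub, disjoint_left.2 fun q hq hq' => ?_⟩
    by_cases hqU : q ∈ U
    · obtain ⟨w, hw, rfl⟩ := (hs x hx).2.closure_image_inter_subset hF ⟨hq, hqU⟩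
      obtain ⟨w', hw', e⟩ := h.closure_image_inter_subset hF ⟨hq', hqU⟩
      have e' := hF.injOn (h.cut_subset hw').1 ((hs x hx).2.cut_subset hw).1 e
      rw [e'] at hw'
      exact disjoint_left.1 (hs x hx).2.disjoint (hsub (Or.inl hw')) hw
    · have hqf : q ∈ frontier U := by
        rw [hF.isOpen.frontier_eq]
        exact ⟨closure_mono (hF.image_subset (h.cut_subset.trans inter_subset_left)) hq', hqU⟩
      exact disjoint_left.1 h.disjoint_closure hq' (mem_iUnion₂.2 ⟨x, hx, hq, hqf⟩))
  have hlim : Tendsto (fun n => (f n).1) atTop (𝓝 0) := by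
    have h1 : Tendsto (fun n : ℕ => (f 0).1 * (1 / 2 : ℝ) ^ n) atTop (𝓝 0) := by
      rw [← mul_zero (f 0).1]
      exact (tendsto_pow_atTop_nhds_zero_of_lt_one (by norm_num) (by norm_num)).const_mul _
    refine squeeze_zero (fun n => (hf n).1.le) (fun n => ?_) h1
    induction n with
    | zero => simp
    | succ n ih =>
      rw [pow_succ]
      linarith [(hrel n (n + 1) (Nat.lt_succ_self n)).1]
  have hRne : ∀ n, (f n).2.2.Nonempty := fun n =>
    ((hf (n + 1)).2.nonempty).mono
      (subset_union_left.trans (hrel n (n + 1) (Nat.lt_succ_self n)).2.1)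
  refine ⟨{ cut := fun n => F '' (f n).2.1
            nhd := fun n => F '' (f n).2.2
            isCrosscut := fun n => (hf n).2.isCrosscut
            isCrosscutNhd := fun n => (hf n).2.isCrosscutNhd hF (hRne n)
            nested := fun n => image_mono
              (subset_union_right.trans (hrel n (n + 1) (Nat.lt_succ_self n)).2.1)
            disjoint_closure := fun i j hij => ?_
            diam_tendsto_zero := fun ε hε => ?_ }, fun ε hε => ?_⟩
  · rcases hij.lt_or_gt with h | h
    · exact (hrel i j h).2.2
    · exact (hrel j i h).2.2.symm
  · filter_upwards [hlim.eventually (gt_mem_nhds hε)] with n hn p hp q hq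
    exact ((hf n).2.chordalDist_lt p hp q hq).trans hn
  · obtain ⟨n, hn⟩ := (hlim.eventually (gt_mem_nhds hε)).exists
    refine ⟨n, ?_⟩
    change Φ '' (F '' (f n).2.2) ⊆ _
    rw [hF.symm_image_image ((hf n).2.subset.trans inter_subset_left)]
    exact (hf n).2.subset.trans (inter_subset_right.trans (ball_subset_ball hn.le))

/-- The prime ends of `U` correspond to the points of the unit circle. -/
theorem exists_primeEnd_point (hF : IsDiskParam U F Φ) (hcut : HasSmallCuts U F) :
    ∃ b : FundamentalChain U → ℂ, (∀ C, ‖b C‖ = 1 ∧ ⋂ j, closure (Φ '' C.nhd j) = {b C}) ∧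
      (∀ C D, C ≈ D ↔ b C = b D) ∧ ∀ ζ : ℂ, ‖ζ‖ = 1 → ∃ C, b C = ζ := by
  choose b hb1 hb using fun C : FundamentalChain U => C.exists_point hF hcut
  have hI : ∀ C, ⋂ j, closure (Φ '' C.nhd j) = {b C} := fun C => C.iInter_closure_eq (hb C)
  refine ⟨b, fun C => ⟨hb1 C, hI C⟩, fun C D => ⟨fun h => ?_, fun h => ?_⟩, fun ζ hζ => ?_⟩
  · have h1 : ⋂ j, closure (Φ '' D.nhd j) ⊆ ⋂ j, closure (Φ '' C.nhd j) := by
      refine subset_iInter fun j => ?_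
      obtain ⟨k, hk⟩ := h.1 j
      exact (iInter_subset _ k).trans (closure_mono (image_mono hk))
    rw [hI, hI, singleton_subset_singleton] at h1
    exact h1.symm
  · have hD := hb D
    rw [← h] at hD
    exact ⟨fun j => C.exists_nhd_subset hF hcut D (hb1 C) (hb C) hD j,
      fun j => D.exists_nhd_subset hF hcut C (hb1 C) hD (hb C) j⟩
  · obtain ⟨C, hC⟩ := exists_fundamentalChain hF hcut hζ
    refine ⟨C, ?_⟩
    have := (hI C).symm.trans (C.iInter_closure_eq hC)
    exact singleton_eq_singleton_iff.1 this
end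

end

/-! ### Limits at the circle for a locally connected boundary -/

section
open Metric

/-- A continuous logarithm of the constant one is constant on a connected set. -/
theorem eq_of_exp_eq_one {X : Type*} [TopologicalSpace X] {S : Set X} (hS : IsPreconnected S)
    {k : X → ℂ} (hk : ContinuousOn k S) (h1 : ∀ x ∈ S, Complex.exp (k x) = 1) {x y : X}
    (hx : x ∈ S) (hy : y ∈ S) : k x = k y := by
  have hval : ∀ z ∈ S, ∃ n : ℤ, k z = n * (2 * Real.pi * Complex.I) := fun z hz =>
    Complex.exp_eq_one_iff.1 (h1 z hz)
  have him : ∀ {z : X} {n : ℤ}, k z = n * (2 * Real.pi * Complex.I) →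
      (k z).im = n * (2 * Real.pi) := fun {z n} h => by
    rw [h]; simp
  have hle : ∀ x ∈ S, ∀ y ∈ S, (k x).im ≤ (k y).im := by
    intro x hx y hy
    by_contra! hlt
    obtain ⟨n, hn⟩ := hval x hx
    obtain ⟨m, hm⟩ := hval y hy
    rw [him hn, him hm] at hlt
    have hmn : m + 1 ≤ n := by
      have : (m : ℝ) < n := lt_of_mul_lt_mul_right hlt Real.two_pi_pos.le
      exact_mod_cast this
    have hmn' : (m : ℝ) + 1 ≤ n := by exact_mod_cast hmn
    have hpre := hS.image (fun z => (k z).im) (Complex.continuous_im.comp_continuousOn hk)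
    -- half way between two consecutive possible values
    have hmid : (m + 1 / 2) * (2 * Real.pi) ∈ (fun z => (k z).im) '' S := by
      refine hpre.ordConnected.out (mem_image_of_mem _ hy) (mem_image_of_mem _ hx) ⟨?_, ?_⟩
      · simp only [him hm]; nlinarith [Real.pi_pos]
      · simp only [him hn]; nlinarith [Real.pi_pos]
    obtain ⟨z, hz, e⟩ := hmid
    obtain ⟨l, hl⟩ := hval z hz
    simp only [him hl] at e
    have e' := mul_right_cancel₀ Real.two_pi_pos.ne' e
    have e2 : (2 * l : ℤ) = 2 * m + 1 := by
      have : (2 * l : ℝ) = 2 * m + 1 := by linarith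
      exact_mod_cast this
    omega
  obtain ⟨n, hn⟩ := hval x hx
  obtain ⟨m, hm⟩ := hval y hy
  have := le_antisymm (hle x hx y hy) (hle y hy x hx)
  rw [him hn, him hm] at this
  have e' := mul_right_cancel₀ Real.two_pi_pos.ne' this
  rw [hn, hm, show (n : ℤ) = m by exact_mod_cast e']

theorem isSimplyConnected_of_convex {S : Set ℂ} (hS : Convex ℝ S) (hne : S.Nonempty) :
    IsSimplyConnected S := by
  have := hS.contractibleSpace hne
  exact (inferInstance : SimplyConnectedSpace S)

/-- The function `z - w` near infinity is not the restriction of a nonvanishing continuous function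
on the plane, since it has no continuous logarithm on large circles. -/
theorem not_exists_continuous_ne_zero {h : ℂ → ℂ} (hc : Continuous h) (h0 : ∀ z, h z ≠ 0) {w : ℂ}
    {M : ℝ} (hM : ∀ z, M ≤ ‖z‖ → h z = z - w) : False := by
  have hsc : IsSimplyConnected (univ : Set ℂ) :=
    isSimplyConnected_of_convex convex_univ univ_nonempty
  obtain ⟨f, hf, hfe⟩ := Complex.exists_continuousOn_eqOn_exp_comp hsc isOpen_univ
    hc.continuousOn (by simpa using h0)
  have hf' : Continuous f := continuousOn_univ.1 hf
  set N : ℝ := max M (‖w‖ + 1) with hN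
  have hN0 : 0 < N := (by positivity : 0 < ‖w‖ + 1).trans_le (le_max_right _ _)
  have hnorm : ∀ θ, ‖circleMap 0 N θ‖ = N := fun θ => by
    rw [norm_circleMap_zero, abs_of_pos hN0]
  have hne : ∀ θ, circleMap 0 N θ ≠ 0 := fun θ => norm_pos_iff.1 (by rw [hnorm]; exact hN0)
  have hs : ∀ θ, 1 + -(w / circleMap 0 N θ) ∈ Complex.slitPlane := fun θ => by
    refine Complex.mem_slitPlane_of_norm_lt_one ?_
    rw [norm_neg, norm_div, hnorm, div_lt_one hN0]
    exact (lt_add_one _).trans_le (le_max_right _ _)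
  let k : ℝ → ℂ := fun θ => f (circleMap 0 N θ) - Complex.log N -
    θ * Complex.I - Complex.log (1 + -(w / circleMap 0 N θ))
  have hk : Continuous k := by
    refine ((((hf'.comp (continuous_circleMap 0 N)).sub continuous_const).sub
      (by fun_prop)).sub ?_)
    exact Continuous.clog (continuous_const.add (continuous_const.div
      (continuous_circleMap 0 N) hne).neg) hs
  have hk1 : ∀ θ ∈ (univ : Set ℝ), Complex.exp (k θ) = 1 := fun θ _ => by
    have hNc : (N : ℂ) ≠ 0 := Complex.ofReal_ne_zero.2 hN0.ne'
    have e1 : Complex.exp (f (circleMap 0 N θ)) = circleMap 0 N θ - w := by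
      rw [← hM _ (by rw [hnorm]; exact le_max_left _ _)]
      exact hfe (mem_univ _)
    have e2 : circleMap 0 N θ = N * Complex.exp (θ * Complex.I) := by simp [circleMap]
    have h3 : (1 + -(w / circleMap 0 N θ)) = (circleMap 0 N θ - w) / circleMap 0 N θ := by
      rw [sub_div, div_self (hne θ)]; ring
    have h4 := Complex.slitPlane_ne_zero (hs θ)
    simp only [k]
    rw [Complex.exp_sub, Complex.exp_sub, Complex.exp_sub, Complex.exp_log h4,
      Complex.exp_log hNc, e1, h3, div_div _ (N : ℂ), ← e2]
    rw [h3] at h4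
    exact div_self h4
  have h2 := eq_of_exp_eq_one isPreconnected_univ hk.continuousOn hk1 (mem_univ 0)
    (mem_univ (2 * Real.pi))
  have h3 : circleMap 0 N (2 * Real.pi) = circleMap 0 N 0 := by simp [circleMap]
  simp only [k, h3, Complex.ofReal_zero, zero_mul, sub_zero] at h2
  have h4 : ((2 * Real.pi : ℝ) : ℂ) * Complex.I = 0 := by linear_combination h2
  simp [Real.pi_ne_zero] at h4

/-- `z - w` has a continuous logarithm on `K`. -/
def HasLogOn (K : Set ℂ) (w : ℂ) : Prop :=
  ∃ l : ℂ → ℂ, ContinuousOn l K ∧ ∀ z ∈ K, Complex.exp (l z) = z - w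

/-- A logarithm of `z - w` persists when `w` moves by less than its distance to `K`. -/
theorem HasLogOn.of_norm_sub_lt {K : Set ℂ} {w w' : ℂ} (h : HasLogOn K w)
    (hw : ∀ z ∈ K, ‖w' - w‖ < ‖z - w‖) : HasLogOn K w' := by
  obtain ⟨l, hl, hle⟩ := h
  have hne : ∀ z ∈ K, z - w ≠ 0 := fun z hz => norm_pos_iff.1 ((norm_nonneg _).trans_lt (hw z hz))
  have hs : ∀ z ∈ K, 1 + -((w' - w) / (z - w)) ∈ Complex.slitPlane := fun z hz => by
    refine Complex.mem_slitPlane_of_norm_lt_one ?_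
    rw [norm_neg, norm_div, div_lt_one (norm_pos_iff.2 (hne z hz))]
    exact hw z hz
  refine ⟨fun z => l z + Complex.log (1 + -((w' - w) / (z - w))), hl.add ?_, fun z hz => ?_⟩
  · refine ContinuousOn.clog (continuousOn_const.add (ContinuousOn.neg
      (continuousOn_const.div (by fun_prop) hne))) hs
  · rw [Complex.exp_add, hle z hz, Complex.exp_log (Complex.slitPlane_ne_zero (hs z hz))]
    have := hne z hz
    field_simp
    ring

theorem hasLogOn_of_norm_lt {K : Set ℂ} {p w : ℂ} (hw : ∀ z ∈ K, ‖z - p‖ < ‖w - p‖) :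
    HasLogOn K w := by
  rcases K.eq_empty_or_nonempty with rfl | ⟨z₀, hz₀⟩
  · exact ⟨0, continuousOn_empty _, by simp⟩
  have hne : w - p ≠ 0 := norm_pos_iff.1 ((norm_nonneg _).trans_lt (hw z₀ hz₀))
  have hs : ∀ z ∈ K, 1 + -((z - p) / (w - p)) ∈ Complex.slitPlane := fun z hz => by
    refine Complex.mem_slitPlane_of_norm_lt_one ?_
    rw [norm_neg, norm_div, div_lt_one (norm_pos_iff.2 hne)]
    exact hw z hz
  refine ⟨fun z => Complex.log (p - w) + Complex.log (1 + -((z - p) / (w - p))),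
    continuousOn_const.add ?_, fun z hz => ?_⟩
  · refine ContinuousOn.clog (continuousOn_const.add (ContinuousOn.neg
      (ContinuousOn.div_const (by fun_prop) _))) hs
  · rw [Complex.exp_add, Complex.exp_log (sub_ne_zero.2 (sub_ne_zero.1 hne).symm),
      Complex.exp_log (Complex.slitPlane_ne_zero (hs z hz))]
    field_simp
    ring

theorem isBounded_preimage_coe {S : Set RiemannSphere} (h : OnePoint.infty ∉ closure S) :
    Bornology.IsBounded {z : ℂ | (z : RiemannSphere) ∈ S} := by
  have h1 : ∀ᶠ z : ℂ in cocompact ℂ, (z : RiemannSphere) ∈ (closure S)ᶜ := by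
    rw [← coclosedCompact_eq_cocompact]
    exact OnePoint.tendsto_coe_infty (isClosed_closure.isOpen_compl.mem_nhds h)
  rw [← Metric.cobounded_eq_cocompact] at h1
  have h2 : Bornology.IsBounded {z : ℂ | (z : RiemannSphere) ∈ (closure S)ᶜ}ᶜ :=
    Bornology.isBounded_compl_iff.2 h1
  exact h2.subset fun z hz h => h (subset_closure hz)

/-- If `U` is connected and contains infinity, then `z - w` has a continuous logarithm on
the complement of `U` for all `w` in `U`: move `w` to infinity inside `U`. -/
theorem hasLogOn_compl {U : Set RiemannSphere} (hU : IsOpen U) (hUc : IsPreconnected U)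
    (hinf : OnePoint.infty ∈ U) {w : ℂ} (hw : (w : RiemannSphere) ∈ U) :
    HasLogOn {z : ℂ | (z : RiemannSphere) ∉ U} w := by
  set K : Set ℂ := {z : ℂ | (z : RiemannSphere) ∉ U} with hK
  let S : Set RiemannSphere := {q | q ∈ U ∧ ∀ w : ℂ, (w : RiemannSphere) = q → HasLogOn K w}
  have hSU : S ⊆ U := fun q hq => hq.1
  -- the logarithms exist near infinity
  obtain ⟨M, hM⟩ : ∃ M : ℝ, ∀ z ∈ K, ‖z‖ < M := by
    have h1 : OnePoint.infty ∉ closure Uᶜ := by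
      rw [hU.isClosed_compl.closure_eq]; exact fun h => h hinf
    obtain ⟨M, hM⟩ := (isBounded_preimage_coe h1).exists_norm_le
    exact ⟨M + 1, fun z hz => (hM z hz).trans_lt (lt_add_one M)⟩
  have hinfS : S ∈ 𝓝 (OnePoint.infty : RiemannSphere) := by
    have hc : IsClosed (closedBall (0 : ℂ) M) := isClosed_closedBall
    have h1 := (OnePoint.isOpen_compl_image_coe.2 ⟨hc, isCompact_closedBall (0 : ℂ) M⟩).inter hU
    refine mem_of_superset (h1.mem_nhds ⟨by simp, hinf⟩) ?_
    rintro q ⟨hq, hqU⟩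
    refine ⟨hqU, ?_⟩
    rintro w rfl
    refine hasLogOn_of_norm_lt (p := 0) fun z hz => ?_
    rw [sub_zero, sub_zero]
    refine (hM z hz).trans (not_le.1 fun h => hq ⟨w, mem_closedBall_zero_iff.2 h, rfl⟩)
  have hball : ∀ w : ℂ, (w : RiemannSphere) ∈ U → ∃ r > 0, ∀ w' ∈ ball w r,
      (w' : RiemannSphere) ∈ U ∧ (HasLogOn K w ↔ HasLogOn K w') := by
    intro w hw
    have ho : IsOpen {z : ℂ | (z : RiemannSphere) ∈ U} := hU.preimage OnePoint.continuous_coe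
    obtain ⟨r, hr, hsub⟩ := Metric.isOpen_iff.1 ho w hw
    have hfar : ∀ z ∈ K, r ≤ ‖z - w‖ := fun z hz => by
      by_contra! h
      exact hz (hsub (mem_ball_iff_norm.2 h))
    refine ⟨r / 2, half_pos hr, fun w' hw' =>
      ⟨hsub (ball_subset_ball (half_le_self hr.le) hw'), ?_, ?_⟩⟩ <;>
    rw [mem_ball_iff_norm] at hw'
    · exact fun h => h.of_norm_sub_lt fun z hz => by linarith [hfar z hz]
    · refine fun h => h.of_norm_sub_lt fun z hz => ?_
      have h1 := norm_sub_le_norm_sub_add_norm_sub z w' w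
      rw [norm_sub_rev w w']
      linarith [hfar z hz]
  have hnhds : ∀ {w : ℂ} {V : Set RiemannSphere}, (∃ r > 0, ∀ w' ∈ ball w r,
      (w' : RiemannSphere) ∈ V) → V ∈ 𝓝 (w : RiemannSphere) := by
    rintro w V ⟨r, hr, h⟩
    rw [OnePoint.nhds_coe_eq, mem_map]
    exact mem_of_superset (ball_mem_nhds w hr) h
  have hSo : IsOpen S := by
    rw [isOpen_iff_mem_nhds]
    intro q hq
    induction q using OnePoint.rec with
    | infty => exact hinfS
    | coe w =>
      obtain ⟨r, hr, h⟩ := hball w hq.1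
      refine hnhds ⟨r, hr, fun w' hw' => ⟨(h w' hw').1, fun w'' e => ?_⟩⟩
      rw [OnePoint.coe_eq_coe.1 e]
      exact (h w' hw').2.1 (hq.2 w rfl)
  have hTo : IsOpen (U \ S) := by
    rw [isOpen_iff_mem_nhds]
    rintro q ⟨hqU, hqS⟩
    induction q using OnePoint.rec with
    | infty => exact absurd (mem_of_mem_nhds hinfS) hqS
    | coe w =>
      obtain ⟨r, hr, h⟩ := hball w hqU
      refine hnhds ⟨r, hr, fun w' hw' => ⟨(h w' hw').1, fun hS => hqS ⟨hqU, fun w'' e => ?_⟩⟩⟩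
      rw [OnePoint.coe_eq_coe.1 e]
      exact (h w' hw').2.2 (hS.2 w' rfl)
  have := hUc.subset_left_of_subset_union hSo hTo disjoint_sdiff_right
    (by rw [union_sdiff_cancel hSU]) ⟨_, hinf, mem_of_mem_nhds hinfS⟩
  exact (this hw).2 w rfl

/-- If `w` lies in a bounded set `W`, then `z - w` has no continuous logarithm on a closed set which
contains the boundary of `W`: otherwise the exponential of a continuous extension of the logarithm
to `W` would extend `z - w` to a nonvanishing function on the plane. -/
theorem not_hasLogOn_of_frontier_subset {W T : Set ℂ} (hb : Bornology.IsBounded W) {w : ℂ}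
    (hw : w ∈ W) (hT : IsClosed T) (hWT : frontier W ⊆ T) : ¬ HasLogOn T w := by
  rintro ⟨l, hl, hle⟩
  obtain ⟨L, hL⟩ := ContinuousMap.exists_restrict_eq hT ⟨T.domRestrict l, hl.domRestrict⟩
  have hLe : ∀ z ∈ T, L z = l z := fun z hz => DFunLike.congr_fun hL ⟨z, hz⟩
  classical
  obtain ⟨M, hM⟩ := hb.exists_norm_le
  refine not_exists_continuous_ne_zero (h := W.piecewise (fun z => Complex.exp (L z))
    fun z => z - w) (w := w) (M := M + 1) ?_ (fun z => ?_) (fun z hz => ?_)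
  · refine Continuous.piecewise (fun z hz => ?_) (by fun_prop) (by fun_prop)
    rw [hLe z (hWT hz), hle z (hWT hz)]
  · by_cases hz : z ∈ W
    · rw [piecewise_eq_of_mem _ _ _ hz]; exact Complex.exp_ne_zero _
    · rw [piecewise_eq_of_notMem _ _ _ hz]
      exact sub_ne_zero.2 fun h => hz (h ▸ hw)
  · refine piecewise_eq_of_notMem _ _ _ fun h => ?_
    linarith [hM z h]

section
variable {U : Set RiemannSphere} {F : ℂ → RiemannSphere} {Φ : RiemannSphere → ℂ}

/-- If the closure of a crosscut lies in a disk around `p`, and its end points are joined in this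
disk by a connected subset of the boundary of `U`, then the side of the crosscut which
does not contain infinity lies in the disk too. Otherwise the side contains a point `w₀` outside
the disk. There are logarithms of `z - w₀` on the disk and on the complement of `U`. Since they
differ by a constant on the connecting set, they fit together to a logarithm on the boundary of the
side. -/
theorem IsSmallCut.image_subset_ball (hF : IsDiskParam U F Φ) (hF0 : F 0 = OnePoint.infty) {ζ : ℂ}
    {ε : ℝ} {P : Set RiemannSphere} {Γ R : Set ℂ} (h : IsSmallCut U F ζ ε P Γ R)
    (h0 : (0 : ℂ) ∉ R ∪ Γ) {p : ℂ} {δ : ℝ}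
    (hΓ : closure (F '' Γ) ⊆ ((↑) : ℂ → RiemannSphere) '' ball p δ) {L : Set RiemannSphere}
    (hL : IsPreconnected L) (hLU : L ⊆ frontier U)
    (hLp : L ⊆ ((↑) : ℂ → RiemannSphere) '' ball p δ)
    (hΓL : closure (F '' Γ) ∩ frontier U ⊆ L) :
    F '' R ⊆ ((↑) : ℂ → RiemannSphere) '' ball p δ := by
  have hRb : R ⊆ ball 0 1 := h.subset.trans inter_subset_left
  have hΓb : Γ ⊆ ball 0 1 := h.cut_subset.trans inter_subset_left
  have h0b : (0 : ℂ) ∈ ball (0 : ℂ) 1 := mem_ball_self one_pos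
  have hUeq : F '' ball 0 1 = U := hF.mapsTo.image_subset.antisymm fun q hq =>
    ⟨Φ q, hF.mapsTo_symm hq, hF.right_inv q hq⟩
  have hUc : IsPreconnected U := by
    rw [← hUeq]; exact (convex_ball (0 : ℂ) 1).isPreconnected.image _ hF.continuousOn
  have hinf : OnePoint.infty ∈ U := hF0 ▸ hF.mapsTo h0b
  have hFR : F '' R = U ∩ Φ ⁻¹' R := by
    ext q; constructor
    · rintro ⟨z, hz, rfl⟩
      exact ⟨hF.mapsTo (hRb hz), by rwa [mem_preimage, hF.left_inv z (hRb hz)]⟩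
    · rintro ⟨hq, hq'⟩
      exact ⟨Φ q, hq', hF.right_inv q hq⟩
  have hFRo : IsOpen (F '' R) := by
    rw [hFR]; exact hF.continuousOn_symm.isOpen_inter_preimage hF.isOpen h.isOpen
  obtain ⟨K, hK, hRK⟩ := h.exists_closed
  have hcl : closure (F '' R) ∩ U ⊆ F '' (R ∪ Γ) := by
    rintro q ⟨hq, hqU⟩
    have h1 : Φ q ∈ closure R := by
      have := ((hF.continuousOn_symm.continuousAt (hF.isOpen.mem_nhds hqU)).continuousWithinAt
        (s := F '' R)).mem_closure_image hq
      rwa [hF.symm_image_image hRb] at this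
    have h2 : Φ q ∈ K := closure_minimal (fun z hz => (hRK.subset (Or.inl hz)).2) hK h1
    exact ⟨Φ q, hRK.symm.subset ⟨hF.mapsTo_symm hqU, h2⟩, hF.right_inv q hqU⟩
  have hne : ∀ z ∈ R ∪ Γ, F z ≠ OnePoint.infty := fun z hz e =>
    h0 (hF.injOn h0b (union_subset hRb hΓb hz) (hF0.trans e.symm) ▸ hz)
  have hinfcl : OnePoint.infty ∉ closure (F '' R) := fun hi => by
    obtain ⟨z, hz, e⟩ := hcl ⟨hi, hinf⟩
    exact hne z hz e
  by_contra hcon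
  obtain ⟨q, hqR, hq⟩ := not_subset.1 hcon
  obtain ⟨w, rfl⟩ : ∃ w : ℂ, (w : RiemannSphere) = q := by
    obtain ⟨z, hz, rfl⟩ := hqR
    exact OnePoint.ne_infty_iff_exists.1 (hne z (Or.inl hz))
  have hwp : δ ≤ ‖w - p‖ := by
    by_contra! hlt
    exact hq ⟨w, mem_ball_iff_norm.2 hlt, rfl⟩
  have hwU : (w : RiemannSphere) ∈ U := hF.image_subset hRb hqR
  have hcoe : Continuous ((↑) : ℂ → RiemannSphere) := OnePoint.continuous_coe
  set T₁ : Set ℂ := {z | (z : RiemannSphere) ∈ closure (F '' Γ)} with hT₁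
  set T₂ : Set ℂ := {z | (z : RiemannSphere) ∉ U} with hT₂
  have hT₁c : IsClosed T₁ := isClosed_closure.preimage hcoe
  have hT₂c : IsClosed T₂ := hF.isOpen.isClosed_compl.preimage hcoe
  have hT₁p : T₁ ⊆ ball p δ := fun z hz => by
    obtain ⟨z', hz', e⟩ := hΓ hz
    rwa [← OnePoint.coe_eq_coe.1 e]
  have hfr : ∀ q ∈ frontier U, q ∉ U := fun q hq => by
    rw [hF.isOpen.frontier_eq] at hq; exact hq.2
  refine not_hasLogOn_of_frontier_subset (W := {z : ℂ | (z : RiemannSphere) ∈ F '' R})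
    (T := T₁ ∪ T₂) (isBounded_preimage_coe hinfcl) hqR (hT₁c.union hT₂c) ?_ ?_
  · have ho : IsOpen {z : ℂ | (z : RiemannSphere) ∈ F '' R} := hFRo.preimage hcoe
    rw [ho.frontier_eq]
    rintro z ⟨hz, hz'⟩
    have hz2 : (z : RiemannSphere) ∈ closure (F '' R) :=
      hcoe.closure_preimage_subset _ hz
    by_cases hzU : (z : RiemannSphere) ∈ U
    · obtain ⟨x, hx | hx, e⟩ := hcl ⟨hz2, hzU⟩
      · exact absurd ⟨x, hx, e⟩ hz'
      · exact Or.inl (subset_closure ⟨x, hx, e⟩)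
    · exact Or.inr hzU
  obtain ⟨l₂, hl₂, he₂⟩ := hasLogOn_compl hF.isOpen hUc hinf hwU
  obtain ⟨l₁, hl₁, he₁⟩ := hasLogOn_of_norm_lt (K := ball p δ) (p := p) (w := w)
    fun z hz => (mem_ball_iff_norm.1 hz).trans_le hwp
  -- the two logarithms differ by a constant on the connecting set
  set L' : Set ℂ := {z | (z : RiemannSphere) ∈ L} with hL'
  have hL'c : IsPreconnected L' := by
    refine hL.preimage_of_isOpenMap OnePoint.coe_injective OnePoint.isOpenEmbedding_coe.isOpenMap
      (hLp.trans (image_subset_range _ _))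
  have hL'₂ : L' ⊆ T₂ := fun z hz => hfr _ (hLU hz)
  have hL'p : L' ⊆ ball p δ := fun z hz => by
    obtain ⟨z', hz', e⟩ := hLp hz
    rwa [← OnePoint.coe_eq_coe.1 e]
  have hk1 : ∀ z ∈ L', Complex.exp (l₂ z - l₁ z) = 1 := fun z hz => by
    rw [Complex.exp_sub, he₂ z (hL'₂ hz), he₁ z (hL'p hz)]
    exact div_self fun e => (hL'₂ hz) (sub_eq_zero.1 e ▸ hwU)
  obtain ⟨c, hc1, hc⟩ : ∃ c : ℂ, Complex.exp c = 1 ∧ ∀ z ∈ L', l₂ z = l₁ z + c := by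
    rcases L'.eq_empty_or_nonempty with hem | ⟨z₀, hz₀⟩
    · exact ⟨0, Complex.exp_zero, by simp [hem]⟩
    · refine ⟨l₂ z₀ - l₁ z₀, hk1 z₀ hz₀, fun z hz => ?_⟩
      have := eq_of_exp_eq_one hL'c ((hl₂.mono hL'₂).sub (hl₁.mono hL'p)) hk1 hz hz₀
      simp only [Pi.sub_apply] at this
      linear_combination this
  have h12 : T₁ ∩ T₂ ⊆ L' := fun z hz => by
    refine hΓL ⟨hz.1, ?_⟩
    rw [hF.isOpen.frontier_eq]
    exact ⟨closure_mono (hF.image_subset hΓb) hz.1, hz.2⟩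
  classical
  have hg₂ : ∀ z ∈ T₂, T₂.piecewise l₂ (fun z => l₁ z + c) z = l₂ z := fun z hz =>
    piecewise_eq_of_mem _ _ _ hz
  have hg₁ : ∀ z ∈ T₁, T₂.piecewise l₂ (fun z => l₁ z + c) z = l₁ z + c := fun z hz => by
    by_cases hz2 : z ∈ T₂
    · rw [hg₂ z hz2]; exact hc z (h12 ⟨hz, hz2⟩)
    · exact piecewise_eq_of_notMem _ _ _ hz2
  refine ⟨T₂.piecewise l₂ fun z => l₁ z + c, ?_, ?_⟩
  · exact ((((hl₁.mono hT₁p).add continuousOn_const).congr hg₁).union_of_isClosed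
      (hl₂.congr hg₂) hT₁c hT₂c)
  · rintro z (hz | hz)
    · rw [hg₁ z hz, Complex.exp_add, he₁ z (hT₁p hz), hc1, mul_one]
    · rw [hg₂ z hz, he₂ z hz]

/-- If the boundary of `U` is locally connected, then the parametrization of `U` by the disk has a
limit at every point of the unit circle. Along a subsequence the short crosscuts around `ζ` converge
to a boundary point `p`, and their end points are joined by a small connected subset of the
boundary. So the regions which they cut off are small, by `IsSmallCut.image_subset_ball`. -/
theorem exists_tendsto_of_locallyConnectedSpace (hF : IsDiskParam U F Φ)
    (hF0 : F 0 = OnePoint.infty) (hcut : HasSmallCuts U F) [LocallyConnectedSpace (frontier U)]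
    {ζ : ℂ} (hζ : ‖ζ‖ = 1) :
    ∃ q : RiemannSphere, Tendsto F (𝓝[ball 0 1] ζ) (𝓝 q) := by
  choose Γ R h using fun n : ℕ => hcut ζ hζ (1 / ((n : ℝ) + 2)) (by positivity) ∅ finite_empty
    (empty_subset _)
  choose a ha using fun n => (h n).nonempty
  have hdist : ∀ n, ∀ z ∈ Γ n ∪ R n, z ∈ ball (0 : ℂ) 1 ∧ dist z ζ < 1 / ((n : ℝ) + 2) := by
    rintro n z (hz | hz)
    · exact (h n).cut_subset hz
    · exact (h n).subset hz
  have hε : Tendsto (fun n : ℕ => 1 / ((n : ℝ) + 2)) atTop (𝓝 0) := by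
    have := (tendsto_const_div_atTop_nhds_zero_nat (1 : ℝ)).comp (tendsto_add_atTop_nat 2)
    refine this.congr fun n => ?_
    simp
  have h0n : ∀ n, (0 : ℂ) ∉ R n ∪ Γ n := fun n h0 => by
    have h1 := (hdist n 0 h0.symm).2
    rw [dist_zero_left, hζ] at h1
    have h2 : 1 / ((n : ℝ) + 2) ≤ 1 := by
      rw [div_le_one (by positivity)]; linarith [n.cast_nonneg (α := ℝ)]
    linarith
  let g := hyperfilter ℕ
  have hg : (g : Filter ℕ) ≤ atTop := Nat.hyperfilter_le_atTop
  have haζ : Tendsto a g (𝓝 ζ) := by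
    refine Tendsto.mono_left ?_ hg
    rw [tendsto_iff_dist_tendsto_zero]
    exact squeeze_zero (fun _ => dist_nonneg) (fun n => (hdist n _ (Or.inl (ha n))).2.le) hε
  obtain ⟨q, -, hq⟩ := isCompact_univ.ultrafilter_le_nhds (g.map fun n => F (a n)) (by simp)
  have hqt : Tendsto (fun n => F (a n)) g (𝓝 q) := hq
  have hζb : ζ ∉ ball (0 : ℂ) 1 := by rw [mem_ball_zero_iff, hζ]; exact lt_irrefl _
  have hqf : q ∈ frontier U := hF.mem_frontier_of_tendsto
    (Eventually.of_forall fun n => (hdist n _ (Or.inl (ha n))).1) hζb haζ hqt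
  have hq' : q ∉ U := by rw [hF.isOpen.frontier_eq] at hqf; exact hqf.2
  have hinf : OnePoint.infty ∈ U := hF0 ▸ hF.mapsTo (mem_ball_self one_pos)
  obtain ⟨p, rfl⟩ : ∃ p : ℂ, (p : RiemannSphere) = q :=
    OnePoint.ne_infty_iff_exists.1 fun e => hq' (e ▸ hinf)
  refine ⟨p, fun V hV => ?_⟩
  rw [OnePoint.nhds_coe_eq, mem_map] at hV
  obtain ⟨δ, hδ, hδV⟩ := Metric.mem_nhds_iff.1 hV
  set B : Set RiemannSphere := ((↑) : ℂ → RiemannSphere) '' ball p δ with hB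
  have hBo : IsOpen B := OnePoint.isOpenEmbedding_coe.isOpenMap _ isOpen_ball
  have hpB : (p : RiemannSphere) ∈ B := ⟨p, mem_ball_self hδ, rfl⟩
  -- a connected neighbourhood of the limit point in the boundary
  obtain ⟨N, ⟨hNn, hNc⟩, hNB⟩ :=
    (LocallyConnectedSpace.open_connected_basis (⟨p, hqf⟩ : frontier U)) |>.mem_iff.1
      ((hBo.preimage continuous_subtype_val).mem_nhds hpB) |> fun ⟨N, hN, hNB⟩ =>
        (⟨N, ⟨hN.1.mem_nhds hN.2.1, hN.2.2.isPreconnected⟩, hNB⟩ :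
          ∃ N : Set (frontier U), (N ∈ 𝓝 (⟨p, hqf⟩ : frontier U) ∧ IsPreconnected N) ∧
            N ⊆ Subtype.val ⁻¹' B)
  obtain ⟨O, hO, hON⟩ := mem_nhds_subtype _ _ _ |>.1 hNn
  obtain ⟨D, ⟨hD, hDc⟩, hDB⟩ := (closed_nhds_basis (p : RiemannSphere)).mem_iff.1
    (inter_mem hO (hBo.mem_nhds hpB))
  have hev : ∀ᶠ n in (g : Filter ℕ), F '' Γ n ⊆ D := by
    refine eventually_subset_of_chordalDist_lt (a := fun n => F (a n))
      (fun n => mem_image_of_mem _ (ha n)) hqt (fun ε hε' => ?_) hD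
    filter_upwards [hg (hε.eventually_lt_const hε')] with n hn x hx y hy
    exact ((h n).chordalDist_lt x hx y hy).trans hn
  obtain ⟨n, hn⟩ := hev.exists
  have hcl : closure (F '' Γ n) ⊆ D := closure_minimal hn hDc
  have hsub := (h n).image_subset_ball hF hF0 (h0n n) (p := p) (δ := δ) (L := Subtype.val '' N)
    (fun x hx => (hDB (hcl hx)).2) (hNc.image _ continuous_subtype_val.continuousOn)
    (by rintro _ ⟨x, -, rfl⟩; exact x.2) (by rintro _ ⟨x, hx, rfl⟩; exact hNB hx)
    (fun x hx => ⟨⟨x, hx.2⟩, hON (hDB (hcl hx.1)).1, rfl⟩)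
  obtain ⟨r, hr, hrR⟩ := (h n).exists_ball_subset
  rw [mem_map]
  refine mem_of_superset (inter_mem_nhdsWithin _ (ball_mem_nhds ζ hr)) fun z hz => ?_
  obtain ⟨y, hy, e⟩ := hsub ⟨z, hrR hz.symm, rfl⟩
  exact mem_preimage.2 (e ▸ hδV hy)
end

end

/-! ### Bounded models of conformal isomorphisms -/

section
open Metric

section
variable {U : TopologicalSpace.Opens RiemannSphere} (φ : ConformalIso U)

open Classical in
/-- The inverse of a conformal isomorphism `φ : U → 𝔻`, as a map defined on the plane. Its
value outside the open disk is irrelevant. -/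
def ofDisk (z : ℂ) : RiemannSphere :=
  if h : z ∈ ball (0 : ℂ) 1 then ((φ.symm ⟨z, h⟩ : U) : RiemannSphere) else OnePoint.infty

open Classical in
/-- A conformal isomorphism `φ : U → 𝔻`, as a map defined on the sphere. It
vanishes outside `U`. -/
def toDisk (p : RiemannSphere) : ℂ :=
  if h : p ∈ U then (φ ⟨p, h⟩ : ℂ) else 0

theorem ofDisk_coe (z : Disk) : ofDisk φ z = φ.symm z := dif_pos z.2

theorem toDisk_coe (x : U) : toDisk φ x = φ x := dif_pos x.2

theorem isDiskParam_ofDisk : IsDiskParam (U : Set RiemannSphere) (ofDisk φ) (toDisk φ) where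
  isOpen := U.isOpen
  continuousOn := by
    rw [continuousOn_iff_continuous_domRestrict]
    have : (ball (0 : ℂ) 1).domRestrict (ofDisk φ) = fun z : Disk => (φ.symm z : RiemannSphere) :=
      funext fun z => ofDisk_coe φ z
    rw [this]
    exact continuous_subtype_val.comp φ.symm.continuous
  continuousOn_symm := by
    rw [continuousOn_iff_continuous_domRestrict]
    have : (U : Set RiemannSphere).domRestrict (toDisk φ) = fun x : U => (φ x : ℂ) :=
      funext fun z => toDisk_coe φ z
    rw [this]
    exact continuous_subtype_val.comp φ.continuous
  mapsTo z hz := by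
    rw [show ofDisk φ z = φ.symm ⟨z, hz⟩ from ofDisk_coe φ ⟨z, hz⟩]
    exact (φ.symm ⟨z, hz⟩).2
  mapsTo_symm p hp := by
    rw [show toDisk φ p = φ ⟨p, hp⟩ from toDisk_coe φ ⟨p, hp⟩]
    exact (φ ⟨p, hp⟩).2
  left_inv z hz := by
    rw [show ofDisk φ z = φ.symm ⟨z, hz⟩ from ofDisk_coe φ ⟨z, hz⟩, toDisk_coe,
      φ.apply_symm_apply]
  right_inv p hp := by
    rw [show toDisk φ p = φ ⟨p, hp⟩ from toDisk_coe φ ⟨p, hp⟩, ofDisk_coe, φ.symm_apply_apply]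

theorem contMDiffAt_ofDisk {z : ℂ} (hz : z ∈ ball (0 : ℂ) 1) :
    ContMDiffAt 𝓘(ℂ) 𝓘(ℂ) ω (ofDisk φ) z := by
  have h : ContMDiffAt 𝓘(ℂ) 𝓘(ℂ) ω (fun w : Disk => ofDisk φ w) ⟨z, hz⟩ := by
    simp only [ofDisk_coe]
    exact (contMDiff_subtype_val.comp φ.symm.contMDiff) _
  exact contMDiffAt_subtype_iff.1 h

theorem contMDiffAt_toDisk {p : RiemannSphere} (hp : p ∈ U) :
    ContMDiffAt 𝓘(ℂ) 𝓘(ℂ) ω (toDisk φ) p := by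
  have h : ContMDiffAt 𝓘(ℂ) 𝓘(ℂ) ω (fun x : U => toDisk φ x) ⟨p, hp⟩ := by
    simp only [toDisk_coe]
    exact (contMDiff_subtype_val.comp φ.contMDiff) _
  exact contMDiffAt_subtype_iff.1 h

theorem chartAt_zero : chartAt ℂ ((0 : ℂ) : RiemannSphere) = finiteChart :=
  if_neg (OnePoint.coe_ne_infty 0)

theorem chartAt_infty : chartAt ℂ (OnePoint.infty : RiemannSphere) = infiniteChart := if_pos rfl

theorem differentiableAt_finiteChart_comp {f : ℂ → RiemannSphere} {z : ℂ}
    (hf : ContMDiffAt 𝓘(ℂ) 𝓘(ℂ) ω f z) (h : f z ≠ OnePoint.infty) :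
    DifferentiableAt ℂ (fun w => finiteChart (f w)) z := by
  have := (contMDiffAt_iff_target_of_mem_source (y := ((0 : ℂ) : RiemannSphere)) (by
    rw [chartAt_zero, finiteChart_source]
    exact OnePoint.ne_infty_iff_exists.1 h)).1 hf
  have h2 := this.2.contDiffAt.differentiableAt (by simp)
  simpa [extChartAt, chartAt_zero, Function.comp_def] using h2

theorem differentiableAt_infiniteChart_comp {f : ℂ → RiemannSphere} {z : ℂ}
    (hf : ContMDiffAt 𝓘(ℂ) 𝓘(ℂ) ω f z) (h : f z ≠ ((0 : ℂ) : RiemannSphere)) :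
    DifferentiableAt ℂ (fun w => finiteChart (sphereInv (f w))) z := by
  have := (contMDiffAt_iff_target_of_mem_source (y := (OnePoint.infty : RiemannSphere)) (by
    rw [chartAt_infty, infiniteChart_source]
    refine OnePoint.ne_infty_iff_exists.1 fun e => h ?_
    rw [← sphereInv_sphereInv (f z), e, sphereInv_infty])).1 hf
  have h2 := this.2.contDiffAt.differentiableAt (by simp)
  simpa [extChartAt, chartAt_infty, Function.comp_def, infiniteChart_apply] using h2

theorem contMDiff_coe : ContMDiff 𝓘(ℂ) 𝓘(ℂ) ω ((↑) : ℂ → RiemannSphere) := fun z => by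
  refine (contMDiffAt_iff_target_of_mem_source (y := ((0 : ℂ) : RiemannSphere)) (by
    rw [chartAt_zero, finiteChart_source]; exact ⟨z, rfl⟩)).2
      ⟨OnePoint.continuous_coe.continuousAt, ?_⟩
  have : extChartAt 𝓘(ℂ) ((0 : ℂ) : RiemannSphere) ∘ ((↑) : ℂ → RiemannSphere) = id := by
    ext w; simp [extChartAt, chartAt_zero, finiteChart_coe]
  rw [this]
  exact contMDiffAt_id

/-- An open subset of the sphere which is conformally isomorphic to the disk omits at least two
finite points, by Liouville's theorem. -/
theorem exists_two_notMem (φ : ConformalIso U) : ∃ c b : ℂ, c ≠ b ∧ (c : RiemannSphere) ∉ U ∧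
    (b : RiemannSphere) ∉ U := by
  have hF := isDiskParam_ofDisk φ
  by_contra! hcon
  obtain ⟨c, hc⟩ : ∃ c : ℂ, ∀ w : ℂ, w ≠ c → (w : RiemannSphere) ∈ U := by
    by_cases h : ∃ c : ℂ, (c : RiemannSphere) ∉ U
    · obtain ⟨c, hc⟩ := h
      exact ⟨c, fun w hw => hcon c w hw.symm hc⟩
    · push Not at h
      exact ⟨0, fun w _ => h w⟩
  have hb : ∀ p, ‖toDisk φ p‖ ≤ 1 := fun p => by
    by_cases hp : p ∈ U
    · exact (mem_ball_zero_iff.1 (hF.mapsTo_symm hp)).le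
    · rw [toDisk, dif_neg hp]; simp
  -- a bounded function, holomorphic except possibly at `c`
  let k : ℂ → ℂ := fun w => toDisk φ w
  have hk : DifferentiableOn ℂ k (univ \ {c}) := fun w hw => by
    have h1 := (contMDiffAt_toDisk φ (hc w hw.2)).comp w (contMDiff_coe w)
    exact (h1.contDiffAt.differentiableAt (by simp)).differentiableWithinAt
  have hk2 := Complex.differentiableOn_update_limUnder_of_bddAbove univ_mem hk
    ⟨1, by rintro _ ⟨w, -, rfl⟩; exact hb w⟩
  have hbd : Bornology.IsBounded (range (Function.update k c (limUnder (𝓝[≠] c) k))) := by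
    refine ((isBounded_closedBall (x := (0 : ℂ)) (r := 1)).union
      (Bornology.isBounded_singleton (x := limUnder (𝓝[≠] c) k))).subset ?_
    rintro _ ⟨w, rfl⟩
    by_cases hw : w = c
    · subst hw; right; simp
    · left
      rw [Function.update_of_ne hw, mem_closedBall_zero_iff]
      exact hb w
  have h1 : c + 1 ≠ c := by simp
  have h2 : c + 2 ≠ c := by simp
  have := (differentiableOn_univ.1 hk2).apply_eq_apply_of_bounded hbd (c + 1) (c + 2)
  rw [Function.update_of_ne h1, Function.update_of_ne h2] at this
  have h3 := congrArg (ofDisk φ) this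
  rw [hF.right_inv _ (hc _ h1), hF.right_inv _ (hc _ h2), OnePoint.coe_eq_coe] at h3
  norm_num at h3

/-- The translation by `c` of the Riemann sphere. -/
def sphereTranslate (c : ℂ) : RiemannSphere ≃ₜ RiemannSphere :=
  (Homeomorph.addRight c).onePointCongr

theorem sphereTranslate_coe (c z : ℂ) :
    sphereTranslate c (z : RiemannSphere) = ((z + c : ℂ) : RiemannSphere) := rfl

theorem sphereTranslate_infty (c : ℂ) : sphereTranslate c OnePoint.infty = OnePoint.infty := rfl

/-- The map `z ↦ z ^ 2` of the Riemann sphere. -/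
def sphereSq : RiemannSphere → RiemannSphere := OnePoint.map fun z : ℂ => z ^ 2

theorem sphereSq_coe (z : ℂ) : sphereSq (z : RiemannSphere) = ((z ^ 2 : ℂ) : RiemannSphere) := rfl

theorem continuous_sphereSq : Continuous sphereSq := by
  refine OnePoint.continuous_map (by fun_prop) ?_
  rw [coclosedCompact_eq_cocompact, ← Metric.cobounded_eq_cocompact]
  rw [← tendsto_norm_atTop_iff_cobounded]
  simp only [norm_pow]
  exact (tendsto_pow_atTop two_ne_zero).comp tendsto_norm_cobounded_atTop

theorem finite_sphereSq_preimage (p : RiemannSphere) : (sphereSq ⁻¹' {p}).Finite := by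
  by_cases h : ∃ z : ℂ, sphereSq z = p
  · obtain ⟨z, rfl⟩ := h
    refine (toFinite {((z : ℂ) : RiemannSphere), ((-z : ℂ) : RiemannSphere)}).subset fun q hq => ?_
    induction q using OnePoint.rec with
    | infty => exact absurd hq.symm (OnePoint.coe_ne_infty _)
    | coe w =>
      rcases sq_eq_sq_iff_eq_or_eq_neg.1 (OnePoint.coe_eq_coe.1 hq) with rfl | rfl
      · exact Or.inl rfl
      · exact Or.inr rfl
  · refine (finite_singleton OnePoint.infty).subset fun q hq => ?_
    induction q using OnePoint.rec with
    | infty => rfl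
    | coe w => exact absurd ⟨w, hq⟩ h

/-- A holomorphic function without zeros on the disk has a holomorphic square root. -/
theorem exists_differentiableOn_sq_eq {h : ℂ → ℂ} (hd : DifferentiableOn ℂ h (ball 0 1))
    (h0 : ∀ z ∈ ball (0 : ℂ) 1, h z ≠ 0) :
    ∃ s : ℂ → ℂ, DifferentiableOn ℂ s (ball 0 1) ∧ ∀ z ∈ ball (0 : ℂ) 1, s z ^ 2 = h z := by
  have h0b : (0 : ℂ) ∈ ball (0 : ℂ) 1 := mem_ball_self one_pos
  have hq : DifferentiableOn ℂ (fun z => deriv h z / h z) (ball 0 1) :=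
    (hd.deriv isOpen_ball).div hd h0
  obtain ⟨L, hL0, hL⟩ := hq.isExactOn_ball.with_val_at 0 (Complex.log (h 0))
  have hconst : ∀ z ∈ ball (0 : ℂ) 1, h z * Complex.exp (-L z) = 1 := by
    have hder : ∀ z ∈ ball (0 : ℂ) 1,
        HasDerivAt (fun z => h z * Complex.exp (-L z)) 0 z := fun z hz => by
      have h1 := (hd.differentiableAt (isOpen_ball.mem_nhds hz)).hasDerivAt
      convert! h1.mul (hL z hz).neg.cexp using 1
      have := h0 z hz
      field_simp
      ring
    intro z hz
    have := isOpen_ball.is_const_of_deriv_eq_zero (convex_ball (0 : ℂ) 1).isPreconnected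
      (fun z hz => (hder z hz).differentiableAt.differentiableWithinAt)
      (fun z hz => (hder z hz).deriv) hz h0b
    rw [this, hL0, Complex.exp_neg, Complex.exp_log (h0 0 h0b), mul_inv_cancel₀ (h0 0 h0b)]
  refine ⟨fun z => Complex.exp (L z / 2), fun z hz => ?_, fun z hz => ?_⟩
  · exact ((hL z hz).differentiableAt.div_const 2).cexp.differentiableWithinAt
  · have := hconst z hz
    rw [Complex.exp_neg, ← div_eq_mul_inv, div_eq_one_iff_eq (Complex.exp_ne_zero _)] at this
    rw [this, ← Complex.exp_nat_mul]
    congr 1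
    push_cast
    ring

/-- The inverse of a conformal isomorphism `φ : U → 𝔻` is the composition of a bounded injective
holomorphic function and a continuous map of the sphere with finite fibres. With finite points
`c` and `b` outside `U`, a square root `s` of `1 / (z - c) - 1 / (b - c)` is injective on `U`, and
it takes no values close to `-s₀` if `s₀` is one of its values. -/
theorem exists_bounded_model (φ : ConformalIso U) : ∃ (G : ℂ → ℂ) (Q : ℂ → RiemannSphere),
    DifferentiableOn ℂ G (ball 0 1) ∧ InjOn G (ball 0 1) ∧ Bornology.IsBounded (G '' ball 0 1) ∧
    Continuous Q ∧ (∀ p, (Q ⁻¹' {p}).Finite) ∧ ∀ z ∈ ball (0 : ℂ) 1, ofDisk φ z = Q (G z) := by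
  have hF := isDiskParam_ofDisk φ
  obtain ⟨c, b, hcb, hc, hb⟩ := exists_two_notMem φ
  have h0b : (0 : ℂ) ∈ ball (0 : ℂ) 1 := mem_ball_self one_pos
  have hne : ∀ {a : ℂ}, (a : RiemannSphere) ∉ U → ∀ z ∈ ball (0 : ℂ) 1, ofDisk φ z ≠ a :=
    fun ha z hz e => ha (e ▸ hF.mapsTo hz)
  classical
  -- the function `1 / (F z - c)`, with value zero at the pole of `F`
  let g : ℂ → ℂ := fun z => finiteChart (sphereInv (sphereTranslate (-c) (ofDisk φ z)))
  have hgcoe : ∀ z ∈ ball (0 : ℂ) 1,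
      (g z : RiemannSphere) = sphereInv (sphereTranslate (-c) (ofDisk φ z)) := fun z hz => by
    obtain ⟨w, hw⟩ : ∃ w : ℂ, (w : RiemannSphere) =
        sphereInv (sphereTranslate (-c) (ofDisk φ z)) := by
      refine OnePoint.ne_infty_iff_exists.1 fun e => ?_
      rw [← sphereInv_zero] at e
      have e2 : sphereTranslate (-c) (ofDisk φ z) = sphereTranslate (-c) c := by
        rw [sphereTranslate_coe, add_neg_cancel, ← sphereInv_sphereInv (sphereTranslate _ _), e,
          sphereInv_sphereInv]
      exact hne hc z hz ((sphereTranslate (-c)).injective e2)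
    simp only [g, ← hw, finiteChart_coe]
  have hFg : ∀ z ∈ ball (0 : ℂ) 1,
      ofDisk φ z = sphereTranslate c (sphereInv (g z : RiemannSphere)) := fun z hz => by
    rw [hgcoe z hz, sphereInv_sphereInv]
    induction ofDisk φ z using OnePoint.rec with
    | infty => rfl
    | coe w => simp [sphereTranslate_coe]
  have hgd : DifferentiableOn ℂ g (ball 0 1) := fun z hz => by
    refine DifferentiableAt.differentiableWithinAt ?_
    have hFz := contMDiffAt_ofDisk φ hz
    have hcont := hF.continuousOn.continuousAt (isOpen_ball.mem_nhds hz)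
    by_cases hinf : ofDisk φ z = OnePoint.infty
    · have h00 : ofDisk φ z ≠ ((0 : ℂ) : RiemannSphere) := by
        rw [hinf]; exact (OnePoint.coe_ne_infty _).symm
      have hd := differentiableAt_infiniteChart_comp hFz h00
      have hval : finiteChart (sphereInv (ofDisk φ z)) = 0 := by
        rw [hinf, sphereInv_infty, finiteChart_coe]
      refine ((hd.div ((hd.const_mul c).const_sub 1) (by simp [hval])).congr_of_eventuallyEq ?_)
      filter_upwards [hcont.eventually_ne h00, isOpen_ball.mem_nhds hz] with w hw hwb
      have hwc := hne hc w hwb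
      simp only [g, Pi.div_apply]
      generalize ofDisk φ w = q at hw hwc ⊢
      induction q using OnePoint.rec with
      | infty => simp [sphereTranslate_infty, sphereInv_infty, finiteChart_coe]
      | coe x =>
        have hx : x ≠ 0 := fun e => hw (by rw [e])
        have hxc : x - c ≠ 0 := sub_ne_zero.2 fun e => hwc (by rw [e])
        rw [sphereTranslate_coe, ← sub_eq_add_neg, sphereInv_coe hxc, sphereInv_coe hx,
          finiteChart_coe, finiteChart_coe]
        field_simp
    · have hd := differentiableAt_finiteChart_comp hFz hinf
      obtain ⟨x, hx⟩ := OnePoint.ne_infty_iff_exists.1 hinf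
      have hval : finiteChart (ofDisk φ z) - c ≠ 0 := by
        rw [← hx, finiteChart_coe]
        exact sub_ne_zero.2 fun e => hne hc z hz (by rw [← hx, e])
      refine ((hd.sub_const c).inv hval).congr_of_eventuallyEq ?_
      filter_upwards [hcont.eventually_ne hinf, isOpen_ball.mem_nhds hz] with w hw hwb
      have hwc := hne hc w hwb
      simp only [g, Pi.inv_apply]
      obtain ⟨x, hx⟩ := OnePoint.ne_infty_iff_exists.1 hw
      have hxc : x - c ≠ 0 := sub_ne_zero.2 fun e => hwc (by rw [← hx, e])
      rw [← hx, sphereTranslate_coe, ← sub_eq_add_neg, sphereInv_coe hxc,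
        finiteChart_coe, finiteChart_coe]
  have hginj : ∀ z ∈ ball (0 : ℂ) 1, ∀ w ∈ ball (0 : ℂ) 1, g z = g w → z = w :=
    fun z hz w hw e => hF.injOn hz hw (by rw [hFg z hz, hFg w hw, e])
  have hg0 : ∀ z ∈ ball (0 : ℂ) 1, g z - (b - c)⁻¹ ≠ 0 := fun z hz e => by
    refine hne hb z hz ?_
    have hbc : b - c ≠ 0 := sub_ne_zero.2 hcb.symm
    rw [hFg z hz, sub_eq_zero.1 e, sphereInv_coe (inv_ne_zero hbc), inv_inv, sphereTranslate_coe,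
      sub_add_cancel]
  obtain ⟨s, hsd, hs⟩ := exists_differentiableOn_sq_eq (hgd.sub_const _) hg0
  have hsinj : ∀ z ∈ ball (0 : ℂ) 1, ∀ w ∈ ball (0 : ℂ) 1, s z ^ 2 = s w ^ 2 → z = w :=
    fun z hz w hw e => hginj z hz w hw (by rw [hs z hz, hs w hw] at e; exact sub_left_injective e)
  have hs0 : ∀ z ∈ ball (0 : ℂ) 1, s z ≠ 0 := fun z hz e => hg0 z hz (by
    rw [← hs z hz, e]; simp)
  obtain ⟨r, hr, hball⟩ : ∃ r > 0, ball (s 0) r ⊆ s '' ball 0 1 := by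
    rcases (hsd.analyticOnNhd isOpen_ball).is_constant_or_isOpen
      (convex_ball (0 : ℂ) 1).isPreconnected with ⟨w, hw⟩ | ho
    · have h2 : (1 / 2 : ℂ) ∈ ball (0 : ℂ) 1 := by rw [mem_ball_zero_iff]; norm_num
      have := hsinj _ h0b _ h2 (by rw [hw _ h0b, hw _ h2])
      norm_num at this
    · exact Metric.isOpen_iff.1 (ho _ Subset.rfl isOpen_ball) _ ⟨0, h0b, rfl⟩
  have hfar : ∀ z ∈ ball (0 : ℂ) 1, r ≤ ‖s z + s 0‖ := fun z hz => by
    by_contra! hlt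
    obtain ⟨w, hw, e⟩ := hball (show -s z ∈ ball (s 0) r by
      rwa [mem_ball_iff_norm, show -s z - s 0 = -(s z + s 0) by ring, norm_neg])
    have e2 := hsinj w hw z hz (by rw [e]; ring)
    subst e2
    exact hs0 w hw (by linear_combination e / 2)
  have hfar0 : ∀ z ∈ ball (0 : ℂ) 1, s z + s 0 ≠ 0 := fun z hz =>
    norm_pos_iff.1 (hr.trans_le (hfar z hz))
  refine ⟨fun z => (s z + s 0)⁻¹, fun x => sphereTranslate c (sphereInv (sphereTranslate (b - c)⁻¹
    (sphereSq (sphereTranslate (-s 0) (sphereInv x))))), (hsd.add_const _).inv hfar0,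
    fun z hz w hw e => hsinj z hz w hw ?_, ?_, ?_, fun p => ?_, fun z hz => ?_⟩
  · rw [add_right_cancel (inv_injective e)]
  · refine (isBounded_closedBall (x := (0 : ℂ)) (r := r⁻¹)).subset ?_
    rintro _ ⟨z, hz, rfl⟩
    rw [mem_closedBall_zero_iff, norm_inv]
    exact inv_anti₀ hr (hfar z hz)
  · exact (sphereTranslate c).continuous.comp (continuous_sphereInv.comp
      ((sphereTranslate _).continuous.comp (continuous_sphereSq.comp
        ((sphereTranslate _).continuous.comp (continuous_sphereInv.comp
          OnePoint.continuous_coe)))))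
  · have hinj : Function.Injective
        fun p => sphereTranslate c (sphereInv (sphereTranslate (b - c)⁻¹ p)) :=
      (sphereTranslate c).injective.comp
        (sphereInvHomeo.injective.comp (sphereTranslate _).injective)
    have hinj' : Function.Injective
        fun x : ℂ => sphereTranslate (-s 0) (sphereInv (x : RiemannSphere)) :=
      (sphereTranslate _).injective.comp
        (sphereInvHomeo.injective.comp OnePoint.coe_injective)
    have h1 := (finite_singleton p).preimage hinj.injOn
    have h2 := h1.preimage' (f := sphereSq) fun q _ => finite_sphereSq_preimage q
    have h3 := h2.preimage (hinj'.injOn (s := _))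
    exact h3
  · simp only
    rw [hFg z hz, sphereInv_coe (inv_ne_zero (hfar0 z hz)), inv_inv, sphereTranslate_coe,
      add_neg_cancel_right, sphereSq_coe, hs z hz, sphereTranslate_coe, sub_add_cancel]

/-- The parametrization of `U` by the disk, followed by a homeomorphism of the sphere, has short
crosscuts at all boundary points. -/
theorem exists_isDiskParam_hasSmallCuts (φ : ConformalIso U) (M : RiemannSphere ≃ₜ RiemannSphere) :
    (∃ Φ, IsDiskParam (M '' U) (M ∘ ofDisk φ) Φ) ∧ HasSmallCuts (M '' U) (M ∘ ofDisk φ) := by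
  have hF := isDiskParam_ofDisk φ
  have hF' : IsDiskParam (M '' U) (M ∘ ofDisk φ) (toDisk φ ∘ M.symm) :=
    { isOpen := M.isOpen_image.2 U.isOpen
      continuousOn := M.continuous.comp_continuousOn hF.continuousOn
      continuousOn_symm := hF.continuousOn_symm.comp M.symm.continuous.continuousOn (by
        rintro _ ⟨p, hp, rfl⟩; rwa [M.symm_apply_apply])
      mapsTo := fun z hz => mem_image_of_mem _ (hF.mapsTo hz)
      mapsTo_symm := by
        rintro _ ⟨p, hp, rfl⟩
        simpa using hF.mapsTo_symm hp
      left_inv := fun z hz => by simpa using hF.left_inv z hz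
      right_inv := by
        rintro _ ⟨p, hp, rfl⟩
        simp [hF.right_inv p hp] }
  refine ⟨⟨_, hF'⟩, ?_⟩
  obtain ⟨G, Q, hG, hinj, hb, hQ, hQfin, hFG⟩ := exists_bounded_model φ
  intro ζ hζ ε hε P hP hPU
  refine exists_isSmallCut hF' hG hinj hb (M.continuous.comp hQ) (fun p => ?_)
    (fun z hz => congrArg M (hFG z hz)) hζ hε hP hPU
  have : (M ∘ Q) ⁻¹' {p} = Q ⁻¹' {M.symm p} := by
    ext z
    exact ⟨fun h => (M.symm_apply_eq.2 h.symm).symm, fun h => (M.symm_apply_eq.1 h.symm).symm⟩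
  rw [this]
  exact hQfin _

/-- A homeomorphism of the sphere which maps a given point to infinity. -/
theorem exists_homeomorph_apply_eq_infty (p : RiemannSphere) :
    ∃ M : RiemannSphere ≃ₜ RiemannSphere, M p = OnePoint.infty := by
  induction p using OnePoint.rec with
  | infty => exact ⟨Homeomorph.refl _, rfl⟩
  | coe c =>
    refine ⟨(sphereTranslate (-c)).trans sphereInvHomeo, ?_⟩
    change sphereInv (sphereTranslate (-c) c) = _
    rw [sphereTranslate_coe, add_neg_cancel, sphereInv_zero]

/-- If the boundary of `U` is locally connected, then the inverse of a conformal isomorphism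
`φ : U → 𝔻` has a limit at every point of the unit circle. One may assume that the value at zero is
infinity. -/
theorem exists_tendsto_ofDisk (φ : ConformalIso U)
    [hlc : LocallyConnectedSpace (frontier (U : Set RiemannSphere))] {ζ : ℂ} (hζ : ‖ζ‖ = 1) :
    ∃ q : RiemannSphere, Tendsto (ofDisk φ) (𝓝[ball 0 1] ζ) (𝓝 q) := by
  obtain ⟨M, hM⟩ := exists_homeomorph_apply_eq_infty (ofDisk φ 0)
  obtain ⟨⟨Φ, hF⟩, hcut⟩ := exists_isDiskParam_hasSmallCuts φ M
  have : LocallyConnectedSpace (frontier (M '' (U : Set RiemannSphere))) := by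
    rw [← M.image_frontier]
    exact (M.image (frontier (U : Set RiemannSphere))).symm.locallyConnectedSpace
  obtain ⟨q, hq⟩ := exists_tendsto_of_locallyConnectedSpace hF hM hcut hζ
  refine ⟨M.symm q, ((M.symm.continuous.tendsto q).comp hq).congr fun z => ?_⟩
  simp

end

end

/-! ### Functions on the disk of absolute value one at the circle -/

section
open Metric ComplexConjugate

/-- The filter of points of the open unit disk which tend to the unit circle. -/
def nearCircle : Filter ℂ := comap norm (𝓝[<] 1)

theorem eventually_nearCircle_iff {p : ℂ → Prop} :
    (∀ᶠ z in nearCircle, p z) ↔ ∃ r < 1, ∀ z : ℂ, r < ‖z‖ → ‖z‖ < 1 → p z := by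
  rw [nearCircle, ((nhdsLT_basis (1 : ℝ)).comap norm).eventually_iff]
  exact ⟨fun ⟨r, hr, h⟩ => ⟨r, hr, fun z h1 h2 => h ⟨h1, h2⟩⟩,
    fun ⟨r, hr, h⟩ => ⟨r, hr, fun z hz => h z hz.1 hz.2⟩⟩

/-- The maximum principle. -/
theorem norm_le_one_of_tendsto {f : ℂ → ℂ} (hf : DifferentiableOn ℂ f (ball 0 1))
    (h1 : Tendsto (fun z => ‖f z‖) nearCircle (𝓝 1)) {z : ℂ} (hz : z ∈ ball (0 : ℂ) 1) :
    ‖f z‖ ≤ 1 := by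
  refine le_of_forall_gt_imp_ge_of_dense fun c hc => ?_
  obtain ⟨r, hr, h⟩ := eventually_nearCircle_iff.1 (h1.eventually_lt_const hc)
  rw [mem_ball_zero_iff] at hz
  obtain ⟨s, hs, hs1⟩ := exists_between (max_lt hr hz)
  rw [max_lt_iff] at hs
  have hs0 : s ≠ 0 := ((norm_nonneg z).trans_lt hs.2).ne'
  refine Complex.norm_le_of_forall_mem_frontier_norm_le isBounded_ball
    (U := ball 0 s) ?_ (fun w hw => ?_) (subset_closure (mem_ball_zero_iff.2 hs.2))
  · refine DifferentiableOn.diffContOnCl ?_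
    rw [closure_ball _ hs0]
    exact hf.mono (closedBall_subset_ball hs1)
  · rw [frontier_ball _ hs0, mem_sphere_zero_iff_norm] at hw
    exact (h w (hw ▸ hs.1) (hw ▸ hs1)).le

/-- The Möbius transformation of the disk which maps `a` to zero. -/
def blaschke (a z : ℂ) : ℂ := (z - a) / (1 - conj a * z)

theorem one_sub_conj_mul_ne_zero {a z : ℂ} (ha : ‖a‖ < 1) (hz : ‖z‖ ≤ 1) :
    1 - conj a * z ≠ 0 := fun h => by
  have h1 : ‖conj a * z‖ = 1 := by rw [← sub_eq_zero.1 h, norm_one]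
  rw [norm_mul, RCLike.norm_conj] at h1
  nlinarith [norm_nonneg a, norm_nonneg z]

theorem one_sub_norm_blaschke_sq {a z : ℂ} (ha : ‖a‖ < 1) (hz : ‖z‖ ≤ 1) :
    1 - ‖blaschke a z‖ ^ 2 = (1 - ‖a‖ ^ 2) * (1 - ‖z‖ ^ 2) / ‖1 - conj a * z‖ ^ 2 := by
  have h0 : ‖1 - conj a * z‖ ^ 2 ≠ 0 :=
    pow_ne_zero 2 (norm_ne_zero_iff.2 (one_sub_conj_mul_ne_zero ha hz))
  rw [blaschke, norm_div, div_pow, eq_div_iff h0, sub_mul, div_mul_cancel₀ _ h0]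
  simp only [Complex.sq_norm, Complex.normSq_apply]
  simp
  ring

theorem tendsto_norm_blaschke {a : ℂ} (ha : ‖a‖ < 1) :
    Tendsto (fun z => ‖blaschke a z‖) nearCircle (𝓝 1) := by
  have hn : Tendsto (fun z : ℂ => ‖z‖) nearCircle (𝓝 1) :=
    tendsto_comap.mono_right nhdsWithin_le_nhds
  have hb : ∀ᶠ z in nearCircle, ‖z‖ < 1 :=
    eventually_nearCircle_iff.2 ⟨0, zero_lt_one, fun z _ h => h⟩
  have hup : Tendsto (fun z : ℂ => (1 - ‖a‖ ^ 2) * (1 - ‖z‖ ^ 2) / (1 - ‖a‖) ^ 2)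
      nearCircle (𝓝 0) := by
    have := (((hn.pow 2).const_sub 1).const_mul (1 - ‖a‖ ^ 2)).div_const ((1 - ‖a‖) ^ 2)
    simpa using this
  have h2 : Tendsto (fun z => 1 - ‖blaschke a z‖ ^ 2) nearCircle (𝓝 0) := by
    have ha2 : 0 ≤ 1 - ‖a‖ ^ 2 := by nlinarith [norm_nonneg a]
    refine squeeze_zero' ?_ ?_ hup
    · filter_upwards [hb] with z hz
      rw [one_sub_norm_blaschke_sq ha hz.le]
      have : 0 ≤ 1 - ‖z‖ ^ 2 := by nlinarith [norm_nonneg z]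
      positivity
    · filter_upwards [hb] with z hz
      rw [one_sub_norm_blaschke_sq ha hz.le]
      have hz2 : 0 ≤ 1 - ‖z‖ ^ 2 := by nlinarith [norm_nonneg z]
      have h3 : 1 - ‖a‖ ≤ ‖1 - conj a * z‖ := by
        have h4 := norm_sub_norm_le 1 (conj a * z)
        rw [norm_one, norm_mul, RCLike.norm_conj] at h4
        nlinarith [norm_nonneg a]
      have h5 : 0 < 1 - ‖a‖ := by linarith
      gcongr
  have h3 := (h2.const_sub 1).sqrt
  simpa using h3

/-- The inductive step towards `exists_contDiffOn_closedBall`. Factors `blaschke a` are split off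
from `f` one at a time, and each of them increases the value of `‖f z₀‖` by at least a fixed
factor, as the zeros stay in a compact subset of the disk. So `n` bounds the number of zeros. -/
theorem exists_contDiffOn_aux {ρ q : ℝ} {z₀ : ℂ} (hz₀ : ‖z₀‖ < 1)
    (hq : ∀ a : ℂ, ‖a‖ ≤ ρ → ‖blaschke a z₀‖ ^ 2 ≤ q) (hq0 : 0 < q) (n : ℕ) :
    ∀ f : ℂ → ℂ, DifferentiableOn ℂ f (ball 0 1) →
      Tendsto (fun z => ‖f z‖) nearCircle (𝓝 1) → (∀ a ∈ ball (0 : ℂ) 1, f a = 0 → ‖a‖ ≤ ρ) →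
      q ^ n < ‖f z₀‖ ^ 2 →
      ∃ h : ℂ → ℂ, ContDiffOn ℝ ∞ h (closedBall 0 1) ∧ EqOn f h (ball 0 1) := by
  have hz₀b : z₀ ∈ ball (0 : ℂ) 1 := mem_ball_zero_iff.2 hz₀
  induction n with
  | zero =>
    intro f hf h1 _ hn
    have := norm_le_one_of_tendsto hf h1 hz₀b
    rw [pow_zero] at hn
    nlinarith [norm_nonneg (f z₀)]
  | succ n ih =>
    intro f hf h1 hzero hn
    by_cases hex : ∃ a ∈ ball (0 : ℂ) 1, f a = 0
    · obtain ⟨a, hab, ha0⟩ := hex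
      have ha : ‖a‖ < 1 := mem_ball_zero_iff.1 hab
      let g : ℂ → ℂ := fun z => dslope f a z * (1 - conj a * z)
      have hfac : ∀ z : ℂ, ‖z‖ < 1 → f z = blaschke a z * g z := fun z hz => by
        have h2 := one_sub_conj_mul_ne_zero ha hz.le
        have h3 := sub_smul_dslope f a z
        rw [ha0, sub_zero, smul_eq_mul] at h3
        rw [← h3]
        simp only [g, blaschke]
        rw [div_mul_eq_mul_div, eq_div_iff h2]
        ring
      have hgd : DifferentiableOn ℂ g (ball 0 1) :=
        ((Complex.differentiableOn_dslope (isOpen_ball.mem_nhds hab)).2 hf).mul (by fun_prop)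
      have hg1 : Tendsto (fun z => ‖g z‖) nearCircle (𝓝 1) := by
        have h2 := h1.div (tendsto_norm_blaschke ha) one_ne_zero
        rw [div_one] at h2
        refine h2.congr' ?_
        rw [EventuallyEq, eventually_nearCircle_iff]
        refine ⟨‖a‖, ha, fun z hz hz1 => ?_⟩
        have h3 : blaschke a z ≠ 0 := div_ne_zero
          (sub_ne_zero.2 fun e => by rw [e] at hz; exact lt_irrefl _ hz)
          (one_sub_conj_mul_ne_zero ha hz1.le)
        simp only [Pi.div_apply]
        rw [hfac z hz1, norm_mul, mul_div_cancel_left₀ _ (norm_ne_zero_iff.2 h3)]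
      obtain ⟨h, hh, he⟩ := ih g hgd hg1 (fun w hw hw0 => hzero w hw (by
        rw [hfac w (mem_ball_zero_iff.1 hw), hw0, mul_zero])) (by
        have h2 := hq a (hzero a hab ha0)
        rw [hfac z₀ hz₀, norm_mul, mul_pow, pow_succ] at hn
        have h3 : ‖blaschke a z₀‖ ^ 2 * ‖g z₀‖ ^ 2 ≤ q * ‖g z₀‖ ^ 2 := by gcongr
        nlinarith)
      refine ⟨fun z => blaschke a z * h z, ContDiffOn.mul ?_ hh, fun z hz => ?_⟩
      · have hb : ContDiffOn ℂ ∞ (blaschke a) (closedBall 0 1) :=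
          (contDiffOn_id.sub contDiffOn_const).div
            (contDiffOn_const.sub (contDiffOn_const.mul contDiffOn_id)) fun z hz =>
              one_sub_conj_mul_ne_zero ha (mem_closedBall_zero_iff.1 hz)
        exact hb.restrict_scalars ℝ
      · rw [hfac z (mem_ball_zero_iff.1 hz), he hz]
    · push Not at hex
      have hinv : DifferentiableOn ℂ (fun z => (f z)⁻¹) (ball 0 1) := hf.inv hex
      have hinv1 : Tendsto (fun z => ‖(f z)⁻¹‖) nearCircle (𝓝 1) := by
        simpa [norm_inv] using h1.inv₀ one_ne_zero
      have hnorm : ∀ z ∈ ball (0 : ℂ) 1, ‖f z‖ = 1 := fun z hz => by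
        refine (norm_le_one_of_tendsto hf h1 hz).antisymm ?_
        have h2 := norm_le_one_of_tendsto hinv hinv1 hz
        rwa [norm_inv, inv_le_one₀ (norm_pos_iff.2 (hex z hz))] at h2
      refine ⟨fun _ => f z₀, contDiffOn_const, ?_⟩
      refine Complex.eqOn_of_isPreconnected_of_isMaxOn_norm (convex_ball (0 : ℂ) 1).isPreconnected
        isOpen_ball hf hz₀b fun z hz => ?_
      simp [hnorm z hz, hnorm z₀ hz₀b]

/-- A holomorphic function on the disk whose absolute value tends to one at the circle is a finite
Blaschke product up to a constant factor, hence it extends smoothly to the closed disk. -/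
theorem exists_contDiffOn_closedBall {f : ℂ → ℂ} (hf : DifferentiableOn ℂ f (ball 0 1))
    (h1 : Tendsto (fun z => ‖f z‖) nearCircle (𝓝 1)) :
    ∃ h : ℂ → ℂ, ContDiffOn ℝ ∞ h (closedBall 0 1) ∧ EqOn f h (ball 0 1) := by
  obtain ⟨r, hr, hpos⟩ := eventually_nearCircle_iff.1 (h1.eventually_const_lt zero_lt_one)
  obtain ⟨ρ, hρr, hρ⟩ := exists_between (max_lt hr zero_lt_one)
  rw [max_lt_iff] at hρr
  have hρn : ‖(ρ : ℂ)‖ = ρ := by rw [Complex.norm_real, Real.norm_of_nonneg hρr.2.le]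
  have hz₀ : 0 < ‖f ρ‖ := hpos _ (by rw [hρn]; exact hρr.1) (by rw [hρn]; exact hρ)
  set δ : ℝ := (1 - ρ ^ 2) * (1 - ρ ^ 2) / 4 with hδ
  have hρ2 : 0 < 1 - ρ ^ 2 := by nlinarith
  have hδ0 : 0 < δ := by positivity
  have hδ1 : δ < 1 := by
    rw [hδ, div_lt_one (by norm_num)]; nlinarith [sq_nonneg ρ]
  have hq : ∀ a : ℂ, ‖a‖ ≤ ρ → ‖blaschke a ρ‖ ^ 2 ≤ 1 - δ := fun a ha => by
    have ha1 : ‖a‖ < 1 := ha.trans_lt hρ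
    have h2 := one_sub_norm_blaschke_sq (z := ρ) ha1 (by rw [hρn]; exact hρ.le)
    have h3 : ‖1 - conj a * (ρ : ℂ)‖ ≤ 2 := by
      refine (norm_sub_le _ _).trans ?_
      rw [norm_one, norm_mul, RCLike.norm_conj, hρn]
      nlinarith [norm_nonneg a]
    have h4 : 0 < ‖1 - conj a * (ρ : ℂ)‖ :=
      norm_pos_iff.2 (one_sub_conj_mul_ne_zero ha1 (by rw [hρn]; exact hρ.le))
    have h5 : δ ≤ 1 - ‖blaschke a ρ‖ ^ 2 := by
      rw [h2, hρn, hδ]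
      have h6 : 1 - ρ ^ 2 ≤ 1 - ‖a‖ ^ 2 := by nlinarith [norm_nonneg a]
      have h7 : ‖1 - conj a * (ρ : ℂ)‖ ^ 2 ≤ 4 := by nlinarith
      have h8 : 0 ≤ (1 - ‖a‖ ^ 2) * (1 - ρ ^ 2) := mul_nonneg (hρ2.le.trans h6) hρ2.le
      gcongr
    linarith
  obtain ⟨n, hn⟩ := exists_pow_lt_of_lt_one (pow_pos hz₀ 2) (show 1 - δ < 1 by linarith)
  refine exists_contDiffOn_aux (z₀ := ρ) (by rw [hρn]; exact hρ) hq (by linarith) n f hf h1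
    (fun a ha ha0 => ?_) hn
  by_contra! hlt
  have := hpos a (hρr.1.trans hlt) (mem_ball_zero_iff.1 ha)
  rw [ha0, norm_zero] at this
  exact lt_irrefl _ this

end

/-! ### The ideal compactification -/

section
open Metric

theorem range_diskModel : range diskModel = closedBall (0 : ℂ) 1 := Subtype.range_coe

theorem diskModel_symm_coe (z : ClosedDisk) : diskModel.symm (z : ℂ) = z := radialRetraction_coe z

/-- A self-map of the closed disk is smooth if it is given by a function which is smooth up to the
circle. -/
theorem contMDiff_diskModel_of_contDiffOn {r : ClosedDisk → ClosedDisk} {h : ℂ → ℂ}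
    (hh : ContDiffOn ℝ ∞ h (closedBall 0 1)) (hr : ∀ z : ClosedDisk, (r z : ℂ) = h z) :
    ContMDiff diskModel diskModel ∞ r := by
  have h1 : ContMDiff diskModel 𝓘(ℝ, ℂ) ∞ (fun z : ClosedDisk => h z) := by
    rw [← contMDiffOn_univ]
    refine hh.contMDiffOn.comp (diskModel.contMDiff).contMDiffOn fun z _ => z.2
  have h2 : ContMDiff diskModel diskModel ∞ (fun z : ClosedDisk => diskModel.symm (h z)) := by
    rw [← contMDiffOn_univ] at h1 ⊢
    refine (diskModel.contMDiffOn_symm).comp h1 fun z _ => ?_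
    rw [range_diskModel, mem_preimage, ← hr z]
    exact (r z).2
  convert! h2 using 1
  ext1 z
  rw [← hr z, diskModel_symm_coe]

section
variable {U : Type u} [TopologicalSpace U] [ChartedSpace ℂ U]

/-- The canonical diffeomorphism from the ideal compactification to the closed disk. -/
def idealDiffeo (φ : ConformalIso U) :
    IdealCompactification φ ≃ₘ⟮diskModel, diskModel⟯ ClosedDisk where
  toEquiv := (idealChart φ).toEquiv
  contMDiff_toFun := fun x => by
    have h : chartAt ClosedDisk x = (idealChart φ).toOpenPartialHomeomorph := rfl
    have h1 := contMDiffOn_chart (I := diskModel) (n := ∞) (x := x)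
    rw [h] at h1
    exact (contMDiffOn_univ.1 h1) x
  contMDiff_invFun := fun z => by
    have h : chartAt ClosedDisk ((idealChart φ).symm z) =
      (idealChart φ).toOpenPartialHomeomorph := rfl
    have h1 := contMDiffOn_chart_symm (I := diskModel) (n := ∞) (x := (idealChart φ).symm z)
    rw [h] at h1
    exact (contMDiffOn_univ.1 h1) z

theorem idealDiffeo_embed (φ : ConformalIso U) (x : U) :
    idealDiffeo φ (embed φ x) = toClosedDisk φ x := idealChart_embed φ x

theorem embed_eq (φ : ConformalIso U) (x : U) :
    embed φ x = (idealDiffeo φ).symm (toClosedDisk φ x) := by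
  rw [← idealDiffeo_embed, Diffeomorph.symm_apply_apply]

theorem mem_range_embed_iff (φ : ConformalIso U) {x : IdealCompactification φ} :
    x ∈ range (embed φ) ↔ ‖(idealChart φ x : ℂ)‖ < 1 := by
  constructor
  · rintro ⟨y, rfl⟩
    rw [idealChart_embed]
    exact mem_ball_zero_iff.1 (φ y).2
  · intro h
    refine ⟨φ.symm ⟨_, mem_ball_zero_iff.2 h⟩, (idealChart φ).injective (Subtype.ext ?_)⟩
    rw [idealChart_embed]
    exact congrArg (fun z : Disk => (z : ℂ)) (φ.apply_symm_apply _)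

theorem boundary_idealCompactification (φ : ConformalIso U) :
    diskModel.boundary (IdealCompactification φ) = (range (embed φ))ᶜ := by
  ext x
  have h : extChartAt diskModel x x = (idealChart φ x : ℂ) := rfl
  have hle : ‖(idealChart φ x : ℂ)‖ ≤ 1 := mem_closedBall_zero_iff.1 (idealChart φ x).2
  rw [mem_compl_iff, mem_range_embed_iff]
  change extChartAt diskModel x x ∈ frontier (range diskModel) ↔ _
  rw [h, range_diskModel, frontier_closedBall _ one_ne_zero, mem_sphere_zero_iff_norm]
  exact ⟨fun h => h.not_lt, fun h => hle.antisymm (not_lt.1 h)⟩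

theorem denseRange_embed (φ : ConformalIso U) : DenseRange (embed φ) :=
  UniformSpace.Completion.denseRange_coe (α := PulledBack φ)

theorem compactSpace_idealCompactification (φ : ConformalIso U) :
    CompactSpace (IdealCompactification φ) := (idealChart φ).symm.compactSpace

/-- The inclusion of the open disk into the closed disk. -/
def diskInclusion (z : Disk) : ClosedDisk := ⟨z, ball_subset_closedBall z.2⟩

theorem isLocalDiffeomorph_diskInclusion :
    IsLocalDiffeomorph 𝓘(ℝ, ℂ) diskModel ∞ diskInclusion := by
  classical
  intro z
  have ht : IsOpen {w : ClosedDisk | ‖(w : ℂ)‖ < 1} :=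
    isOpen_lt (continuous_norm.comp continuous_subtype_val) continuous_const
  let inv : ClosedDisk → Disk := fun w =>
    if h : (w : ℂ) ∈ ball (0 : ℂ) 1 then ⟨w, h⟩ else z
  have hinv : ∀ w : ClosedDisk, ‖(w : ℂ)‖ < 1 → ((inv w : Disk) : ℂ) = w := fun w hw => by
    simp only [inv, dif_pos (mem_ball_zero_iff.2 hw)]
  refine ⟨{ toFun := diskInclusion
            invFun := inv
            source := univ
            target := {w | ‖(w : ℂ)‖ < 1}
            map_source' := fun w _ => mem_ball_zero_iff.1 w.2
            map_target' := fun _ _ => mem_univ _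
            left_inv' := fun w _ => Subtype.ext (hinv _ (mem_ball_zero_iff.1 w.2))
            right_inv' := fun w hw => Subtype.ext (hinv w hw)
            open_source := isOpen_univ
            open_target := ht
            contMDiffOn_toFun := ?_
            contMDiffOn_invFun := ?_ }, mem_univ z, fun _ _ => rfl⟩
  · have h1 : ContMDiffOn 𝓘(ℝ, ℂ) diskModel ∞ (fun w : Disk => diskModel.symm (w : ℂ)) univ :=
      (diskModel.contMDiffOn_symm).comp contMDiff_subtype_val.contMDiffOn
        fun w _ => by rw [range_diskModel]; exact ball_subset_closedBall w.2
    exact h1.congr fun w _ => (diskModel_symm_coe (diskInclusion w)).symm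
  · intro w hw
    refine (ContMDiffWithinAt.subtypeVal_comp_iff Disk inv _ w).1 ?_
    exact ((diskModel.contMDiff (n := ∞)).contMDiffAt.contMDiffWithinAt).congr
      (fun y hy => hinv y hy) (hinv w hw)

end

/-- A holomorphic map of Riemann surfaces is smooth as a map of real surfaces. -/
theorem contMDiff_real_of_complex {X : Type u} {Y : Type v} [TopologicalSpace X]
    [ChartedSpace ℂ X] [TopologicalSpace Y] [ChartedSpace ℂ Y] {f : X → Y}
    (hf : ContMDiff 𝓘(ℂ) 𝓘(ℂ) ω f) : ContMDiff 𝓘(ℝ, ℂ) 𝓘(ℝ, ℂ) ∞ f := fun x => by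
  have h := contMDiffAt_iff.1 (hf x)
  refine contMDiffAt_iff.2 ⟨h.1, ?_⟩
  exact (h.2.restrict_scalars ℝ).of_le le_top

section
variable {U : Type u} [TopologicalSpace U] [ChartedSpace ℂ U]

theorem isLocalDiffeomorph_embed (φ : ConformalIso U) :
    IsLocalDiffeomorph 𝓘(ℝ, ℂ) diskModel ∞ (embed φ) := by
  let φ' : Diffeomorph 𝓘(ℝ, ℂ) 𝓘(ℝ, ℂ) U Disk ∞ :=
    { toEquiv := φ.toEquiv
      contMDiff_toFun := contMDiff_real_of_complex φ.contMDiff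
      contMDiff_invFun := contMDiff_real_of_complex φ.symm.contMDiff }
  have h : embed φ = (idealDiffeo φ).symm ∘ (diskInclusion ∘ φ') := funext (embed_eq φ)
  rw [h]
  exact fun x => ((φ'.isLocalDiffeomorph x).comp diskModel ClosedDisk
    (isLocalDiffeomorph_diskInclusion _)).comp diskModel (IdealCompactification φ)
      ((idealDiffeo φ).symm.isLocalDiffeomorph _)

theorem isOpenEmbedding_embed (φ : ConformalIso U) : IsOpenEmbedding (embed φ) := by
  refine IsOpenEmbedding.of_continuous_injective_isOpenMap
    (isLocalDiffeomorph_embed φ).contMDiff.continuous (fun x y h => ?_)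
    (isLocalDiffeomorph_embed φ).isOpenMap
  exact toClosedDisk_injective φ (by rw [← idealChart_embed, h, idealChart_embed])

variable {V : Type v} [TopologicalSpace V] [ChartedSpace ℂ V]

/-- A proper holomorphic map between surfaces conformally isomorphic to the disk extends to
a smooth self-map of the closed disk. -/
theorem exists_contMDiff_extension (φ : ConformalIso U) (ψ : ConformalIso V) {f : U → V}
    (hf : MDifferentiable 𝓘(ℂ) 𝓘(ℂ) f) (hp : IsProperMap f) :
    ∃ r : ClosedDisk → ClosedDisk, ContMDiff diskModel diskModel ∞ r ∧
      ∀ x, r (toClosedDisk φ x) = toClosedDisk ψ (f x) := by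
  classical
  let k : Disk → Disk := fun z => ψ (f (φ.symm z))
  have hkp : IsProperMap k := (ψ.toHomeomorph.isProperMap.comp hp).comp
    φ.symm.toHomeomorph.isProperMap
  have hkd : MDifferentiable 𝓘(ℂ) 𝓘(ℂ) fun z : Disk => (k z : ℂ) :=
    (contMDiff_subtype_val (n := ω)).mdifferentiable (by simp) |>.comp
      ((ψ.contMDiff.mdifferentiable (by simp)).comp
        (hf.comp (φ.symm.contMDiff.mdifferentiable (by simp))))
  -- the inverse of the inclusion of the disk; its values outside the disk are irrelevant
  let j : ℂ → Disk := fun z => if h : z ∈ ball (0 : ℂ) 1 then ⟨z, h⟩ else ⟨0, by simp⟩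
  have hj : ∀ z ∈ ball (0 : ℂ) 1, ((j z : Disk) : ℂ) = z := fun z hz => by
    simp only [j, dif_pos hz]
  have hjc : ∀ z : Disk, j z = z := fun z => Subtype.ext (hj z z.2)
  have hjd : ∀ z ∈ ball (0 : ℂ) 1, MDifferentiableAt 𝓘(ℂ) 𝓘(ℂ) j z := fun z hz => by
    refine ContMDiffAt.mdifferentiableAt (n := ∞)
      ((ContMDiffAt.subtypeVal_comp_iff Disk j z).1 ?_) (by simp)
    refine contMDiffAt_id.congr_of_eventuallyEq ?_
    filter_upwards [isOpen_ball.mem_nhds hz] with w hw using hj w hw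
  let F : ℂ → ℂ := fun z => k (j z)
  have hFd : DifferentiableOn ℂ F (ball 0 1) := fun z hz =>
    ((hkd (j z)).comp z (hjd z hz)).differentiableAt.differentiableWithinAt
  have hF1 : Tendsto (fun z => ‖F z‖) nearCircle (𝓝 1) := by
    rw [tendsto_order]
    refine ⟨fun r hr => ?_, fun r hr => ?_⟩
    · -- the preimage of a smaller closed disk is compact, as the map is proper
      have hK : IsCompact {w : Disk | ‖(w : ℂ)‖ ≤ r} := by
        rw [Topology.IsInducing.subtypeVal.isCompact_iff]
        have : Subtype.val '' {w : Disk | ‖(w : ℂ)‖ ≤ r} = closedBall (0 : ℂ) r := by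
          ext w
          simp only [mem_image, mem_ofPred_eq, mem_closedBall_zero_iff]
          exact ⟨by rintro ⟨y, hy, rfl⟩; exact hy,
            fun h => ⟨⟨w, mem_ball_zero_iff.2 (h.trans_lt hr)⟩, h, rfl⟩⟩
        exact this ▸ isCompact_closedBall _ _
      have hK2 := (hkp.isCompact_preimage hK)
      have hcont : Continuous fun w : Disk => ‖(w : ℂ)‖ := continuous_subtype_val.norm
      rw [eventually_nearCircle_iff]
      rcases (k ⁻¹' {w : Disk | ‖(w : ℂ)‖ ≤ r}).eq_empty_or_nonempty with he | hne
      · refine ⟨0, one_pos, fun z _ hz => ?_⟩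
        by_contra! hle
        exact notMem_empty (j z) (he.subset hle)
      · obtain ⟨w, -, hw⟩ := hK2.exists_isMaxOn hne hcont.continuousOn
        refine ⟨‖(w : ℂ)‖, mem_ball_zero_iff.1 w.2, fun z hz hz1 => ?_⟩
        by_contra! hle
        have h2 : ‖((j z : Disk) : ℂ)‖ ≤ ‖(w : ℂ)‖ := hw (a := j z) hle
        rw [hj z (mem_ball_zero_iff.2 hz1)] at h2
        exact absurd hz h2.not_gt
    · exact Eventually.of_forall fun z => (mem_ball_zero_iff.1 (k (j z)).2).trans hr
  obtain ⟨h, hh, hFh⟩ := exists_contDiffOn_closedBall hFd hF1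
  have hmaps : ∀ z : ClosedDisk, h z ∈ closedBall (0 : ℂ) 1 := fun z => by
    have h1 : MapsTo h (ball 0 1) (closedBall 0 1) := fun w hw => by
      rw [← hFh hw]; exact ball_subset_closedBall (k (j w)).2
    have h2 := h1.closure_of_continuousOn (by
      rw [closure_ball _ one_ne_zero]; exact hh.continuousOn)
    rw [closure_ball _ one_ne_zero, isClosed_closedBall.closure_eq] at h2
    exact h2 z.2
  refine ⟨fun z => ⟨h z, hmaps z⟩, contMDiff_diskModel_of_contDiffOn hh fun z => rfl, fun x => ?_⟩
  refine Subtype.ext ?_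
  change h (φ x) = ψ (f x)
  rw [← hFh (φ x).2]
  simp only [F, k, hjc, φ.symm_apply_apply]

/-- The change of the conformal isomorphism extends to a diffeomorphism of the closed disk. -/
theorem exists_diffeomorph_closedDisk (φ ψ : ConformalIso U) :
    ∃ D : ClosedDisk ≃ₘ⟮diskModel, diskModel⟯ ClosedDisk,
      ∀ x, D (toClosedDisk φ x) = toClosedDisk ψ x := by
  obtain ⟨r, hr, hrx⟩ := exists_contMDiff_extension φ ψ mdifferentiable_id isProperMap_id
  obtain ⟨s, hs, hsx⟩ := exists_contMDiff_extension ψ φ mdifferentiable_id isProperMap_id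
  simp only [id_eq] at hrx hsx
  refine ⟨{ toFun := r, invFun := s, contMDiff_toFun := hr, contMDiff_invFun := hs
            left_inv := ?_, right_inv := ?_ }, hrx⟩
  · refine congrFun ((denseRange_toClosedDisk φ).equalizer (hs.continuous.comp hr.continuous)
      continuous_id (funext fun x => ?_))
    simp [hrx, hsx]
  · refine congrFun ((denseRange_toClosedDisk ψ).equalizer (hr.continuous.comp hs.continuous)
      continuous_id (funext fun x => ?_))
    simp [hrx, hsx]

theorem exists_diffeomorph_extension (φ ψ : ConformalIso U) :
    ∃ Φ : IdealCompactification φ ≃ₘ⟮diskModel, diskModel⟯ ClosedDisk,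
      ∀ x, Φ (embed φ x) = toClosedDisk ψ x := by
  obtain ⟨D, hD⟩ := exists_diffeomorph_closedDisk φ ψ
  exact ⟨(idealDiffeo φ).trans D, fun x => by
    rw [Diffeomorph.coe_trans, Function.comp_apply, idealDiffeo_embed, hD]⟩

theorem existsUnique_diffeomorph (φ ψ : ConformalIso U) :
    ∃! Φ : IdealCompactification φ ≃ₘ⟮diskModel, diskModel⟯ IdealCompactification ψ,
      ∀ x, Φ (embed φ x) = embed ψ x := by
  obtain ⟨D, hD⟩ := exists_diffeomorph_extension φ ψ
  refine ⟨D.trans (idealDiffeo ψ).symm, fun x => ?_, fun Φ hΦ => ?_⟩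
  · rw [Diffeomorph.coe_trans, Function.comp_apply, hD, ← embed_eq]
  · refine Diffeomorph.ext fun y => congrFun ((denseRange_embed φ).equalizer Φ.continuous
      (D.trans (idealDiffeo ψ).symm).continuous (funext fun x => ?_)) y
    simp only [Function.comp_apply, hΦ, Diffeomorph.coe_trans, hD, ← embed_eq]

theorem exists_contMDiff_idealCompactification (φ : ConformalIso U) (ψ : ConformalIso V)
    {f : U → V} (hf : MDifferentiable 𝓘(ℂ) 𝓘(ℂ) f) (hp : IsProperMap f) :
    ∃ g : IdealCompactification φ → IdealCompactification ψ,
      ContMDiff diskModel diskModel ∞ g ∧ ∀ x, g (embed φ x) = embed ψ (f x) := by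
  obtain ⟨r, hr, hrx⟩ := exists_contMDiff_extension φ ψ hf hp
  refine ⟨(idealDiffeo ψ).symm ∘ r ∘ idealDiffeo φ,
    (idealDiffeo ψ).symm.contMDiff.comp (hr.comp (idealDiffeo φ).contMDiff), fun x => ?_⟩
  simp only [Function.comp_apply, idealDiffeo_embed, hrx, ← embed_eq]
end

section
variable {U : TopologicalSpace.Opens RiemannSphere} (φ : ConformalIso U)

theorem exists_primeEnd_equiv :
    ∃ β : PrimeEnd (U : Set RiemannSphere) ≃ diskModel.boundary (IdealCompactification φ),
      ∀ C : FundamentalChain (U : Set RiemannSphere),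
        ⋂ j, closure (embed φ '' {x : U | (x : RiemannSphere) ∈ C.nhd j})
          = {(β C.toPrimeEnd : IdealCompactification φ)} := by
  have hF := isDiskParam_ofDisk φ
  have hcut : HasSmallCuts (U : Set RiemannSphere) (ofDisk φ) := by
    have := (exists_isDiskParam_hasSmallCuts φ (Homeomorph.refl _)).2
    simpa using this
  obtain ⟨b, hb, hbe, hbs⟩ := exists_primeEnd_point hF hcut
  let pt : FundamentalChain (U : Set RiemannSphere) → ClosedDisk := fun C =>
    ⟨b C, mem_closedBall_zero_iff.2 (hb C).1.le⟩
  have hpt : ∀ C, (idealChart φ).symm (pt C) ∈ diskModel.boundary (IdealCompactification φ) :=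
    fun C => by
      rw [boundary_idealCompactification, mem_compl_iff, mem_range_embed_iff,
        Homeomorph.apply_symm_apply]
      exact (hb C).1.not_lt
  let β : PrimeEnd (U : Set RiemannSphere) → diskModel.boundary (IdealCompactification φ) :=
    Quotient.lift (fun C => ⟨(idealChart φ).symm (pt C), hpt C⟩) fun C D h =>
      Subtype.ext (congrArg (idealChart φ).symm (Subtype.ext ((hbe C D).1 h)))
  have hβ : Function.Bijective β := by
    constructor
    · rintro ⟨C⟩ ⟨D⟩ h
      refine Quotient.sound ((hbe C D).2 ?_)
      have h1 := (idealChart φ).symm.injective (congrArg Subtype.val h)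
      exact congrArg Subtype.val h1
    · rintro ⟨x, hx⟩
      have hx' := hx
      rw [boundary_idealCompactification, mem_compl_iff, mem_range_embed_iff] at hx'
      obtain ⟨C, hC⟩ := hbs (idealChart φ x)
        ((mem_closedBall_zero_iff.1 (idealChart φ x).2).antisymm (not_lt.1 hx'))
      refine ⟨Quotient.mk _ C, Subtype.ext ?_⟩
      change (idealChart φ).symm (pt C) = x
      rw [Homeomorph.symm_apply_eq]
      exact Subtype.ext hC
  refine ⟨Equiv.ofBijective β hβ, fun C => ?_⟩
  -- the chart of the compactification carries the closures to closures in the plane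
  have hind : IsInducing fun x : IdealCompactification φ => (idealChart φ x : ℂ) :=
    IsInducing.subtypeVal.comp (idealChart φ).isInducing
  have hcl : ∀ j, closure (embed φ '' {x : U | (x : RiemannSphere) ∈ C.nhd j}) =
      (fun x : IdealCompactification φ => (idealChart φ x : ℂ)) ⁻¹'
        closure (toDisk φ '' C.nhd j) := fun j => by
    rw [hind.closure_eq_preimage_closure_image, image_image]
    congr 2
    ext z
    constructor
    · rintro ⟨x, hx, rfl⟩
      exact ⟨x, hx, by simp only [toDisk_coe, idealChart_embed]; rfl⟩
    · rintro ⟨p, hp, rfl⟩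
      have hpU : p ∈ U := (C.nhd_subset j hp).1
      refine ⟨⟨p, hpU⟩, hp, ?_⟩
      simp only [idealChart_embed]
      exact (toDisk_coe φ ⟨p, hpU⟩).symm
  simp only [hcl]
  rw [← preimage_iInter, (hb C).2]
  change _ = {(idealChart φ).symm (pt C)}
  ext x
  rw [mem_preimage, mem_singleton_iff, mem_singleton_iff, Homeomorph.eq_symm_apply]
  exact ⟨fun h => Subtype.ext h, fun h => congrArg Subtype.val h⟩

theorem exists_continuous_extension
    [LocallyConnectedSpace (frontier (U : Set RiemannSphere))] :
    ∃ g : IdealCompactification φ → RiemannSphere, Continuous g ∧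
      (∀ x : U, g (embed φ x) = x) ∧ range g = closure (U : Set RiemannSphere) := by
  have hF := isDiskParam_ofDisk φ
  have hcl : closure (ball (0 : ℂ) 1) = closedBall 0 1 := closure_ball _ one_ne_zero
  have hcont : ContinuousOn (extendFrom (ball 0 1) (ofDisk φ)) (closedBall 0 1) := by
    refine continuousOn_extendFrom hcl.ge fun z hz => ?_
    rcases (mem_closedBall_zero_iff.1 hz).lt_or_eq with h | h
    · exact ⟨_, hF.continuousOn z (mem_ball_zero_iff.2 h)⟩
    · exact exists_tendsto_ofDisk φ h
  have hc : Continuous fun x : IdealCompactification φ =>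
      extendFrom (ball 0 1) (ofDisk φ) (idealChart φ x) :=
    hcont.comp_continuous (continuous_subtype_val.comp (idealChart φ).continuous)
      fun x => (idealChart φ x).2
  have hx : ∀ x : U, extendFrom (ball 0 1) (ofDisk φ) (idealChart φ (embed φ x)) = x := fun x => by
    rw [idealChart_embed]
    change extendFrom (ball 0 1) (ofDisk φ) (φ x) = x
    have h : (φ x : ℂ) ∈ ball (0 : ℂ) 1 := (φ x).2
    rw [extendFrom_eq (subset_closure h) (hF.continuousOn _ h), ofDisk_coe, φ.symm_apply_apply]
  refine ⟨_, hc, hx, ?_⟩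
  have := compactSpace_idealCompactification φ
  refine Subset.antisymm ?_ (closure_minimal (fun p hp => ⟨embed φ ⟨p, hp⟩, hx ⟨p, hp⟩⟩)
    (isCompact_range hc).isClosed)
  rw [← image_univ, ← (denseRange_embed φ).closure_range]
  refine (image_closure_subset_closure_image hc).trans (closure_mono ?_)
  rintro _ ⟨_, ⟨x, rfl⟩, rfl⟩
  simp only [hx]
  exact x.2
end

end

end IdealBoundary

end

theorem mainTheorem11 :
    -- the ideal compactification, its smooth structure, and independence of the choices
    (∀ (U : Type u) [TopologicalSpace U] [ChartedSpace ℂ U] [IsManifold 𝓘(ℂ) ω U]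
      (φ : IdealBoundary.ConformalIso U),
      CompactSpace (IdealBoundary.IdealCompactification φ) ∧
      IsOpenEmbedding (IdealBoundary.embed φ) ∧
      DenseRange (IdealBoundary.embed φ) ∧
      IsLocalDiffeomorph 𝓘(ℝ, ℂ) IdealBoundary.diskModel ∞ (IdealBoundary.embed φ) ∧
      IdealBoundary.diskModel.boundary (IdealBoundary.IdealCompactification φ) =
        (range (IdealBoundary.embed φ))ᶜ ∧
      (∀ ψ : IdealBoundary.ConformalIso U,
        ∃ Φ : IdealBoundary.IdealCompactification φ
            ≃ₘ⟮IdealBoundary.diskModel, IdealBoundary.diskModel⟯ IdealBoundary.ClosedDisk,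
          ∀ x, Φ (IdealBoundary.embed φ x) = IdealBoundary.toClosedDisk ψ x) ∧
      (∀ ψ : IdealBoundary.ConformalIso U,
        ∃! Φ : IdealBoundary.IdealCompactification φ
            ≃ₘ⟮IdealBoundary.diskModel, IdealBoundary.diskModel⟯
              IdealBoundary.IdealCompactification ψ,
          ∀ x, Φ (IdealBoundary.embed φ x) = IdealBoundary.embed ψ x)) ∧
    -- naturality
    (∀ (U : Type u) [TopologicalSpace U] [ChartedSpace ℂ U] [IsManifold 𝓘(ℂ) ω U]
      (V : Type v) [TopologicalSpace V] [ChartedSpace ℂ V] [IsManifold 𝓘(ℂ) ω V]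
      (φ : IdealBoundary.ConformalIso U) (ψ : IdealBoundary.ConformalIso V) (f : U → V),
      MDifferentiable 𝓘(ℂ) 𝓘(ℂ) f → IsProperMap f →
      ∃ g : IdealBoundary.IdealCompactification φ → IdealBoundary.IdealCompactification ψ,
        ContMDiff IdealBoundary.diskModel IdealBoundary.diskModel ∞ g ∧
        ∀ x, g (IdealBoundary.embed φ x) = IdealBoundary.embed ψ (f x)) ∧
    -- open subsets of the Riemann sphere
    (∀ (U : TopologicalSpace.Opens IdealBoundary.RiemannSphere)
      (φ : IdealBoundary.ConformalIso U),
      (∃ β : IdealBoundary.PrimeEnd (U : Set IdealBoundary.RiemannSphere) ≃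
          IdealBoundary.diskModel.boundary (IdealBoundary.IdealCompactification φ),
        ∀ C : IdealBoundary.FundamentalChain (U : Set IdealBoundary.RiemannSphere),
          ⋂ j, closure (IdealBoundary.embed φ '' {x : U | (x : IdealBoundary.RiemannSphere) ∈ C.nhd j})
            = {(β C.toPrimeEnd : IdealBoundary.IdealCompactification φ)}) ∧
      (LocallyConnectedSpace (frontier (U : Set IdealBoundary.RiemannSphere)) →
        ∃ g : IdealBoundary.IdealCompactification φ → IdealBoundary.RiemannSphere,
          Continuous g ∧
          (∀ x : U, g (IdealBoundary.embed φ x) = (x : IdealBoundary.RiemannSphere)) ∧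
          range g = closure (U : Set IdealBoundary.RiemannSphere))) := by
  refine ⟨fun U _ _ _ φ => ⟨IdealBoundary.compactSpace_idealCompactification φ,
    IdealBoundary.isOpenEmbedding_embed φ, IdealBoundary.denseRange_embed φ,
    IdealBoundary.isLocalDiffeomorph_embed φ, IdealBoundary.boundary_idealCompactification φ,
    IdealBoundary.exists_diffeomorph_extension φ, IdealBoundary.existsUnique_diffeomorph φ⟩,
    fun U _ _ _ V _ _ _ φ ψ f hf hp =>
      IdealBoundary.exists_contMDiff_idealCompactification φ ψ hf hp,
    fun U φ => ⟨IdealBoundary.exists_primeEnd_equiv φ, fun _ =>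
      IdealBoundary.exists_continuous_extension φ⟩⟩
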